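/- **Setting.** For a probability measure $\mu$ on $(0,\infty)$ with finite mean $m_\mu$ put $\nu_\mu(dt)=m_\mu^{-1}\mu((t,\infty))\,dt$ on $(0,\infty)$. A stationary renewal process $SR(\mu)$ is a counting process $N_t=\#\{k\ge 1: T_k\le t\}$, $t\ge 0$, where $T_1\sim\nu_\mu$, $T_{k+1}-T_k\sim\mu$ for $k\ge1$, and all these variables are independent. For $\eta\in\{0,1\}^{\mathbb Z}$ let $C(\eta,i)\subset\mathbb Z$ be the connected component of occupied sites ($\eta=1$) containing $i$, with $C(\eta,i)=\emptyset$ if $\eta(i)=0$. Given independent $SR(\mu_S)$-processes $N^S(i)$ and $SR(\mu_M)$-processes $N^M(i)$, $i\in\mathbb Z$, a forest fire process $FF(\mu_S,\mu_M)$ is a $\{0,1\}$-valued process $(\eta_t(i))_{t\ge0,i\in\mathbb Z}$, a.s. càdlàg in $t$ for each $i$, such that a.s., for all $t\ge 0$ and $i\in\mathbb Z$, $$\eta_t(i)=\int_0^t \mathbf 1_{\{\eta_{s-}(i)=0\}}\,dN^S_s(i)-\sum_{j\in\mathbb Z}\int_0^t\mathbf 1_{\{j\in C(\eta_{s-},i)\}}\,dN^M_s(j).$$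 **Assumptions.** $(H_M)$: $\mu_M^1$ is a probability measure on $(0,\infty)$ with mean $1$, and for $\lambda\in(0,1]$, $\mu_M^\lambda$ is its image under $t\mapsto t/\lambda$. $(H_S(0))$: $\mu_S$ is a probability measure on $(0,\infty)$ with finite mean and unbounded support and, with $\nu_S=\nu_{\mu_S}$, for all $t>0$, $\lim_{x\to\infty}\nu_S((x,\infty))/\nu_S((tx,\infty))=1$. **Rescaled clusters.** Let $\phi_S:(0,\infty)\to(0,\infty)$ be the inverse of the bijection $t\mapsto t/\nu_S((t,\infty))$, $\mathbf a_\lambda=\phi_S(1/\lambda)$ (so $\lambda\mathbf a_\lambda=\nu_S((\mathbf a_\lambda,\infty))$) and $\mathbf n_\lambda=\lfloor 1/(\lambda\mathbf a_\lambda)\rfloor$. With $\alpha\{a,\dots,b\}:=[\alpha a,\alpha b]$ and $\alpha\emptyset:=\emptyset$, set, for an $FF(\mu_S,\mu_M^\lambda)$-process $\eta^\lambda$, $$D^\lambda_t(x)=\frac1{\mathbf n_\lambda}\,C\big(\eta^\lambda_{\mathbf a_\lambda t},\lfloor \mathbf n_\lambda x\rfloor\big),\qquad t\ge0,\ x\in\mathbb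 R.$$ **Limit process.** Let $\pi_S$ be a Poisson measure on $\mathbb R$ with intensity $dx$. The $LFF(0)$-process is $Y_t(x)=\mathbf 1_{\{\pi_S(\{x\})=0\}}$ for all $t\ge0$, $x\in\mathbb R$, and $D_t(x)=[l_t(x),r_t(x)]$ with $l_t(x)=\sup\{y\le x:Y_t(y)=0\}$ and $r_t(x)=\inf\{y\ge x:Y_t(y)=0\}$. So the clusters are the intervals between consecutive points of $\pi_S$ and do not change in time. **Distances.** Let $\mathcal I=\{[a,b]:a\le b\}$; put $\boldsymbol\delta([a,b],[c,d])=|a-c|+|b-d|$, $\boldsymbol\delta([a,b],\emptyset)=\boldsymbol\delta(\emptyset,[a,b])=b-a$, $\boldsymbol\delta(\emptyset,\emptyset)=0$, and $\boldsymbol\delta_T(I,J)=\int_0^T\boldsymbol\delta(I_t,J_t)\,dt$ for $I,J\in\mathbb D([0,T],\mathcal I\cup\{\emptyset\})$, the set of càdlàg functions from $[0,T]$ to $\mathcal I\cup\{\emptyset\}$. Products carry the sum of the distances of the coordinates. **Theorem.** Assume $(H_M)$ and $(H_S(0))$. For each $\lambda\in(0,1]$ let $(D^\lambda_t(x))_{t\ge0,x\in\mathbb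 R}$ be associated with an $FF(\mu_S,\mu_M^\lambda)$-process, and let $(D_t(x))_{t\ge0,x\in\mathbb R}$ be associated with an $LFF(0)$-process. (a) For any $T>0$ and any $x_1,\dots,x_p\in\mathbb R$, $(D^\lambda_t(x_i))_{t\in[0,T],\,i=1,\dots,p}$ converges in law to $(D_t(x_i))_{t\in[0,T],\,i=1,\dots,p}$ in $\mathbb D([0,T],\mathcal I\cup\{\emptyset\})^p$ as $\lambda\to0$, where $\mathbb D([0,T],\mathcal I\cup\{\emptyset\})$ is endowed with $\boldsymbol\delta_T$. (b) For any $(t_1,x_1),\dots,(t_p,x_p)\in(0,\infty)\times\mathbb R$, $(D^\lambda_{t_i}(x_i))_{i=1,\dots,p}$ converges in law to $(D_{t_i}(x_i))_{i=1,\dots,p}$ in $(\mathcal I\cup\{\emptyset\})^p$ as $\lambda\to0$, where $\mathcal I\cup\{\emptyset\}$ is endowed with $\boldsymbol\delta$. -/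

import Mathlib

open MeasureTheory ProbabilityTheory Filter Topology Set
open scoped ENNReal NNReal

namespace ForestFire

noncomputable section

/-! ### Laws on the half-line and stationary renewal processes -/

/-- A probability measure on `(0, ∞)` with finite expectation. -/
structure IsPositiveLaw (μ : Measure ℝ) : Prop where
  isProbabilityMeasure : IsProbabilityMeasure μ
  pos : μ (Iic 0) = 0
  integrable : Integrable (fun t : ℝ => t) μ

/-- The expectation `m_μ` of `μ`. -/
def mean (μ : Measure ℝ) : ℝ := ∫ t, t ∂μ

/-- The law `ν_μ(dt) = m_μ⁻¹ μ((t, ∞)) dt` on `(0, ∞)`. -/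
def delayLaw (μ : Measure ℝ) : Measure ℝ :=
  (volume.restrict (Ioi 0)).withDensity (fun t => ENNReal.ofReal ((mean μ)⁻¹ * μ.real (Ioi t)))

/-- The delays of a sequence of marks `T 0, T 1, …`: the first mark, then the successive
differences. -/
def gap {Ω : Type*} (T : ℕ → Ω → ℝ) : ℕ → Ω → ℝ
  | 0 => T 0
  | k + 1 => fun ω => T (k + 1) ω - T k ω

/-- `T 0, T 1, …` are the successive marks of a stationary renewal process `SR(μ)` on the
half-line: the delays are independent, the first one has law `ν_μ` and all others have law `μ`.
The counting process is `N_t = #{k | T k ≤ t}`, so that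
`∫_0^t f(s) dN_s = ∑_{k : T k ≤ t} f(T k)`. -/
structure IsStationaryRenewal {Ω : Type*} [MeasurableSpace Ω] (P : Measure Ω) (μ : Measure ℝ)
    (T : ℕ → Ω → ℝ) : Prop where
  measurable : ∀ k, Measurable (T k)
  law_first : P.map (gap T 0) = delayLaw μ
  law_gap : ∀ k, P.map (gap T (k + 1)) = μ
  indep : iIndepFun (gap T) P

/-! ### The forest fire process on `ℤ` -/

/-- The occupied connected component of `i` in the configuration `η` (`true` = occupied): the set
of the `j` such that all sites between `i` and `j`, both included, are occupied. It is empty if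
`i` is vacant. -/
def cluster (η : ℤ → Bool) (i : ℤ) : Set ℤ :=
  {j | ∀ k ∈ Set.uIcc i j, η k = true}

/-- The configuration just before time `s`, that is `(η_{s-}(i))_i`. -/
def before (η : ℝ → ℤ → Bool) (s : ℝ) : ℤ → Bool :=
  fun i => Function.leftLim (fun u => η u i) s

/-- `f` is right continuous with left limits on `[0, ∞)`. -/
def IsCadlag (f : ℝ → Bool) : Prop :=
  (∀ t, 0 ≤ t → Tendsto f (𝓝[>] t) (𝓝 (f t))) ∧
    ∀ t, 0 < t → ∃ b, Tendsto f (𝓝[<] t) (𝓝 b)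

/-- The effective seeds on `i` up to time `t`: those that fall when `i` is vacant.
Here `s i 0, s i 1, …` are the times at which a seed falls on `i`. -/
def effectiveSeeds (s : ℤ → ℕ → ℝ) (η : ℝ → ℤ → Bool) (t : ℝ) (i : ℤ) : Set ℕ :=
  {k | s i k ≤ t ∧ before η (s i k) i = false}

/-- The matches up to time `t` that fall on some site of the cluster of `i`.
Here `m j 0, m j 1, …` are the times at which a match falls on `j`. -/
def effectiveMatches (m : ℤ → ℕ → ℝ) (η : ℝ → ℤ → Bool) (t : ℝ) (i : ℤ) : Set (ℤ × ℕ) :=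
  {q | m q.1 q.2 ≤ t ∧ q.1 ∈ cluster (before η (m q.1 q.2)) i}

/-- `η` is a `FF(μS, μM)`-process driven by the seed times `S` and the match times `M`: these are
independent stationary renewal processes, every site is a.s. càdlàg, and a.s., for all `t ≥ 0`
and all `i`,
`η_t(i) = ∫_0^t 1{η_{s-}(i) = 0} dN^S_s(i) - ∑_j ∫_0^t 1{j ∈ C(η_{s-}, i)} dN^M_s(j)`. -/
structure IsForestFire {Ω : Type*} [MeasurableSpace Ω] (P : Measure Ω) (μS μM : Measure ℝ)
    (S M : ℤ → ℕ → Ω → ℝ) (η : Ω → ℝ → ℤ → Bool) : Prop where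
  seeds : ∀ i, IsStationaryRenewal P μS (S i)
  fires : ∀ i, IsStationaryRenewal P μM (M i)
  indep : iIndepFun (fun (q : ℤ ⊕ ℤ) (ω : Ω) (k : ℕ) => Sum.elim S M q k ω) P
  measurable : ∀ t i, Measurable (fun ω => η ω t i)
  cadlag : ∀ i, ∀ᵐ ω ∂P, IsCadlag (fun t => η ω t i)
  equation : ∀ᵐ ω ∂P, ∀ t, 0 ≤ t → ∀ i,
    (effectiveMatches (fun j k => M j k ω) (η ω) t i).Finite ∧
    (if η ω t i = true then (1 : ℤ) else 0) =
      ((effectiveSeeds (fun j k => S j k ω) (η ω) t i).ncard : ℤ)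
        - ((effectiveMatches (fun j k => M j k ω) (η ω) t i).ncard : ℤ)

/-! ### Assumptions -/

/-- `(H_M)` for the law `μ_M^1`: it is a probability measure on `(0, ∞)` with expectation `1`. -/
structure HypM (μ : Measure ℝ) : Prop where
  isPositiveLaw : IsPositiveLaw μ
  mean_eq : mean μ = 1

/-- The law `μ_M^l`: the image of `μ_M^1` by `t ↦ t / l`. -/
def slowedLaw (μ : Measure ℝ) (l : ℝ) : Measure ℝ := μ.map (fun t => t / l)

/-- `(H_S(0))`: a probability measure on `(0, ∞)` with finite expectation, whose support is
unbounded, and such that `ν_S((x, ∞)) / ν_S((t x, ∞)) → 1` as `x → ∞`, for all `t > 0`. -/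
structure HypSZero (μ : Measure ℝ) : Prop where
  isPositiveLaw : IsPositiveLaw μ
  unbounded : ¬ BddAbove μ.support
  slowlyVarying : ∀ t, 0 < t →
    Tendsto (fun x => (delayLaw μ).real (Ioi x) / (delayLaw μ).real (Ioi (t * x))) atTop (𝓝 1)

/-! ### Scales and rescaled clusters -/

/-- The inverse `φ_S : (0, ∞) → (0, ∞)` of the bijection `t ↦ t / ν_S((t, ∞))` of `(0, ∞)`. -/
def phi (μS : Measure ℝ) : ℝ → ℝ :=
  Function.invFunOn (fun t => t / (delayLaw μS).real (Ioi t)) (Ioi 0)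

/-- The time scale `a_l = φ_S(1 / l)`. -/
def timeScale (μS : Measure ℝ) (l : ℝ) : ℝ := phi μS (1 / l)

/-- The space scale `n_l = ⌊1 / (l a_l)⌋`. -/
def spaceScale (μS : Measure ℝ) (l : ℝ) : ℕ := ⌊1 / (l * timeScale μS l)⌋₊

/-- `n⁻¹ C`, with the convention `n⁻¹ {a, …, b} = [a / n, b / n]` and `n⁻¹ ∅ = ∅`. -/
def rescale (n : ℕ) (C : Set ℤ) : Set ℝ :=
  convexHull ℝ ((fun j : ℤ => (j : ℝ) / n) '' C)

/-- The rescaled cluster `D^l_t(x) = n_l⁻¹ C(η_{a_l t}, ⌊n_l x⌋)`. -/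
def rescaledCluster (μS : Measure ℝ) (l : ℝ) (η : ℝ → ℤ → Bool) (t x : ℝ) : Set ℝ :=
  rescale (spaceScale μS l) (cluster (η (timeScale μS l * t)) ⌊(spaceScale μS l : ℝ) * x⌋)

/-! ### The limit process -/

/-- `π` is a Poisson (random) measure on `ℝ` with intensity measure `dx`. -/
structure IsPoissonMeasure {Ω : Type*} [MeasurableSpace Ω] (P : Measure Ω)
    (π : Ω → Measure ℝ) : Prop where
  measurable : ∀ B, MeasurableSet B → Measurable (fun ω => π ω B)
  law : ∀ B, MeasurableSet B → volume B ≠ ∞ →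
    P.map (fun ω => π ω B) =
      (poissonMeasure (volume B).toNNReal).map (fun k : ℕ => (k : ℝ≥0∞))
  indep : ∀ (m : ℕ) (B : Fin m → Set ℝ), (∀ i, MeasurableSet (B i)) →
    Pairwise (fun i j => Disjoint (B i) (B j)) → iIndepFun (fun i ω => π ω (B i)) P

open Classical in
/-- The `LFF(0)`-process: `Y_t(x) = 1{π_S({x}) = 0}` for all `t`. -/
def limitProcess (π : Measure ℝ) (_t x : ℝ) : Bool := decide (π {x} = 0)

/-- The occupied component around `x` in a configuration `Y` on `ℝ`: `[l(Y, x), r(Y, x)]` with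
`l(Y, x) = sup {y ≤ x | Y(y) = 0}` and `r(Y, x) = inf {y ≥ x | Y(y) = 0}`. -/
def realCluster (Y : ℝ → Bool) (x : ℝ) : Set ℝ :=
  Icc (sSup {y | y ≤ x ∧ Y y = false}) (sInf {y | x ≤ y ∧ Y y = false})

/-- The cluster `D_t(x) = C(Y_t, x)` of the `LFF(0)`-process. -/
def limitCluster (π : Measure ℝ) (t x : ℝ) : Set ℝ := realCluster (limitProcess π t) x

/-! ### Spaces of intervals and of paths, and convergence in law -/

/-- The set `𝓘 ∪ {∅}`, where `𝓘 = {[a, b] | a ≤ b}`. -/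
def intervals : Set (Set ℝ) := {I | I = ∅ ∨ ∃ a b, a ≤ b ∧ I = Icc a b}

open Classical in
/-- `δ([a, b], [c, d]) = |a - c| + |b - d|`, `δ([a, b], ∅) = δ(∅, [a, b]) = b - a` and
`δ(∅, ∅) = 0`. -/
def intervalDist (I J : Set ℝ) : ℝ :=
  if I = ∅ then (if J = ∅ then 0 else sSup J - sInf J)
  else if J = ∅ then sSup I - sInf I
  else |sInf I - sInf J| + |sSup I - sSup J|

/-- `J s` tends to `I` along `l`: both endpoints converge if `I` is nonempty, and `J s` is
eventually empty if `I` is empty. -/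
def TendstoInterval (J : ℝ → Set ℝ) (l : Filter ℝ) (I : Set ℝ) : Prop :=
  (∀ᶠ s in l, J s = ∅ ↔ I = ∅) ∧ Tendsto (fun s => intervalDist (J s) I) l (𝓝 0)

/-- The paths `J` whose restriction to `[0, T]` belongs to `𝔻([0, T], 𝓘 ∪ {∅})`, the set of
càdlàg functions from `[0, T]` to `𝓘 ∪ {∅}`. -/
def cadlagPaths (T : ℝ) : Set (ℝ → Set ℝ) :=
  {J | (∀ t ∈ Icc 0 T, J t ∈ intervals) ∧
    (∀ t ∈ Ico 0 T, TendstoInterval J (𝓝[>] t) (J t)) ∧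
    ∀ t ∈ Ioc 0 T, ∃ I ∈ intervals, TendstoInterval J (𝓝[<] t) I}

/-- `δ_T(I, J) = ∫_0^T δ(I_t, J_t) dt`. -/
def pathDist (T : ℝ) (I J : ℝ → Set ℝ) : ℝ := ∫ t in (0 : ℝ)..T, intervalDist (I t) (J t)

/-- `F` is a bounded function on `E`, continuous for the distance `d`. -/
def IsTestFunction {V : Type*} (E : Set V) (d : V → V → ℝ) (F : V → ℝ) : Prop :=
  (∃ C, ∀ v ∈ E, |F v| ≤ C) ∧
    ∀ v ∈ E, ∀ ε > 0, ∃ r > 0, ∀ w ∈ E, d v w < r → |F w - F v| < ε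

/-- Convergence in law, as `l ∈ (0, 1]` tends to `0`, of the random elements `X l` of `E` to the
random element `Y` of `E`, where `E` is endowed with the distance `d`: the expectations of all
bounded continuous functions converge. -/
structure TendstoInLaw {V : Type*} (E : Set V) (d : V → V → ℝ)
    {Ω : ℝ → Type*} [∀ l, MeasurableSpace (Ω l)] (P : ∀ l, Measure (Ω l)) (X : ∀ l, Ω l → V)
    {Ω' : Type*} [MeasurableSpace Ω'] (P' : Measure Ω') (Y : Ω' → V) : Prop where
  mem : ∀ l ∈ Ioc (0 : ℝ) 1, ∀ᵐ ω ∂(P l), X l ω ∈ E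
  mem_limit : ∀ᵐ ω ∂P', Y ω ∈ E
  integrable : ∀ F, IsTestFunction E d F →
    ∀ l ∈ Ioc (0 : ℝ) 1, Integrable (fun ω => F (X l ω)) (P l)
  integrable_limit : ∀ F, IsTestFunction E d F → Integrable (fun ω => F (Y ω)) P'
  tendsto : ∀ F, IsTestFunction E d F →
    Tendsto (fun l => ∫ ω, F (X l ω) ∂(P l)) (𝓝[>] 0) (𝓝 (∫ ω, F (Y ω) ∂P'))

end

end ForestFire

/-! Slow variation of the tail of `ν_S` removes time from the limit. Since `l a_l = ν_S((a_l, ∞))`,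
a site has received no seed by time `a_l t` with probability `ν_S((a_l t, ∞)) ~ l a_l ~ 1 / n_l`,
whatever `t > 0`. On the space scale `n_l` the unseeded sites therefore look like a Poisson process
of rate one, and like the same one at all positive times: `n_l ν_S((a_l s, a_l t]) → 0`, so with
high probability no site of a window of order `n_l` gets its first seed between `a_l s` and `a_l t`
(`HypSZero.tendsto_spaceScale_mul_delayLaw_Ioc`).

The same estimate controls the other sites. A stationary renewal process that has a mark before `H`
misses a given interval of length `δ` with probability at most `ν_S((δ, H])`
(`IsStationaryRenewal.measure_no_mark_le`). Hence, for any fixed `K`, with high probability each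
site of the window that is seeded by time `a_l T` is seeded during every time interval of length `2
a_l T / K` before `a_l T`. Matches fall on the window at a rate of order `n_l l ~ 1 / a_l`, so their
number before `a_l T` is tight. A fire cannot cross an unseeded site, and what it burns is refilled
within a macroscopic time `2 T / K`. Outside a short set of times, the cluster is thus exactly the
interval between two consecutive unseeded sites (`IsRegularPath.cluster_eq`).

For the convergence in law, space is cut into cells of length `h`. Whether the cells contain an
unseeded site is decided by independent events whose probabilities converge to those of the Poisson
measure, and the clusters, before and in the limit, are within a multiple of `h` of an interval read
off the set of charged cells. `tendstoInLaw_of_discretization` turns this into convergence in law,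
because a test function is uniformly continuous near the compact family of bounded intervals. At
fixed positive times one asks that no match falls on the window shortly before; for paths one
integrates over time. -/

namespace ForestFire

/-! ### Renewal theory -/

section Renewal

variable {Ω : Type*} [MeasurableSpace Ω] {P : Measure Ω} {μ : Measure ℝ} {T : ℕ → Ω → ℝ}

lemma IsPositiveLaw.ae_pos (h : IsPositiveLaw μ) : ∀ᵐ t ∂μ, 0 < t := by
  rw [ae_iff]
  convert h.pos using 2
  ext t
  simp

lemma IsPositiveLaw.mean_pos (h : IsPositiveLaw μ) : 0 < mean μ := by
  have := h.isProbabilityMeasure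
  have h0 : 0 ≤ᵐ[μ] fun t : ℝ => t := h.ae_pos.mono fun t ht => ht.le
  refine (integral_pos_iff_support_of_nonneg_ae h0 h.integrable).2 ?_
  have : μ (Function.support fun t : ℝ => t) = 1 := by
    rw [prob_compl_eq_zero_iff₀ (by measurability) |>.symm]
    refine measure_mono_null ?_ h.pos
    intro t ht
    simp at ht
    simp [ht]
  rw [this]
  exact one_pos

/-- The measure `m_μ⁻¹ dt` on the half-line, which dominates the renewal measure. -/
noncomputable def renewalBound (μ : Measure ℝ) : Measure ℝ :=
  ENNReal.ofReal (mean μ)⁻¹ • volume.restrict (Ioi 0)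

lemma renewalBound_apply {B : Set ℝ} (hB : MeasurableSet B) :
    renewalBound μ B = ENNReal.ofReal (mean μ)⁻¹ * ∫⁻ u, B.indicator 1 u * (Ioi 0).indicator 1 u := by
  rw [renewalBound, Measure.smul_apply, Measure.restrict_apply hB, smul_eq_mul]
  congr 1
  rw [← lintegral_indicator_one (hB.inter measurableSet_Ioi)]
  simp [Set.inter_indicator_one]

lemma delayLaw_apply [IsProbabilityMeasure μ] (h : 0 < mean μ) {B : Set ℝ} (hB : MeasurableSet B) :
    delayLaw μ B = ENNReal.ofReal (mean μ)⁻¹ *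
      ∫⁻ u, B.indicator 1 u * ((Ioi 0).indicator 1 u * μ (Ioi u)) := by
  have hm : Measurable fun u : ℝ => μ (Ioi u) :=
    (show Antitone fun u : ℝ => μ (Ioi u) from
      fun a b hab => measure_mono (Ioi_subset_Ioi hab)).measurable
  rw [delayLaw, withDensity_apply _ hB, Measure.restrict_restrict hB,
    ← lintegral_indicator (hB.inter measurableSet_Ioi), ← lintegral_const_mul _ (by
      exact (measurable_one.indicator hB).mul ((measurable_one.indicator measurableSet_Ioi).mul hm))]
  congr 1
  ext u
  by_cases h1 : u ∈ B <;> by_cases h2 : u ∈ Ioi (0 : ℝ) <;>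
    simp [Set.indicator, h1]
  · simp at h2
    rw [if_pos h2, if_pos h2, ENNReal.ofReal_mul (by positivity), measureReal_def,
      ENNReal.ofReal_toReal (measure_ne_top _ _)]
  · simp at h2
    simp [not_lt.2 h2]

lemma renewalBound_conv_apply [IsProbabilityMeasure μ] {B : Set ℝ} (hB : MeasurableSet B) :
    (renewalBound μ ∗ μ) B = ENNReal.ofReal (mean μ)⁻¹ * ∫⁻ u, B.indicator 1 u * μ (Iio u) := by
  have hf : Measurable (B.indicator (1 : ℝ → ℝ≥0∞)) := measurable_one.indicator hB
  have hi : Measurable ((Ioi (0 : ℝ)).indicator (1 : ℝ → ℝ≥0∞)) :=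
    measurable_one.indicator measurableSet_Ioi
  have h1 : Measurable fun q : ℝ × ℝ => B.indicator (1 : ℝ → ℝ≥0∞) (q.1 + q.2) :=
    hf.comp (measurable_fst.add measurable_snd)
  rw [← lintegral_indicator_one hB, Measure.lintegral_conv hf, renewalBound,
    lintegral_smul_measure, smul_eq_mul, ← lintegral_indicator measurableSet_Ioi]
  congr 1
  have h2 : ∀ x : ℝ, (Ioi (0 : ℝ)).indicator
      (fun a => ∫⁻ y, B.indicator (1 : ℝ → ℝ≥0∞) (a + y) ∂μ) x =
      ∫⁻ y, (Ioi (0 : ℝ)).indicator 1 x * B.indicator (1 : ℝ → ℝ≥0∞) (x + y) ∂μ := by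
    intro x
    by_cases hx : 0 < x <;> simp [indicator, hx]
  simp_rw [h2]
  rw [lintegral_lintegral_swap ((hi.comp measurable_fst).mul h1).aemeasurable]
  have h3 : ∀ y : ℝ, ∫⁻ x, (Ioi (0 : ℝ)).indicator 1 x * B.indicator (1 : ℝ → ℝ≥0∞) (x + y) =
      ∫⁻ u, (Ioi (0 : ℝ)).indicator 1 (u - y) * B.indicator (1 : ℝ → ℝ≥0∞) u := by
    intro y
    rw [← lintegral_add_right_eq_self (fun u => (Ioi (0 : ℝ)).indicator 1 (u - y) *
      B.indicator (1 : ℝ → ℝ≥0∞) u) y]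
    simp only [add_sub_cancel_right]
  simp_rw [h3]
  rw [lintegral_lintegral_swap
    ((hi.comp (measurable_snd.sub measurable_fst)).mul (hf.comp measurable_snd)).aemeasurable]
  refine lintegral_congr fun u => ?_
  have h4 : Measurable fun x : ℝ => (Ioi (0 : ℝ)).indicator (1 : ℝ → ℝ≥0∞) (u - x) :=
    hi.comp (measurable_const.sub measurable_id)
  rw [lintegral_mul_const _ h4, mul_comm, ← lintegral_indicator_one measurableSet_Iio]
  congr 2
  ext y
  simp [indicator, sub_pos]

/-- At `u > 0` the two densities on the left are `m_μ⁻¹ μ((u, ∞))` and `m_μ⁻¹ μ((-∞, u))`, whose sum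
is at most `m_μ⁻¹`, with equality unless `u` is an atom of `μ`. This is the invariance that makes
the process stationary; the inequality is all that the induction in `sum_map_le` needs. -/
lemma IsPositiveLaw.delayLaw_add_conv_le (h : IsPositiveLaw μ) :
    delayLaw μ + renewalBound μ ∗ μ ≤ renewalBound μ := by
  have := h.isProbabilityMeasure
  refine Measure.le_iff.2 fun B hB => ?_
  have hm : Measurable fun u : ℝ => μ (Iio u) :=
    (show Monotone fun u : ℝ => μ (Iio u) from
      fun a b hab => measure_mono (Iio_subset_Iio hab)).measurable
  rw [Measure.add_apply, delayLaw_apply h.mean_pos hB, renewalBound_conv_apply hB,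
    renewalBound_apply hB, ← mul_add, ← lintegral_add_right (μ := volume)
      (fun u => B.indicator 1 u * ((Ioi 0).indicator 1 u * μ (Ioi u)))
      (g := fun u => B.indicator 1 u * μ (Iio u)) ((measurable_one.indicator hB).mul hm)]
  gcongr with u
  rw [← mul_add]
  gcongr
  by_cases hu : 0 < u
  · simp only [indicator, mem_Ioi, hu, if_true, Pi.one_apply, one_mul]
    rw [← measure_union (by
      rw [Set.disjoint_left]; intro x hx hx'; exact lt_asymm (mem_Ioi.1 hx) hx') measurableSet_Iio]
    exact prob_le_one
  · have : μ (Iio u) = 0 := measure_mono_null (fun x hx => (le_of_lt hx).trans (not_lt.1 hu)) h.pos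
    simp [indicator, hu, this]

omit [MeasurableSpace Ω] in
lemma sum_gap (T : ℕ → Ω → ℝ) (k : ℕ) : ∑ j ∈ Finset.range (k + 1), gap T j = T k := by
  induction k with
  | zero => simp [gap]
  | succ k ih => rw [Finset.sum_range_succ, ih]; ext ω; simp [gap]

lemma measurable_gap (h : ∀ k, Measurable (T k)) (k : ℕ) : Measurable (gap T k) := by
  cases k with
  | zero => exact h 0
  | succ k => exact (h (k + 1)).sub (h k)

namespace IsStationaryRenewal

lemma indepFun_gap (h : IsStationaryRenewal P μ T) (k : ℕ) :
    IndepFun (T k) (gap T (k + 1)) P := by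
  have := h.indep.indepFun_finsetSum_of_notMem (measurable_gap h.measurable)
    (s := Finset.range (k + 1)) (i := k + 1) (by simp)
  rwa [sum_gap] at this

lemma map_succ [IsProbabilityMeasure P] (h : IsStationaryRenewal P μ T) (k : ℕ) :
    P.map (T (k + 1)) = P.map (T k) ∗ μ := by
  have := (h.indepFun_gap k).map_add_eq_map_conv_map (h.measurable k)
    (measurable_gap h.measurable _)
  rw [h.law_gap] at this
  rw [← this]
  congr 1
  ext ω
  simp [gap]

/-- Each `T (k + 1)` has the law of `T k` convolved with `μ`, so the sum of the first `n + 1` laws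
is `ν_μ` plus the sum of the first `n` convolved with `μ`, and the induction closes by
`delayLaw_add_conv_le`. -/
lemma sum_map_le [IsProbabilityMeasure P] (h : IsStationaryRenewal P μ T) (hμ : IsPositiveLaw μ)
    (n : ℕ) : ∑ k ∈ Finset.range n, P.map (T k) ≤ renewalBound μ := by
  have := hμ.isProbabilityMeasure
  induction n with
  | zero => simpa using Measure.zero_le _
  | succ n ih =>
    refine le_trans ?_ hμ.delayLaw_add_conv_le
    rw [Finset.sum_range_succ', add_comm]
    refine add_le_add (le_of_eq h.law_first) (Measure.le_iff.2 fun B hB => ?_)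
    have hf : Measurable (B.indicator (1 : ℝ → ℝ≥0∞)) := measurable_one.indicator hB
    simp_rw [h.map_succ]
    rw [Measure.finsetSum_apply, ← lintegral_indicator_one hB, Measure.lintegral_conv hf]
    simp_rw [← lintegral_indicator_one hB, Measure.lintegral_conv hf]
    rw [← lintegral_finsetSum_measure]
    exact lintegral_mono' ih le_rfl

/-- The renewal measure is at most `m_μ⁻¹ dt`. -/
lemma tsum_measure_le [IsProbabilityMeasure P] (h : IsStationaryRenewal P μ T)
    (hμ : IsPositiveLaw μ) {B : Set ℝ} (hB : MeasurableSet B) :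
    ∑' k, P (T k ⁻¹' B) ≤ renewalBound μ B := by
  refine ENNReal.tsum_le_of_sum_range_le fun n => ?_
  refine le_trans (le_of_eq ?_) (h.sum_map_le hμ n B)
  rw [Measure.finsetSum_apply]
  exact Finset.sum_congr rfl fun k _ => (Measure.map_apply (h.measurable k) hB).symm

lemma tsum_lintegral_le [IsProbabilityMeasure P] (h : IsStationaryRenewal P μ T)
    (hμ : IsPositiveLaw μ) (f : ℝ → ℝ≥0∞) :
    ∑' k, ∫⁻ s, f s ∂(P.map (T k)) ≤ ∫⁻ s, f s ∂(renewalBound μ) := by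
  refine ENNReal.tsum_le_of_sum_range_le fun n => ?_
  rw [← lintegral_finsetSum_measure]
  exact lintegral_mono' (h.sum_map_le hμ n) le_rfl

lemma ae_pos [IsProbabilityMeasure P] (h : IsStationaryRenewal P μ T) (hμ : IsPositiveLaw μ) :
    ∀ᵐ ω ∂P, ∀ k, 0 < gap T k ω := by
  rw [ae_all_iff]
  intro k
  have hm : AEMeasurable (gap T k) P := (measurable_gap h.measurable k).aemeasurable
  refine ae_of_ae_map (p := fun t => 0 < t) hm ?_
  cases k with
  | zero =>
    rw [h.law_first, delayLaw]
    exact (withDensity_absolutelyContinuous _ _).ae_le (ae_restrict_mem measurableSet_Ioi)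
  | succ k => rw [h.law_gap]; exact hμ.ae_pos

lemma ae_finite [IsProbabilityMeasure P] (h : IsStationaryRenewal P μ T) (hμ : IsPositiveLaw μ) :
    ∀ᵐ ω ∂P, ∀ t, {k | T k ω ≤ t}.Finite := by
  have : ∀ n : ℕ, ∀ᵐ ω ∂P, {k | ω ∈ T k ⁻¹' Iic (n : ℝ)}.Finite := fun n => by
    refine ae_finite_setOfPred_mem (ne_top_of_le_ne_top ?_ (h.tsum_measure_le hμ measurableSet_Iic))
    rw [renewalBound, Measure.smul_apply, Measure.restrict_apply measurableSet_Iic]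
    refine ENNReal.mul_ne_top ENNReal.ofReal_ne_top ?_
    rw [inter_comm, Ioi_inter_Iic]
    simp
  filter_upwards [ae_all_iff.2 this] with ω hω t
  obtain ⟨n, hn⟩ := exists_nat_ge t
  exact (hω n).subset fun k hk => le_trans hk hn

lemma measure_first [IsProbabilityMeasure P] (h : IsStationaryRenewal P μ T) {B : Set ℝ}
    (hB : MeasurableSet B) : P (T 0 ⁻¹' B) = delayLaw μ B := by
  rw [← h.law_first, Measure.map_apply (measurable_gap h.measurable 0) hB]
  rfl

lemma isProbabilityMeasure_delayLaw [IsProbabilityMeasure P] (h : IsStationaryRenewal P μ T) :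
    IsProbabilityMeasure (delayLaw μ) := by
  rw [← h.law_first]
  exact Measure.isProbabilityMeasure_map (measurable_gap h.measurable 0).aemeasurable

/-- A process that has a mark before time `H` has no mark in a given interval of length `δ` with
probability at most `ν_μ((δ, H])`. -/
lemma measure_no_mark_le [IsProbabilityMeasure P] (h : IsStationaryRenewal P μ T)
    (hμ : IsPositiveLaw μ) {t δ H : ℝ} (ht : 0 ≤ t) (hδ : 0 < δ) (hH : t + δ ≤ H) :
    P {ω | T 0 ω ≤ H ∧ ∀ k, T k ω ∉ Ioc t (t + δ)} ≤ delayLaw μ (Ioc δ H) := by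
  have := hμ.isProbabilityMeasure
  have hν := h.isProbabilityMeasure_delayLaw
  -- If the first mark is after `t`, it is also after `t + δ`. Otherwise some pair of consecutive
  -- marks straddles the interval: were all marks at most `t`, there would be infinitely many of
  -- them before `t`.
  have hsub : {ω | T 0 ω ≤ H ∧ ∀ k, T k ω ∉ Ioc t (t + δ)} ≤ᵐ[P]
      (T 0 ⁻¹' Ioc (t + δ) H ∪ ⋃ k, {ω | T k ω ≤ t ∧ t + δ < T (k + 1) ω} : Set Ω) := by
    filter_upwards [h.ae_finite hμ] with ω hω hmem
    obtain ⟨h0, hk⟩ := hmem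
    by_cases h1 : T 0 ω ≤ t
    · right
      by_contra hcon
      have hall : ∀ k, T k ω ≤ t := by
        intro k
        induction k with
        | zero => exact h1
        | succ k ih =>
          by_contra hgt
          refine hcon (mem_iUnion.2 ⟨k, ih, ?_⟩)
          by_contra hle
          exact hk (k + 1) ⟨not_le.1 hgt, not_lt.1 hle⟩
      exact Set.infinite_univ ((hω t).subset fun k _ => hall k)
    · left
      refine ⟨?_, h0⟩
      by_contra hle
      exact hk 0 ⟨not_le.1 h1, not_lt.1 hle⟩
  have hstep : ∀ k, P {ω | T k ω ≤ t ∧ t + δ < T (k + 1) ω} =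
      ∫⁻ s, (Iic t).indicator (fun s => μ (Ioi (t + δ - s))) s ∂(P.map (T k)) := by
    intro k
    have hmeas : MeasurableSet {q : ℝ × ℝ | q.1 ≤ t ∧ t + δ - q.1 < q.2} :=
      (measurableSet_le measurable_fst measurable_const).inter
        (measurableSet_lt (measurable_const.sub measurable_fst) measurable_snd)
    have hg : Measurable (gap T (k + 1)) := measurable_gap h.measurable _
    have hprod := (indepFun_iff_map_prod_eq_prod_map_map (h.measurable k).aemeasurable
      hg.aemeasurable).1 (h.indepFun_gap k)
    rw [h.law_gap] at hprod
    have : {ω | T k ω ≤ t ∧ t + δ < T (k + 1) ω} =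
        (fun ω => (T k ω, gap T (k + 1) ω)) ⁻¹' {q : ℝ × ℝ | q.1 ≤ t ∧ t + δ - q.1 < q.2} := by
      ext ω
      simp [gap]
    rw [this, ← Measure.map_apply ((h.measurable k).prodMk hg) hmeas, hprod,
      Measure.prod_apply hmeas]
    refine lintegral_congr fun s => ?_
    by_cases hs : s ≤ t
    · simp [indicator, hs]; rfl
    · simp [indicator, hs]
  calc P {ω | T 0 ω ≤ H ∧ ∀ k, T k ω ∉ Ioc t (t + δ)}
      ≤ P (T 0 ⁻¹' Ioc (t + δ) H ∪ ⋃ k, {ω | T k ω ≤ t ∧ t + δ < T (k + 1) ω}) :=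
        measure_mono_ae hsub
    _ ≤ P (T 0 ⁻¹' Ioc (t + δ) H) + ∑' k, P {ω | T k ω ≤ t ∧ t + δ < T (k + 1) ω} :=
        (measure_union_le _ _).trans (add_le_add_right (measure_iUnion_le _) _)
    -- The second term collects the straddling pairs. By the bound on the renewal measure they
    -- contribute at most `m_μ⁻¹ ∫_0^t μ((t + δ - s, ∞)) ds`, which the substitution `u = t + δ - s`
    -- turns into `ν_μ((δ, t + δ])`, up to the negligible endpoint `u = δ`.
    _ ≤ delayLaw μ (Ioc (t + δ) H) + delayLaw μ (Ioc δ (t + δ)) := by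
        rw [h.measure_first measurableSet_Ioc]
        gcongr
        simp_rw [hstep]
        refine (h.tsum_lintegral_le hμ _).trans ?_
        rw [renewalBound, lintegral_smul_measure, smul_eq_mul,
          delayLaw_apply hμ.mean_pos measurableSet_Ioc, ← lintegral_indicator measurableSet_Ioi,
          ← lintegral_sub_left_eq_self _ (t + δ)]
        gcongr 1
        refine lintegral_mono_ae ?_
        filter_upwards [compl_mem_ae_iff.2 (measure_singleton δ)] with u hu
        have hu' : u ≠ δ := hu
        by_cases h1 : 0 < t + δ - u
        · by_cases h2 : t + δ - u ≤ t
          · have h3 : δ < u := lt_of_le_of_ne (by linarith) hu'.symm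
            have h4 : u ≤ t + δ := by linarith
            have h5 : 0 < u := by linarith
            simp [indicator, h3, h4, h5]
            split_ifs <;> simp
          · simp [indicator, h2]
        · simp only [indicator, mem_Ioi, h1, if_false, zero_le]
    _ = delayLaw μ (Ioc δ H) := by
        rw [add_comm, ← measure_union (Ioc_disjoint_Ioc_of_le le_rfl) measurableSet_Ioc,
          Ioc_union_Ioc_eq_Ioc (by linarith) hH]

end IsStationaryRenewal

end Renewal

/-! ### Scales -/

section Scales

/-- Squeeze between `exp (-c q / (1 - q))` and `exp (-c q)`, from `1 - y⁻¹ ≤ log y` and `1 + y ≤ exp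
y`. -/
lemma tendsto_one_sub_pow {α : Type*} {l : Filter α} {q : α → ℝ} {c : α → ℕ} {h : ℝ}
    (hq : Tendsto q l (𝓝 0)) (h0 : ∀ᶠ x in l, 0 ≤ q x) (hc : Tendsto (fun x => c x * q x) l (𝓝 h)) :
    Tendsto (fun x => (1 - q x) ^ c x) l (𝓝 (Real.exp (-h))) := by
  have hlow : Tendsto (fun x => Real.exp (-(c x * q x / (1 - q x)))) l (𝓝 (Real.exp (-h))) := by
    have h1 : Tendsto (fun x => 1 - q x) l (𝓝 1) := by simpa using hq.const_sub 1
    have := (hc.div h1 one_ne_zero).neg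
    rw [div_one] at this
    exact (Real.continuous_exp.tendsto _).comp this
  have hupp : Tendsto (fun x => Real.exp (-(c x * q x))) l (𝓝 (Real.exp (-h))) :=
    (Real.continuous_exp.tendsto _).comp hc.neg
  refine tendsto_of_tendsto_of_tendsto_of_le_of_le' hlow hupp ?_ ?_
  · filter_upwards [h0, hq.eventually_lt_const one_pos] with x h0 h1
    have h2 : 0 < 1 - q x := by linarith
    have h3 := Real.one_sub_inv_le_log_of_pos h2
    calc Real.exp (-(c x * q x / (1 - q x))) ≤ Real.exp (c x * Real.log (1 - q x)) := by
          refine Real.exp_le_exp.2 ?_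
          have : -(c x * q x / (1 - q x)) = c x * (1 - (1 - q x)⁻¹) := by field_simp; ring
          rw [this]
          gcongr
      _ = (1 - q x) ^ c x := by
          rw [← Real.log_pow, Real.exp_log (by positivity)]
  · filter_upwards [hq.eventually_lt_const one_pos] with x h1
    calc (1 - q x) ^ c x ≤ (Real.exp (-q x)) ^ c x := by
          refine pow_le_pow_left₀ (by linarith) ?_ _
          have := Real.add_one_le_exp (-q x)
          linarith
      _ = _ := by rw [← Real.exp_nat_mul]; ring_nf

variable {μ : Measure ℝ}

lemma IsPositiveLaw.delayLaw_le (h : IsPositiveLaw μ) (B : Set ℝ) :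
    delayLaw μ B ≤ ENNReal.ofReal (mean μ)⁻¹ * volume B := by
  have h1 : delayLaw μ B ≤ renewalBound μ B :=
    le_trans (by rw [Measure.add_apply]; exact le_self_add) (h.delayLaw_add_conv_le B)
  refine h1.trans ?_
  rw [renewalBound, Measure.smul_apply, smul_eq_mul]
  gcongr
  exact Measure.restrict_le_self

variable [IsProbabilityMeasure (delayLaw μ)]

lemma IsPositiveLaw.continuous_delayLaw (h : IsPositiveLaw μ) :
    Continuous fun x => (delayLaw μ).real (Ioi x) := by
  refine (LipschitzWith.of_dist_le_mul (K := (mean μ)⁻¹.toNNReal) fun x y => ?_).continuous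
  wlog hxy : x ≤ y generalizing x y
  · rw [dist_comm, dist_comm x]; exact this y x (le_of_not_ge hxy)
  have h1 : (delayLaw μ).real (Ioi x) = (delayLaw μ).real (Ioc x y) + (delayLaw μ).real (Ioi y) := by
    rw [← measureReal_union (Ioc_disjoint_Ioi le_rfl) measurableSet_Ioi, Ioc_union_Ioi_eq_Ioi hxy]
  rw [Real.dist_eq, h1, add_sub_cancel_right, abs_of_nonneg measureReal_nonneg, dist_comm,
    Real.dist_eq, abs_of_nonneg (sub_nonneg.2 hxy), measureReal_def]
  have h2 := ENNReal.toReal_mono (by simp [ENNReal.mul_eq_top])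
    (h.delayLaw_le (Ioc x y))
  rw [ENNReal.toReal_mul, Real.volume_Ioc, ENNReal.toReal_ofReal (sub_nonneg.2 hxy)] at h2
  exact h2

/-- If `ν_S((x, ∞))` vanished, so would the density `μ((u, ∞)) / m_μ` at almost every `u > max x 0`;
a single such `u` bounds the support of `μ`. -/
lemma HypSZero.delayLaw_pos (h : HypSZero μ) (x : ℝ) : 0 < (delayLaw μ).real (Ioi x) := by
  have := h.isPositiveLaw.isProbabilityMeasure
  have hm := h.isPositiveLaw.mean_pos
  refine measureReal_nonneg.lt_of_ne fun h0 => h.unbounded ?_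
  rw [eq_comm, measureReal_eq_zero_iff, delayLaw, withDensity_apply _ measurableSet_Ioi,
    Measure.restrict_restrict measurableSet_Ioi, lintegral_eq_zero_iff'] at h0
  rotate_left
  · refine (Measurable.ennreal_ofReal (Measurable.const_mul ?_ _)).aemeasurable
    exact (show Antitone fun u : ℝ => μ.real (Ioi u) from
      fun a b hab => measureReal_mono (Ioi_subset_Ioi hab)).measurable
  have h1 : ∀ᵐ u ∂(volume.restrict (Ioi x ∩ Ioi 0)), μ (Ioi u) = 0 := by
    filter_upwards [h0] with u hu
    have hu' : (mean μ)⁻¹ * μ.real (Ioi u) ≤ 0 := by simpa using hu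
    rw [← measureReal_eq_zero_iff]
    refine le_antisymm ?_ measureReal_nonneg
    by_contra hlt
    exact hu'.not_gt (mul_pos (inv_pos.2 hm) (not_le.1 hlt))
  rw [Ioi_inter_Ioi] at h1
  have : (ae (volume.restrict (Ioi (max x 0)))).NeBot := by
    rw [ae_neBot]
    simp
  obtain ⟨u, hu⟩ := h1.exists
  refine ⟨u, fun y hy => ?_⟩
  by_contra hlt
  exact ((Measure.mem_support_iff_forall y).1 hy _ (Ioi_mem_nhds (not_le.1 hlt))).ne' hu

lemma HypSZero.timeScale_spec (h : HypSZero μ) {l : ℝ} (hl : 0 < l) :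
    0 < timeScale μ l ∧ l * timeScale μ l = (delayLaw μ).real (Ioi (timeScale μ l)) := by
  have h0 : (delayLaw μ).real (Ioi 0) = 1 := by
    have : (delayLaw μ) (Ioi 0)ᶜ = 0 := by
      rw [delayLaw]
      refine withDensity_absolutelyContinuous _ _ ?_
      rw [Measure.restrict_apply measurableSet_Ioi.compl, compl_inter_self, measure_empty]
    rw [measureReal_def, (prob_compl_eq_zero_iff measurableSet_Ioi).1 this, ENNReal.toReal_one]
  have hcont : Continuous fun t : ℝ => l * t - (delayLaw μ).real (Ioi t) :=
    (continuous_const.mul continuous_id).sub h.isPositiveLaw.continuous_delayLaw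
  -- `timeScale` is defined by a chosen inverse, which is meaningful only if `1 / l` is attained.
  -- The function `l t - ν_S((t, ∞))` is continuous, equals at most 0 at `t = 0` and is at least 0
  -- at `t = 1 / l`. Uniqueness of the root plays no role.
  obtain ⟨t, ht, hgt⟩ := intermediate_value_Icc (a := 0) (b := 1 / l) (by positivity)
    hcont.continuousOn (show (0 : ℝ) ∈ Icc _ _ from by
      constructor
      · simp
      · have : (delayLaw μ).real (Ioi (1 / l)) ≤ 1 := measureReal_le_one
        rw [mul_one_div_cancel hl.ne']
        linarith)
  have hgt' : l * t = (delayLaw μ).real (Ioi t) := by simpa [sub_eq_zero] using hgt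
  have ht0 : t ∈ Ioi (0 : ℝ) := by
    refine ht.1.lt_of_ne fun h => ?_
    rw [← h, h0] at hgt'
    simp at hgt'
  have hex : ∃ t ∈ Ioi (0 : ℝ), t / (delayLaw μ).real (Ioi t) = 1 / l :=
    ⟨t, ht0, by rw [← hgt']; have : t ≠ 0 := ht0.ne'; field_simp⟩
  have h1 : 0 < timeScale μ l := Function.invFunOn_mem hex
  have h2 : timeScale μ l / (delayLaw μ).real (Ioi (timeScale μ l)) = 1 / l :=
    Function.invFunOn_eq hex
  refine ⟨h1, ?_⟩
  rw [div_eq_div_iff (h.delayLaw_pos _).ne' hl.ne'] at h2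
  linarith

/-- If `a_l` were below `b`, then `l a_l = ν_S((a_l, ∞))` would be at least `ν_S((b, ∞)) > 0`, which
fails for small `l`. -/
lemma HypSZero.tendsto_timeScale (h : HypSZero μ) : Tendsto (timeScale μ) (𝓝[>] 0) atTop := by
  refine tendsto_atTop.2 fun b => ?_
  have hb := h.delayLaw_pos b
  have h1 : ∀ᶠ l : ℝ in 𝓝[>] 0, l < (delayLaw μ).real (Ioi b) / (|b| + 1) :=
    nhdsWithin_le_nhds (eventually_lt_nhds (by positivity))
  filter_upwards [h1, self_mem_nhdsWithin] with l hl hl0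
  obtain ⟨ha, hla⟩ := h.timeScale_spec hl0
  by_contra hlt
  have h2 : (delayLaw μ).real (Ioi b) ≤ (delayLaw μ).real (Ioi (timeScale μ l)) :=
    measureReal_mono (Ioi_subset_Ioi (not_le.1 hlt).le)
  rw [← hla] at h2
  rw [lt_div_iff₀ (by positivity)] at hl
  have : timeScale μ l < |b| + 1 := by linarith [not_le.1 hlt, le_abs_self b]
  have : l * timeScale μ l ≤ l * (|b| + 1) := mul_le_mul_of_nonneg_left this.le (le_of_lt hl0)
  linarith

variable (μ) in
lemma tendsto_delayLaw_Ioi : Tendsto (fun x => (delayLaw μ).real (Ioi x)) atTop (𝓝 0) := by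
  have h1 : Tendsto (fun x => 1 - cdf (delayLaw μ) x) atTop (𝓝 (1 - 1)) :=
    (tendsto_cdf_atTop (delayLaw μ)).const_sub 1
  rw [sub_self] at h1
  refine h1.congr fun x => ?_
  rw [cdf_eq_real, ← probReal_compl_eq_one_sub measurableSet_Iic, compl_Iic]

lemma HypSZero.spaceScale_mul_le (h : HypSZero μ) {l : ℝ} (hl : 0 < l) :
    spaceScale μ l * (l * timeScale μ l) ≤ 1 := by
  obtain ⟨ha, -⟩ := h.timeScale_spec hl
  have : (spaceScale μ l : ℝ) ≤ 1 / (l * timeScale μ l) := Nat.floor_le (by positivity)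
  rwa [le_div_iff₀ (by positivity)] at this

lemma HypSZero.tendsto_mul_timeScale (h : HypSZero μ) :
    Tendsto (fun l => l * timeScale μ l) (𝓝[>] 0) (𝓝[>] 0) := by
  refine tendsto_nhdsWithin_iff.2 ⟨?_, ?_⟩
  · refine ((tendsto_delayLaw_Ioi μ).comp h.tendsto_timeScale).congr' ?_
    filter_upwards [self_mem_nhdsWithin] with l hl
    exact (h.timeScale_spec hl).2.symm
  · filter_upwards [self_mem_nhdsWithin] with l hl
    exact mul_pos hl (h.timeScale_spec hl).1

lemma HypSZero.tendsto_spaceScale (h : HypSZero μ) :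
    Tendsto (fun l => spaceScale μ l) (𝓝[>] 0) atTop := by
  have := tendsto_inv_nhdsGT_zero.comp h.tendsto_mul_timeScale
  refine (tendsto_nat_floor_atTop.comp this).congr fun l => ?_
  simp [spaceScale]

lemma HypSZero.tendsto_spaceScale_mul (h : HypSZero μ) :
    Tendsto (fun l => spaceScale μ l * (l * timeScale μ l)) (𝓝[>] 0) (𝓝 1) := by
  have := (tendsto_nat_floor_div_atTop (R := ℝ)).comp
    (tendsto_inv_nhdsGT_zero.comp h.tendsto_mul_timeScale)
  refine this.congr fun l => ?_
  simp [spaceScale, div_eq_mul_inv]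

/-- A site receives no seed up to time `t a_l` with probability equivalent to `1 / n_l`. -/
lemma HypSZero.tendsto_spaceScale_mul_delayLaw (h : HypSZero μ) {t : ℝ} (ht : 0 < t) :
    Tendsto (fun l => spaceScale μ l * (delayLaw μ).real (Ioi (timeScale μ l * t)))
      (𝓝[>] 0) (𝓝 1) := by
  have h1 := ((h.slowlyVarying t ht).comp h.tendsto_timeScale).inv₀ one_ne_zero
  have h2 := h.tendsto_spaceScale_mul.mul h1
  rw [inv_one, mul_one] at h2
  refine h2.congr' ?_
  filter_upwards [self_mem_nhdsWithin] with l hl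
  obtain ⟨ha, hla⟩ := h.timeScale_spec hl
  have := h.delayLaw_pos (timeScale μ l)
  rw [hla, Function.comp_apply, inv_div, mul_comm t]
  field_simp

/-- Both tails are equivalent to `1 / n_l`, so their difference is negligible in comparison. Through
`measure_no_mark_le`, this is what excludes long waits between seeds on every seeded site of a
window of order `n_l`. -/
lemma HypSZero.tendsto_spaceScale_mul_delayLaw_Ioc (h : HypSZero μ) {s t : ℝ} (hs : 0 < s)
    (hst : s ≤ t) :
    Tendsto (fun l => spaceScale μ l *
      (delayLaw μ).real (Ioc (timeScale μ l * s) (timeScale μ l * t))) (𝓝[>] 0) (𝓝 0) := by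
  have h1 := (h.tendsto_spaceScale_mul_delayLaw hs).sub
    (h.tendsto_spaceScale_mul_delayLaw (hs.trans_le hst))
  rw [sub_self] at h1
  refine h1.congr' ?_
  filter_upwards [self_mem_nhdsWithin] with l hl
  obtain ⟨ha, -⟩ := h.timeScale_spec hl
  have hle : timeScale μ l * s ≤ timeScale μ l * t := by gcongr
  rw [← mul_sub, ← Ioc_union_Ioi_eq_Ioi hle,
    measureReal_union (Ioc_disjoint_Ioi le_rfl) measurableSet_Ioi]
  ring

end Scales

/-! ### Intervals -/

section Intervals

lemma Icc_mem_intervals (a b : ℝ) : Icc a b ∈ intervals := by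
  by_cases h : a ≤ b
  · exact Or.inr ⟨a, b, h, rfl⟩
  · exact Or.inl (Icc_eq_empty h)

lemma intervalDist_Icc_Icc {a b c d : ℝ} (h : a ≤ b) (h' : c ≤ d) :
    intervalDist (Icc a b) (Icc c d) = |a - c| + |b - d| := by
  simp [intervalDist, (nonempty_Icc.2 h).ne_empty, (nonempty_Icc.2 h').ne_empty, csInf_Icc h,
    csInf_Icc h', csSup_Icc h, csSup_Icc h']

lemma intervalDist_Icc_empty {a b : ℝ} (h : a ≤ b) : intervalDist (Icc a b) ∅ = b - a := by
  simp [intervalDist, (nonempty_Icc.2 h).ne_empty, csInf_Icc h, csSup_Icc h]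

lemma intervalDist_self (I : Set ℝ) : intervalDist I I = 0 := by
  by_cases h : I = ∅ <;> simp [intervalDist, h]

lemma intervalDist_nonneg {I J : Set ℝ} (hI : I ∈ intervals) (hJ : J ∈ intervals) :
    0 ≤ intervalDist I J := by
  obtain rfl | ⟨a, b, hab, rfl⟩ := hI <;> obtain rfl | ⟨c, d, hcd, rfl⟩ := hJ
  · simp [intervalDist]
  · simp [intervalDist, (nonempty_Icc.2 hcd).ne_empty, csInf_Icc hcd, csSup_Icc hcd, hcd]
  · rw [intervalDist_Icc_empty hab]; linarith
  · rw [intervalDist_Icc_Icc hab hcd]; positivity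

/-- The intermediate interval has to be nonempty: `δ([a, a], ∅) = 0` for every `a`, so the triangle
inequality fails through `∅`. Later arguments only compare with nonempty intervals. -/
lemma intervalDist_triangle {a b c d : ℝ} (h : a ≤ b) (h' : c ≤ d) {J : Set ℝ}
    (hJ : J ∈ intervals) :
    intervalDist (Icc a b) J ≤ |a - c| + |b - d| + intervalDist (Icc c d) J := by
  obtain rfl | ⟨e, f, hef, rfl⟩ := hJ
  · rw [intervalDist_Icc_empty h, intervalDist_Icc_empty h']
    linarith [neg_abs_le (a - c), le_abs_self (b - d)]
  · rw [intervalDist_Icc_Icc h hef, intervalDist_Icc_Icc h' hef]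
    linarith [abs_sub_le a c e, abs_sub_le b d f]

lemma intervalDist_le_of_subset {A : ℝ} (hA : 0 ≤ A) {I J : Set ℝ} (hI : I ∈ intervals)
    (hJ : J ∈ intervals) (hIA : I ⊆ Icc (-A) A) (hJA : J ⊆ Icc (-A) A) :
    intervalDist I J ≤ 4 * A := by
  obtain rfl | ⟨a, b, hab, rfl⟩ := hI <;> obtain rfl | ⟨c, d, hcd, rfl⟩ := hJ
  · simpa [intervalDist] using hA
  · have hc := hJA (left_mem_Icc.2 hcd)
    have hd := hJA (right_mem_Icc.2 hcd)
    simp only [intervalDist, (nonempty_Icc.2 hcd).ne_empty, csInf_Icc hcd, csSup_Icc hcd, if_true,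
      if_false]
    linarith [hc.1, hd.2]
  · have ha := hIA (left_mem_Icc.2 hab)
    have hb := hIA (right_mem_Icc.2 hab)
    rw [intervalDist_Icc_empty hab]
    linarith [ha.1, hb.2]
  · have ha := hIA (left_mem_Icc.2 hab)
    have hb := hIA (right_mem_Icc.2 hab)
    have hc := hJA (left_mem_Icc.2 hcd)
    have hd := hJA (right_mem_Icc.2 hcd)
    rw [intervalDist_Icc_Icc hab hcd]
    have h1 : |a - c| ≤ 2 * A := abs_le.2 ⟨by linarith [ha.1, hc.2], by linarith [ha.2, hc.1]⟩
    have h2 : |b - d| ≤ 2 * A := abs_le.2 ⟨by linarith [hb.1, hd.2], by linarith [hb.2, hd.1]⟩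
    linarith

lemma rescale_empty (n : ℕ) : rescale n ∅ = ∅ := by simp [rescale]

lemma rescale_Icc (n : ℕ) {a b : ℤ} (h : a ≤ b) : rescale n (Icc a b) = Icc (a / n : ℝ) (b / n) := by
  refine Subset.antisymm (convexHull_min ?_ (convex_Icc _ _)) ?_
  · rintro _ ⟨j, hj, rfl⟩
    have h1 : (a : ℝ) ≤ j := by exact_mod_cast hj.1
    have h2 : (j : ℝ) ≤ b := by exact_mod_cast hj.2
    constructor <;> dsimp only <;> gcongr
  · have hsub := subset_convexHull ℝ ((fun j : ℤ => (j : ℝ) / n) '' Icc a b)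
    exact (convex_convexHull ℝ _).ordConnected.out
      (hsub (mem_image_of_mem _ (left_mem_Icc.2 h))) (hsub (mem_image_of_mem _ (right_mem_Icc.2 h)))

lemma rescale_Ioo (n : ℕ) {L R i : ℤ} (hi : i ∈ Ioo L R) :
    rescale n (Ioo L R) = Icc (((L : ℝ) + 1) / n) (((R : ℝ) - 1) / n) := by
  rw [mem_Ioo] at hi
  have : Ioo L R = Icc (L + 1) (R - 1) := by
    ext j
    simp only [mem_Ioo, mem_Icc]
    lia
  rw [this, rescale_Icc n (by lia)]
  push_cast
  rfl

lemma rescale_mono (n : ℕ) {C C' : Set ℤ} (h : C ⊆ C') : rescale n C ⊆ rescale n C' :=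
  convexHull_mono (image_mono h)

/-- A path with values in `𝓘 ∪ {∅}` that is locally constant on the right and on the left of
every time. -/
structure IsStepPath (T : ℝ) (J : ℝ → Set ℝ) : Prop where
  mem : ∀ t ∈ Icc 0 T, J t ∈ intervals
  right : ∀ t ∈ Ico 0 T, ∀ᶠ s in 𝓝[>] t, J s = J t
  left : ∀ t ∈ Ioc 0 T, ∃ I ∈ intervals, ∀ᶠ s in 𝓝[<] t, J s = I

lemma TendstoInterval.of_eventually {J : ℝ → Set ℝ} {l : Filter ℝ} {I : Set ℝ}
    (h : ∀ᶠ s in l, J s = I) : TendstoInterval J l I :=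
  ⟨h.mono fun s hs => by rw [hs], tendsto_const_nhds.congr' (h.mono fun s hs => by
    dsimp only
    rw [hs, intervalDist_self])⟩

lemma IsStepPath.mem_cadlagPaths {T : ℝ} {J : ℝ → Set ℝ} (h : IsStepPath T J) :
    J ∈ cadlagPaths T :=
  ⟨h.mem, fun t ht => .of_eventually (h.right t ht), fun t ht => by
    obtain ⟨I, hI, hJ⟩ := h.left t ht
    exact ⟨I, hI, .of_eventually hJ⟩⟩

lemma isStepPath_const (T : ℝ) {I : Set ℝ} (hI : I ∈ intervals) : IsStepPath T fun _ => I :=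
  ⟨fun _ _ => hI, fun _ _ => .of_forall fun _ => rfl, fun _ _ => ⟨I, hI, .of_forall fun _ => rfl⟩⟩

end Intervals

/-! ### Clusters -/

section Clusters

/-- Vacant sites on both sides of `i` shield its cluster from the rest of the configuration. With
sites that stay unseeded up to a given time, this reduces the infinite system to finitely many
sites. -/
lemma cluster_congr {η η' : ℤ → Bool} {L R i : ℤ} (hL : η L = false) (hR : η R = false)
    (hi : i ∈ Ioo L R) (h : ∀ j ∈ Icc L R, η j = η' j) : cluster η i = cluster η' i := by
  ext j
  by_cases hj : j ∈ Icc L R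
  · have : ∀ k ∈ uIcc i j, η k = η' k := fun k hk => h k (by
      have := (uIcc_subset_Icc (Ioo_subset_Icc_self hi) hj) hk
      exact this)
    exact forall₂_congr fun k hk => by rw [this k hk]
  · refine iff_of_false (fun hc => ?_) fun hc => ?_
    all_goals
      rw [mem_Icc, not_and_or, not_le, not_le] at hj
      obtain hj | hj := hj
    · simp [hc L (mem_uIcc.2 (Or.inr ⟨hj.le, hi.1.le⟩))] at hL
    · simp [hc R (mem_uIcc.2 (Or.inl ⟨hi.2.le, hj.le⟩))] at hR
    · rw [h L (left_mem_Icc.2 (hi.1.trans hi.2).le)] at hL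
      simp [hc L (mem_uIcc.2 (Or.inr ⟨hj.le, hi.1.le⟩))] at hL
    · rw [h R (right_mem_Icc.2 (hi.1.trans hi.2).le)] at hR
      simp [hc R (mem_uIcc.2 (Or.inl ⟨hi.2.le, hj.le⟩))] at hR

lemma cluster_subset_Ioo {η : ℤ → Bool} {L R i : ℤ} (hL : η L = false) (hR : η R = false)
    (hi : i ∈ Ioo L R) : cluster η i ⊆ Ioo L R := by
  intro j hj
  constructor
  · by_contra hlt
    simp [hj L (mem_uIcc.2 (Or.inr ⟨not_lt.1 hlt, hi.1.le⟩))] at hL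
  · by_contra hlt
    simp [hj R (mem_uIcc.2 (Or.inl ⟨hi.2.le, not_lt.1 hlt⟩))] at hR

lemma cluster_eq_Ioo {η : ℤ → Bool} {L R i : ℤ} (hL : η L = false) (hR : η R = false)
    (hi : i ∈ Ioo L R) (h : ∀ j ∈ Ioo L R, η j = true) : cluster η i = Ioo L R :=
  (cluster_subset_Ioo hL hR hi).antisymm fun _ hj k hk => h k (by
    rcases mem_uIcc.1 hk with hk | hk
    · exact ⟨hi.1.trans_le hk.1, hk.2.trans_lt hj.2⟩
    · exact ⟨hj.1.trans_le hk.1, hk.2.trans_lt hi.2⟩)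

lemma cluster_eq_empty_or_Icc {η : ℤ → Bool} {L R i : ℤ} (hL : η L = false) (hR : η R = false)
    (hi : i ∈ Ioo L R) : cluster η i = ∅ ∨ ∃ a b, a ≤ b ∧ cluster η i = Icc a b := by
  have hfin : (cluster η i).Finite := (finite_Ioo L R).subset (cluster_subset_Ioo hL hR hi)
  refine (cluster η i).eq_empty_or_nonempty.imp_right fun hne => ?_
  obtain ⟨a, ha, ha'⟩ := exists_min_image _ id hfin hne
  obtain ⟨b, hb, hb'⟩ := exists_max_image _ id hfin hne
  have hii : i ∈ cluster η i := fun k hk => by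
    obtain rfl : k = i := by simpa using hk
    exact ha k left_mem_uIcc
  have hai : a ≤ i := ha' i hii
  have hib : i ≤ b := hb' i hii
  refine ⟨a, b, ha' b hb, Subset.antisymm (fun j hj => ⟨ha' j hj, hb' j hj⟩) fun j hj k hk => ?_⟩
  rw [mem_Icc] at hj
  rw [mem_uIcc] at hk
  by_cases hik : i ≤ k
  · exact hb k (mem_uIcc.2 (Or.inl ⟨hik, by lia⟩))
  · exact ha k (mem_uIcc.2 (Or.inr ⟨by lia, by lia⟩))

lemma rescale_cluster_mem_intervals (n : ℕ) {η : ℤ → Bool} {L R i : ℤ} (hL : η L = false)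
    (hR : η R = false) (hi : i ∈ Ioo L R) : rescale n (cluster η i) ∈ intervals := by
  obtain h | ⟨a, b, hab, h⟩ := cluster_eq_empty_or_Icc hL hR hi
  · exact Or.inl (by rw [h, rescale_empty])
  · rw [h, rescale_Icc n hab]
    exact Icc_mem_intervals _ _

/-- The configuration `η` restricted to `{-m, …, m}`, with all other sites vacant. -/
def window (m : ℕ) (η : ℤ → Bool) : ℤ → Bool := fun j => if -(m : ℤ) ≤ j ∧ j ≤ m then η j else false

lemma rescale_cluster_window_mem_intervals (n m : ℕ) (η : ℤ → Bool) (i : ℤ) :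
    rescale n (cluster (window m η) i) ∈ intervals := by
  refine rescale_cluster_mem_intervals n (L := -(m + i.natAbs + 1)) (R := m + i.natAbs + 1) ?_ ?_ ?_
  · exact if_neg (by lia)
  · exact if_neg (by lia)
  · constructor <;> lia

lemma cluster_window {m : ℕ} {η : ℤ → Bool} {L R i : ℤ} (hL : η L = false)
    (hR : η R = false) (hi : i ∈ Ioo L R) (hmL : L.natAbs ≤ m) (hmR : R.natAbs ≤ m) :
    cluster (window m η) i = cluster η i := by
  refine (cluster_congr hL hR hi fun j hj => ?_).symm
  have : -(m : ℤ) ≤ j ∧ j ≤ m := by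
    rw [mem_Icc] at hj
    lia
  exact (if_pos this).symm

end Clusters

/-! ### Paths of the forest fire process -/

section Paths

/-- The almost sure properties of the paths of a forest fire process. -/
structure IsRegularPath (s m : ℤ → ℕ → ℝ) (η : ℝ → ℤ → Bool) : Prop where
  cadlag : ∀ i, IsCadlag (fun t => η t i)
  first_le : ∀ i k, s i 0 ≤ s i k
  finite : ∀ i t, {k | s i k ≤ t}.Finite
  equation : ∀ t, 0 ≤ t → ∀ i, (effectiveMatches m η t i).Finite ∧
    (if η t i = true then (1 : ℤ) else 0) =
      ((effectiveSeeds s η t i).ncard : ℤ) - ((effectiveMatches m η t i).ncard : ℤ)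
  exists_gt : ∀ H N, ∃ i, N < i ∧ H < s i 0
  exists_lt : ∀ H N, ∃ i, i < N ∧ H < s i 0

namespace IsRegularPath

variable {s m : ℤ → ℕ → ℝ} {η : ℝ → ℤ → Bool}

lemma eventually_eq_before (h : IsRegularPath s m η) {t : ℝ} (ht : 0 < t) (i : ℤ) :
    ∀ᶠ u in 𝓝[<] t, η u i = before η t i := by
  obtain ⟨b, hb⟩ := (h.cadlag i).2 t ht
  have : before η t i = b := leftLim_eq_of_tendsto hb
  rw [this]
  rwa [nhds_discrete, tendsto_pure] at hb

lemma eventually_eq (h : IsRegularPath s m η) {t : ℝ} (ht : 0 ≤ t) (i : ℤ) :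
    ∀ᶠ u in 𝓝[>] t, η u i = η t i := by
  have := (h.cadlag i).1 t ht
  rwa [nhds_discrete, tendsto_pure] at this

/-- A site is vacant before its first seed. -/
lemma eq_false (h : IsRegularPath s m η) {t : ℝ} (ht : 0 ≤ t) {i : ℤ} (hi : t < s i 0) :
    η t i = false := by
  have h1 : effectiveSeeds s η t i = ∅ :=
    eq_empty_of_forall_notMem fun k hk => (hi.trans_le (h.first_le i k)).not_ge hk.1
  have h2 := (h.equation t ht i).2
  rw [h1, ncard_empty] at h2
  by_contra h3
  rw [if_pos (by simpa using h3)] at h2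
  lia

lemma before_eq_false (h : IsRegularPath s m η) {t : ℝ} (ht : 0 < t) {i : ℤ} (hi : t < s i 0) :
    before η t i = false := by
  obtain ⟨u, hu, hu0, hut⟩ := ((h.eventually_eq_before ht i).and
    (Ioo_mem_nhdsLT ht)).exists
  rw [← hu, h.eq_false hu0.le (hut.trans hi)]

/-- A site on which a seed falls during `(t', t]` and whose cluster is not hit by a match
during `(t', t]` is occupied at time `t`. -/
lemma eq_true (h : IsRegularPath s m η) {t' t : ℝ} (ht' : 0 ≤ t') {i : ℤ} {k : ℕ}
    (hk : s i k ∈ Ioc t' t)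
    (hm : ∀ j l, m j l ∈ Ioc t' t → j ∉ cluster (before η (m j l)) i) : η t i = true := by
  -- No match reaches `i` after `t'`, so the negative term of the equation is frozen on `[t', t]`
  -- and it remains to find one more effective seed than effective matches.
  have hmatch : ∀ u ∈ Icc t' t, effectiveMatches m η u i = effectiveMatches m η t' i := by
    intro u hu
    ext q
    refine ⟨fun hq => ⟨?_, hq.2⟩, fun hq => ⟨hq.1.trans hu.1, hq.2⟩⟩
    by_contra hlt
    exact hm q.1 q.2 ⟨not_le.1 hlt, hq.1.trans hu.2⟩ hq.2
  have hseed : ∀ u ≤ t, effectiveSeeds s η u i ⊆ effectiveSeeds s η t i :=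
    fun u hu q hq => ⟨hq.1.trans hu, hq.2⟩
  -- Needed because `ncard` is monotone only on finite sets, being 0 on infinite ones.
  have hfin : (effectiveSeeds s η t i).Finite := (h.finite i t).subset fun q hq => hq.1
  have ht : t' < t := hk.1.trans_le hk.2
  have e1 := (h.equation t (ht'.trans ht.le) i).2
  rw [hmatch t ⟨ht.le, le_rfl⟩] at e1
  cases hb : before η (s i k) i with
  -- The seed `k` is effective and later than `t'`: the seed count strictly increases after `t'`,
  -- when the difference was already at least 0.
  | false =>
    have e2 := (h.equation t' ht' i).2
    have hlt : (effectiveSeeds s η t' i).ncard < (effectiveSeeds s η t i).ncard :=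
      ncard_lt_ncard (ssubset_iff_subset_ne.2 ⟨hseed t' ht.le, fun he => by
        have : k ∈ effectiveSeeds s η t i := ⟨hk.2, hb⟩
        rw [← he] at this
        exact this.1.not_gt hk.1⟩) hfin
    by_contra h3
    rw [if_neg h3] at e1
    split_ifs at e2 <;> lia
  -- The site is occupied at some time `u` between `t'` and the seed, so the difference equals 1 at
  -- `u`; it cannot decrease afterwards.
  | true =>
    obtain ⟨u, hu, hu0, hut⟩ := ((h.eventually_eq_before (ht'.trans_lt hk.1) i).and
      (Ioo_mem_nhdsLT hk.1)).exists
    have hut' : u ≤ t := hut.le.trans hk.2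
    have e2 := (h.equation u (ht'.trans hu0.le) i).2
    rw [hmatch u ⟨hu0.le, hut'⟩, hu, hb, if_pos rfl] at e2
    have := ncard_le_ncard (hseed u hut') hfin
    by_contra h3
    rw [if_neg h3] at e1
    lia

/-- Between two sites that remain vacant up to time `H`, all sites are occupied at time `t`
if they receive seeds frequently and no match falls on them shortly before `t`. -/
lemma cluster_eq (h : IsRegularPath s m η) {L R i : ℤ} {d H t : ℝ} (hi : i ∈ Ioo L R)
    (hL : H < s L 0) (hR : H < s R 0)
    (hseed : ∀ j ∈ Ioo L R, ∀ u ∈ Icc d H, ∃ k, s j k ∈ Ioc (u - d) u)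
    (hd : 0 ≤ d) (ht : t ∈ Icc d H) (hm : ∀ j ∈ Ioo L R, ∀ k, m j k ∉ Ioc (t - d) t) :
    cluster (η t) i = Ioo L R := by
  have ht0 : 0 ≤ t := hd.trans ht.1
  refine cluster_eq_Ioo (h.eq_false ht0 (ht.2.trans_lt hL)) (h.eq_false ht0 (ht.2.trans_lt hR)) hi
    fun j hj => ?_
  obtain ⟨k, hk⟩ := hseed j hj t ht
  refine h.eq_true (t' := t - d) (by linarith [ht.1]) hk fun j' l hl hmem => ?_
  have hpos : 0 < m j' l := lt_of_le_of_lt (by linarith [ht.1]) hl.1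
  -- Just before the match, `L` and `R` are still vacant, so a match that reaches the cluster of `j`
  -- has to fall strictly between them.
  have hle : m j' l ≤ H := hl.2.trans ht.2
  have := cluster_subset_Ioo (h.before_eq_false hpos (hle.trans_lt hL))
    (h.before_eq_false hpos (hle.trans_lt hR)) hj hmem
  exact hm j' this l hl

lemma exists_Ioo (h : IsRegularPath s m η) (H : ℝ) (i : ℤ) :
    ∃ L R, i ∈ Ioo L R ∧ H < s L 0 ∧ H < s R 0 := by
  obtain ⟨L, hL, hL'⟩ := h.exists_lt H i
  obtain ⟨R, hR, hR'⟩ := h.exists_gt H i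
  exact ⟨L, R, ⟨hL, hR⟩, hL', hR'⟩

lemma rescale_cluster_subset (h : IsRegularPath s m η) (n : ℕ) {L R i : ℤ} (hi : i ∈ Ioo L R)
    {t : ℝ} (ht : 0 ≤ t) (hL : t < s L 0) (hR : t < s R 0) :
    rescale n (cluster (η t) i) ⊆ Icc (((L : ℝ) + 1) / n) (((R : ℝ) - 1) / n) := by
  rw [← rescale_Ioo n hi]
  exact rescale_mono n (cluster_subset_Ioo (h.eq_false ht hL) (h.eq_false ht hR) hi)

lemma eventually_cluster_eq (h : IsRegularPath s m η) (i : ℤ) {t : ℝ} (ht : 0 ≤ t) :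
    ∀ᶠ u in 𝓝[>] t, cluster (η u) i = cluster (η t) i := by
  obtain ⟨L, R, hi, hL, hR⟩ := h.exists_Ioo t i
  filter_upwards [(eventually_all_finite (finite_Icc L R)).2 fun j _ => h.eventually_eq ht j]
    with u hu
  refine (cluster_congr (h.eq_false ht hL) (h.eq_false ht hR) hi fun j hj => (hu j hj).symm).symm

lemma eventually_cluster_eq_before (h : IsRegularPath s m η) (i : ℤ) {t : ℝ} (ht : 0 < t) :
    ∀ᶠ u in 𝓝[<] t, cluster (η u) i = cluster (before η t) i := by
  obtain ⟨L, R, hi, hL, hR⟩ := h.exists_Ioo t i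
  filter_upwards [(eventually_all_finite (finite_Icc L R)).2 fun j _ =>
    h.eventually_eq_before ht j] with u hu
  refine (cluster_congr (h.before_eq_false ht hL) (h.before_eq_false ht hR) hi
    fun j hj => (hu j hj).symm).symm

lemma rescale_cluster_mem (h : IsRegularPath s m η) (n : ℕ) (i : ℤ) {t : ℝ} (ht : 0 ≤ t) :
    rescale n (cluster (η t) i) ∈ intervals := by
  obtain ⟨L, R, hi, hL, hR⟩ := h.exists_Ioo t i
  exact rescale_cluster_mem_intervals n (h.eq_false ht hL) (h.eq_false ht hR) hi

lemma isStepPath (h : IsRegularPath s m η) (n : ℕ) (i : ℤ) {a : ℝ} (ha : 0 < a) (T : ℝ) :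
    IsStepPath T fun t => rescale n (cluster (η (a * t)) i) where
  mem t ht := h.rescale_cluster_mem n i (mul_nonneg ha.le ht.1)
  right t ht := by
    have : Tendsto (fun u => a * u) (𝓝[>] t) (𝓝[>] (a * t)) :=
      tendsto_nhdsWithin_iff.2 ⟨((continuous_const_mul a).tendsto t).mono_left nhdsWithin_le_nhds,
        eventually_mem_nhdsWithin.mono fun u hu => mul_lt_mul_of_pos_left hu ha⟩
    filter_upwards [this.eventually (h.eventually_cluster_eq i (mul_nonneg ha.le ht.1))] with u hu
    rw [hu]
  left t ht := by
    have hat : 0 < a * t := mul_pos ha ht.1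
    have : Tendsto (fun u => a * u) (𝓝[<] t) (𝓝[<] (a * t)) :=
      tendsto_nhdsWithin_iff.2 ⟨((continuous_const_mul a).tendsto t).mono_left nhdsWithin_le_nhds,
        eventually_mem_nhdsWithin.mono fun u hu => mul_lt_mul_of_pos_left hu ha⟩
    obtain ⟨L, R, hi, hL, hR⟩ := h.exists_Ioo (a * t) i
    refine ⟨rescale n (cluster (before η (a * t)) i), rescale_cluster_mem_intervals n
      (h.before_eq_false hat hL) (h.before_eq_false hat hR) hi, ?_⟩
    filter_upwards [this.eventually (h.eventually_cluster_eq_before i hat)] with u hu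
    rw [hu]

end IsRegularPath

end Paths

/-! ### Almost sure regularity of forest fire processes -/

section Regularity

lemma IsPositiveLaw.slowedLaw {μ : Measure ℝ} (h : IsPositiveLaw μ) {l : ℝ} (hl : 0 < l) :
    IsPositiveLaw (slowedLaw μ l) := by
  have := h.isProbabilityMeasure
  have hm : Measurable fun t : ℝ => t / l := measurable_id.div_const l
  refine ⟨Measure.isProbabilityMeasure_map hm.aemeasurable, ?_, ?_⟩
  · rw [ForestFire.slowedLaw, Measure.map_apply hm measurableSet_Iic]
    refine measure_mono_null (fun t ht => ?_) h.pos
    have ht' : t / l ≤ 0 := ht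
    rw [div_le_iff₀ hl, zero_mul] at ht'
    exact ht'
  · rw [ForestFire.slowedLaw, integrable_map_measure (by fun_prop) hm.aemeasurable]
    exact h.integrable.div_const l

lemma mean_slowedLaw {μ : Measure ℝ} (l : ℝ) : mean (slowedLaw μ l) = mean μ / l := by
  have hm : Measurable fun t : ℝ => t / l := measurable_id.div_const l
  rw [mean, slowedLaw, integral_map hm.aemeasurable (by fun_prop), integral_div, mean]

namespace IsForestFire

variable {Ω : Type*} [MeasurableSpace Ω] {P : Measure Ω} [IsProbabilityMeasure P]
  {μS μM : Measure ℝ} {S M : ℤ → ℕ → Ω → ℝ} {η : Ω → ℝ → ℤ → Bool}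

omit [IsProbabilityMeasure P] in
lemma iIndepFun_first (h : IsForestFire P μS μM S M η) : iIndepFun (fun i => S i 0) P := by
  have h1 := h.indep.precomp (g := (Sum.inl : ℤ → ℤ ⊕ ℤ)) Sum.inl_injective
  exact h1.comp (fun _ f => f 0) fun _ => measurable_pi_apply 0

/-- The events that the sites receive a seed before time `H` are independent. -/
lemma measure_biInter_first (h : IsForestFire P μS μM S M η) (H : ℝ) (J : Finset ℤ) :
    P (⋂ i ∈ J, {ω | S i 0 ω ≤ H}) = (delayLaw μS (Iic H)) ^ J.card := by
  have := h.iIndepFun_first.meas_biInter (S := J) (s := fun i => {ω | S i 0 ω ≤ H})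
    (fun i _ => ⟨Iic H, measurableSet_Iic, rfl⟩)
  rw [this, ← Finset.prod_const]
  exact Finset.prod_congr rfl fun i _ => (h.seeds i).measure_first measurableSet_Iic

lemma isProbabilityMeasure_delayLaw (h : IsForestFire P μS μM S M η) :
    IsProbabilityMeasure (delayLaw μS) := (h.seeds 0).isProbabilityMeasure_delayLaw

/-- The first `n` sites of the sequence are all seeded by time `H` with probability `ν_S((-∞, H]) ^
n`, which tends to 0. Applied on both sides of a site, this keeps clusters finite over bounded
times. -/
lemma ae_exists_lt_first (h : IsForestFire P μS μM S M η) (hS : HypSZero μS) (H : ℝ) {f : ℕ → ℤ}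
    (hf : Function.Injective f) : ∀ᵐ ω ∂P, ∃ n, H < S (f n) 0 ω := by
  have := h.isProbabilityMeasure_delayLaw
  have hlt : delayLaw μS (Iic H) < 1 := by
    refine prob_le_one.lt_of_ne fun h1 => ?_
    have h2 := (prob_compl_eq_zero_iff measurableSet_Iic).2 h1
    rw [compl_Iic] at h2
    have h3 := hS.delayLaw_pos H
    rw [measureReal_def, h2] at h3
    simp at h3
  rw [ae_iff]
  refine le_antisymm (ge_of_tendsto' (ENNReal.tendsto_pow_atTop_nhds_zero_of_lt_one hlt)
    fun n => ?_) (zero_le)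
  have h1 := h.measure_biInter_first H ((Finset.range n).map ⟨f, hf⟩)
  rw [Finset.card_map, Finset.card_range] at h1
  rw [← h1]
  refine measure_mono fun ω hω => ?_
  simp only [mem_ofPred_eq, not_exists, not_lt] at hω
  simp only [Finset.mem_map, mem_iInter]
  rintro _ ⟨k, -, rfl⟩
  exact hω k

lemma ae_isRegularPath (h : IsForestFire P μS μM S M η) (hS : HypSZero μS) :
    ∀ᵐ ω ∂P, IsRegularPath (fun j k => S j k ω) (fun j k => M j k ω) (η ω) := by
  have h1 := ae_all_iff.2 fun i => (h.seeds i).ae_pos hS.isPositiveLaw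
  have h2 := ae_all_iff.2 fun i => (h.seeds i).ae_finite hS.isPositiveLaw
  have h3 : ∀ᵐ ω ∂P, ∀ (H : ℕ) (N : ℤ), ∃ n : ℕ, (H : ℝ) < S (N + 1 + n) 0 ω :=
    ae_all_iff.2 fun H => ae_all_iff.2 fun N =>
      h.ae_exists_lt_first hS H (f := fun n => N + 1 + n) fun a b hab => by simpa using hab
  have h4 : ∀ᵐ ω ∂P, ∀ (H : ℕ) (N : ℤ), ∃ n : ℕ, (H : ℝ) < S (N - 1 - n) 0 ω :=
    ae_all_iff.2 fun H => ae_all_iff.2 fun N =>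
      h.ae_exists_lt_first hS H (f := fun n => N - 1 - n) fun a b hab => by simpa using hab
  filter_upwards [h1, h2, h3, h4, ae_all_iff.2 h.cadlag, h.equation] with ω h1 h2 h3 h4 h5 h6
  refine ⟨h5, fun i k => ?_, h2, h6, fun H N => ?_, fun H N => ?_⟩
  · induction k with
    | zero => exact le_rfl
    | succ k ih =>
      have := h1 i (k + 1)
      simp only [gap] at this
      linarith
  · obtain ⟨K, hK⟩ := exists_nat_ge H
    obtain ⟨n, hn⟩ := h3 K N
    exact ⟨_, by lia, hK.trans_lt hn⟩
  · obtain ⟨K, hK⟩ := exists_nat_ge H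
    obtain ⟨n, hn⟩ := h4 K N
    exact ⟨_, by lia, hK.trans_lt hn⟩

end IsForestFire

end Regularity

/-! ### Measurability -/

section Measurability

/-- The set `θ '' (G ⁻¹' s)` is countable, whatever `s` and `G` are. Test functions are not assumed
measurable for any σ-algebra, so measurability has to come from discreteness of the source. -/
lemma measurable_of_factorsThrough {Ω β γ : Type*} [MeasurableSpace Ω] [MeasurableSpace β]
    [MeasurableSpace γ] [Countable β] [MeasurableSingletonClass β] {θ : Ω → β} (hθ : Measurable θ)
    {G : Ω → γ} (h : Function.FactorsThrough G θ) : Measurable G := fun s _ => by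
  have : G ⁻¹' s = θ ⁻¹' (θ '' (G ⁻¹' s)) := by
    refine (subset_preimage_image θ _).antisymm ?_
    rintro ω ⟨ω', hω', he⟩
    rwa [mem_preimage, ← h he]
  rw [this]
  exact hθ (to_countable _).measurableSet

/-- The first time after `t` in the grid of mesh `1 / (m + 1)`. -/
noncomputable def nextGrid (m : ℕ) (t : ℝ) : ℝ := (⌊t * (m + 1)⌋₊ + 1) / (m + 1)

lemma lt_nextGrid (m : ℕ) (t : ℝ) : t < nextGrid m t := by
  rw [nextGrid, lt_div_iff₀ (by positivity)]
  exact Nat.lt_floor_add_one _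

lemma nextGrid_le (m : ℕ) {t : ℝ} (ht : 0 ≤ t) : nextGrid m t ≤ t + 1 / (m + 1) := by
  rw [nextGrid, add_div]
  gcongr
  rw [div_le_iff₀ (by positivity)]
  exact Nat.floor_le (by positivity)

lemma tendsto_nextGrid {t : ℝ} (ht : 0 ≤ t) : Tendsto (fun m => nextGrid m t) atTop (𝓝[>] t) := by
  refine tendsto_nhdsWithin_iff.2 ⟨?_, .of_forall fun m => lt_nextGrid m t⟩
  refine tendsto_of_tendsto_of_tendsto_of_le_of_le tendsto_const_nhds ?_
    (fun m => (lt_nextGrid m t).le) fun m => nextGrid_le m ht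
  simpa using (tendsto_one_div_add_atTop_nhds_zero_nat (𝕜 := ℝ)).const_add t

lemma nextGrid_eq_of_mem {m : ℕ} {s t : ℝ} (ht : 0 ≤ t) (hs : s ∈ Ico t (nextGrid m t)) :
    nextGrid m s = nextGrid m t := by
  have h1 : ⌊s * (m + 1)⌋₊ = ⌊t * (m + 1)⌋₊ := by
    rw [Nat.floor_eq_iff (mul_nonneg (ht.trans hs.1) (by positivity))]
    constructor
    · refine (Nat.floor_le (by positivity)).trans ?_
      gcongr
      exact hs.1
    · have := hs.2
      rwa [nextGrid, lt_div_iff₀ (by positivity)] at this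
  rw [nextGrid, h1, nextGrid]

lemma eventually_nextGrid_eq_left (m : ℕ) {t : ℝ} (ht : 0 < t) :
    ∃ c, ∀ᶠ s in 𝓝[<] t, nextGrid m s = c := by
  have hpos : 0 < ⌈t * (m + 1)⌉₊ := Nat.ceil_pos.2 (by positivity)
  obtain ⟨c, hc⟩ : ∃ c, ⌈t * (m + 1)⌉₊ = c + 1 := ⟨_, (Nat.succ_pred_eq_of_pos hpos).symm⟩
  have hct : (c : ℝ) / (m + 1) < t := by
    rw [div_lt_iff₀ (by positivity)]
    exact Nat.lt_ceil.1 (by lia)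
  refine ⟨(c + 1) / (m + 1), ?_⟩
  filter_upwards [Ioo_mem_nhdsLT hct] with s hs
  have h1 : (c : ℝ) ≤ s * (m + 1) := by
    have := hs.1
    rw [div_lt_iff₀ (by positivity)] at this
    exact this.le
  have h2 : s * (m + 1) < c + 1 := by
    have h3 : t * (m + 1) ≤ ((c + 1 : ℕ) : ℝ) := hc ▸ Nat.le_ceil _
    push_cast at h3
    exact (mul_lt_mul_of_pos_right hs.2 (by positivity)).trans_le h3
  rw [nextGrid, (Nat.floor_eq_iff ((Nat.cast_nonneg c).trans h1)).2 ⟨h1, h2⟩]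

/-- Truncating time at `T` makes the whole path, and not only its restriction to `[0, T]`, depend on
finitely many grid times; a test function is applied to paths defined on all of `ℝ`. -/
lemma isStepPath_nextGrid (T : ℝ) (m : ℕ) {J : ℝ → Set ℝ} (hJ : ∀ u, J u ∈ intervals) :
    IsStepPath T fun t => J (nextGrid m (min t T)) where
  mem t _ := hJ _
  right t ht := by
    filter_upwards [Ioo_mem_nhdsGT ht.2, Ioo_mem_nhdsGT (lt_nextGrid m t)] with s hs hs'
    rw [min_eq_left hs.2.le, min_eq_left ht.2.le, nextGrid_eq_of_mem ht.1 ⟨hs'.1.le, hs'.2⟩]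
  left t ht := by
    obtain ⟨c, hc⟩ := eventually_nextGrid_eq_left m ht.1
    refine ⟨J c, hJ c, ?_⟩
    filter_upwards [hc, self_mem_nhdsWithin] with s hs hst
    rw [min_eq_left ((le_of_lt hst).trans ht.2), hs]

/-- The sampled functions `f (nextGrid m t)` factor through an integer part, hence are measurable.
Since `nextGrid m t` decreases strictly from the right of `t` to `t` in the limit, being locally
constant on the right gives convergence at every `t` of `(0, T)`. -/
lemma aestronglyMeasurable_of_eventually_right {f : ℝ → ℝ} {T : ℝ}
    (h : ∀ t ∈ Ico 0 T, ∀ᶠ s in 𝓝[>] t, f s = f t) :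
    AEStronglyMeasurable f (volume.restrict (Ioc 0 T)) := by
  refine aestronglyMeasurable_of_tendsto_ae atTop (f := fun m t => f (nextGrid m t)) (fun m => ?_) ?_
  · have h1 : Measurable fun t : ℝ => ⌊t * (m + 1)⌋₊ :=
      Nat.measurable_floor.comp (measurable_id.mul_const _)
    exact ((measurable_from_nat (f := fun k : ℕ => f ((k + 1) / (m + 1)))).comp
      h1).aestronglyMeasurable
  · filter_upwards [ae_restrict_mem measurableSet_Ioc,
      ae_restrict_of_ae (compl_mem_ae_iff.2 (measure_singleton T))] with t ht htT
    refine tendsto_const_nhds.congr' ?_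
    filter_upwards [(tendsto_nextGrid ht.1.le).eventually (h t ⟨ht.1.le, ht.2.lt_of_ne htT⟩)]
      with m hm
    exact hm.symm

namespace IsStepPath

lemma intervalIntegrable {T A : ℝ} (hT : 0 ≤ T) (hA : 0 ≤ A) {I J : ℝ → Set ℝ} (hI : IsStepPath T I)
    (hJ : IsStepPath T J) (hIA : ∀ t ∈ Icc 0 T, I t ⊆ Icc (-A) A)
    (hJA : ∀ t ∈ Icc 0 T, J t ⊆ Icc (-A) A) :
    IntervalIntegrable (fun t => intervalDist (I t) (J t)) volume 0 T := by
  rw [intervalIntegrable_iff_integrableOn_Ioc_of_le hT]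
  refine Integrable.of_bound (C := 4 * A) ?_ ?_
  · refine aestronglyMeasurable_of_eventually_right fun t ht => ?_
    filter_upwards [hI.right t ht, hJ.right t ht] with s h1 h2
    rw [h1, h2]
  · filter_upwards [ae_restrict_mem measurableSet_Ioc] with t ht
    have ht' := Ioc_subset_Icc_self ht
    rw [Real.norm_of_nonneg (intervalDist_nonneg (hI.mem t ht') (hJ.mem t ht'))]
    exact intervalDist_le_of_subset hA (hI.mem t ht') (hJ.mem t ht') (hIA t ht') (hJA t ht')

end IsStepPath

namespace IsForestFire

variable {Ω : Type*} [MeasurableSpace Ω] {P : Measure Ω} [IsProbabilityMeasure P]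
  {μS μM : Measure ℝ} {S M : ℤ → ℕ → Ω → ℝ} {η : Ω → ℝ → ℤ → Bool}

omit [IsProbabilityMeasure P] in
lemma measurable_of_window (h : IsForestFire P μS μM S M η) {K m : ℕ} {τ : Fin K → ℝ} {G : Ω → ℝ}
    (hG : ∀ ω ω', (∀ k, window m (η ω (τ k)) = window m (η ω' (τ k))) → G ω = G ω') :
    Measurable G := by
  let θ : Ω → Fin K × Finset.Icc (-m : ℤ) m → Bool := fun ω q => η ω (τ q.1) q.2
  have hθ : Measurable θ := measurable_pi_lambda _ fun q => h.measurable _ _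
  refine measurable_of_factorsThrough hθ fun ω ω' he => hG ω ω' fun k => ?_
  ext j
  simp only [window]
  split_ifs with hj
  · exact congrFun he (k, ⟨j, Finset.mem_Icc.2 hj⟩)
  · rfl

/-- For almost every `ω`, the clusters of the truncated configurations equal the true ones for large
`m`, so no continuity of `F` is required. -/
lemma aestronglyMeasurable_clusters (h : IsForestFire P μS μM S M η) (hS : HypSZero μS) (n : ℕ)
    {p : ℕ} (i : Fin p → ℤ) {τ : Fin p → ℝ} (hτ : ∀ k, 0 ≤ τ k) (F : (Fin p → Set ℝ) → ℝ) :
    AEStronglyMeasurable (fun ω => F fun k => rescale n (cluster (η ω (τ k)) (i k))) P := by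
  refine aestronglyMeasurable_of_tendsto_ae atTop
    (f := fun m ω => F fun k => rescale n (cluster (window m (η ω (τ k))) (i k))) (fun m => ?_) ?_
  · refine (h.measurable_of_window (m := m) (τ := τ) fun ω ω' he => ?_).aestronglyMeasurable
    simp_rw [he]
  · filter_upwards [h.ae_isRegularPath hS] with ω hω
    refine tendsto_const_nhds.congr' ?_
    choose L R hi hL hR using fun k => hω.exists_Ioo (τ k) (i k)
    have h1 : ∀ᶠ m in atTop, ∀ k, (L k).natAbs ≤ m ∧ (R k).natAbs ≤ m :=
      eventually_all.2 fun k => (eventually_ge_atTop _).and (eventually_ge_atTop _)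
    filter_upwards [h1] with m hm
    congr 1
    ext1 k
    rw [cluster_window (hω.eq_false (hτ k) (hL k)) (hω.eq_false (hτ k) (hR k)) (hi k) (hm k).1
      (hm k).2]

/-- A path involves uncountably many times, so time is sampled as well as space truncated. The
approximations depend on finitely many spins and converge for `δ_T` by dominated convergence;
continuity of `F` concludes. -/
lemma aestronglyMeasurable_paths (h : IsForestFire P μS μM S M η) (hS : HypSZero μS) (n : ℕ)
    {p : ℕ} (i : Fin p → ℤ) {a T : ℝ} (ha : 0 < a) (hT : 0 < T) {F : (Fin p → ℝ → Set ℝ) → ℝ}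
    (hF : IsTestFunction {J : Fin p → ℝ → Set ℝ | ∀ k, J k ∈ cadlagPaths T}
      (fun I J => ∑ k, pathDist T (I k) (J k)) F) :
    AEStronglyMeasurable (fun ω => F fun k t => rescale n (cluster (η ω (a * t)) (i k))) P := by
  refine aestronglyMeasurable_of_tendsto_ae atTop (f := fun m ω => F fun k t =>
    rescale n (cluster (window m (η ω (a * nextGrid m (min t T)))) (i k))) (fun m => ?_) ?_
  · refine (h.measurable_of_window (m := m) (K := ⌊T * (m + 1)⌋₊ + 1)
      (τ := fun k => a * ((k + 1) / (m + 1))) fun ω ω' he => ?_).aestronglyMeasurable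
    congr 1
    ext1 k
    ext1 t
    have hlt : ⌊min t T * (m + 1)⌋₊ < ⌊T * (m + 1)⌋₊ + 1 :=
      Nat.lt_succ_of_le (Nat.floor_mono (mul_le_mul_of_nonneg_right (min_le_right _ _)
        (by positivity)))
    have := he ⟨_, hlt⟩
    simp only at this
    rw [nextGrid, this]
  · filter_upwards [h.ae_isRegularPath hS] with ω hω
    -- The horizon is `T + 1` because the grid time following some `t ≤ T` may exceed `T`, by at
    -- most `1 / (m + 1)`.
    choose L R hi hL hR using fun k => hω.exists_Ioo (a * (T + 1)) (i k)
    have hmem : ∀ m k, IsStepPath T fun t =>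
        rescale n (cluster (window m (η ω (a * nextGrid m (min t T)))) (i k)) := fun m k =>
      isStepPath_nextGrid T m (J := fun u => rescale n (cluster (window m (η ω (a * u))) (i k)))
        fun u => rescale_cluster_window_mem_intervals n m _ _
    have hmem' : ∀ k, IsStepPath T fun t => rescale n (cluster (η ω (a * t)) (i k)) := fun k =>
      hω.isStepPath n (i k) ha T
    have hwin : ∀ᶠ m in atTop, ∀ k, ∀ u ∈ Icc 0 (T + 1),
        cluster (window m (η ω (a * u))) (i k) = cluster (η ω (a * u)) (i k) := by
      have h1 : ∀ᶠ m in atTop, ∀ k, (L k).natAbs ≤ m ∧ (R k).natAbs ≤ m :=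
        eventually_all.2 fun k => (eventually_ge_atTop _).and (eventually_ge_atTop _)
      filter_upwards [h1] with m hm k u hu
      have h0 : 0 ≤ a * u := mul_nonneg ha.le hu.1
      have h1 : a * u ≤ a * (T + 1) := mul_le_mul_of_nonneg_left hu.2 ha.le
      exact cluster_window (hω.eq_false h0 (h1.trans_lt (hL k)))
        (hω.eq_false h0 (h1.trans_lt (hR k))) (hi k) (hm k).1 (hm k).2
    have hgrid : ∀ m, ∀ t ∈ Icc 0 T, nextGrid m t ∈ Icc 0 (T + 1) := fun m t ht => by
      refine ⟨ht.1.trans (lt_nextGrid m t).le, (nextGrid_le m ht.1).trans (add_le_add ht.2 ?_)⟩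
      rw [div_le_one (by positivity)]
      linarith [m.cast_nonneg (α := ℝ)]
    have hdist : Tendsto (fun m : ℕ => ∑ k, pathDist T (fun t => rescale n (cluster (η ω (a * t)) (i k)))
        (fun t => rescale n (cluster (window m (η ω (a * nextGrid m (min t T)))) (i k))))
        atTop (𝓝 (∑ k : Fin p, 0)) := by
      refine tendsto_finsetSum _ fun k _ => ?_
      have hzero : (0 : ℝ) = ∫ t in (0 : ℝ)..T, 0 := by simp
      rw [hzero]
      set A := max |((L k : ℝ) + 1) / n| |((R k : ℝ) - 1) / n| with hAdef
      have hA : 0 ≤ A := (abs_nonneg _).trans (le_max_left _ _)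
      have hsub : ∀ u ∈ Icc 0 (T + 1), rescale n (cluster (η ω (a * u)) (i k)) ⊆ Icc (-A) A := by
        intro u hu
        have h1 : a * u ≤ a * (T + 1) := mul_le_mul_of_nonneg_left hu.2 ha.le
        refine (hω.rescale_cluster_subset n (hi k) (mul_nonneg ha.le hu.1) (h1.trans_lt (hL k))
          (h1.trans_lt (hR k))).trans (Icc_subset_Icc ?_ ?_)
        · exact neg_le.1 ((neg_le_abs _).trans (le_max_left _ _))
        · exact (le_abs_self _).trans (le_max_right _ _)
      have hsub' : ∀ t ∈ Icc 0 T, rescale n (cluster (η ω (a * t)) (i k)) ⊆ Icc (-A) A :=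
        fun t ht => hsub t ⟨ht.1, ht.2.trans (by linarith)⟩
      refine intervalIntegral.tendsto_integral_filter_of_dominated_convergence (fun _ => 4 * A)
        ?_ ?_ (by simp) ?_
      · refine .of_forall fun m => ?_
        rw [uIoc_of_le hT.le]
        refine aestronglyMeasurable_of_eventually_right fun t ht => ?_
        filter_upwards [(hmem' k).right t ht, (hmem m k).right t ht] with s h1 h2
        rw [h1, h2]
      · filter_upwards [hwin] with m hm
        refine .of_forall fun t ht => ?_
        rw [uIoc_of_le hT.le] at ht
        have ht' := Ioc_subset_Icc_self ht
        rw [Real.norm_of_nonneg (intervalDist_nonneg ((hmem' k).mem t ht') ((hmem m k).mem t ht'))]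
        refine intervalDist_le_of_subset hA ((hmem' k).mem t ht') ((hmem m k).mem t ht')
          (hsub' t ht') ?_
        rw [min_eq_left ht'.2, hm k _ (hgrid m t ht')]
        exact hsub _ (hgrid m t ht')
      · refine .of_forall fun t ht => tendsto_const_nhds.congr' ?_
        rw [uIoc_of_le hT.le] at ht
        have ht' := Ioc_subset_Icc_self ht
        have h1 : ∀ᶠ u in 𝓝[>] t, rescale n (cluster (η ω (a * u)) (i k)) =
            rescale n (cluster (η ω (a * t)) (i k)) :=
          (hω.isStepPath n (i k) ha (T + 1)).right t ⟨ht.1.le, by linarith [ht.2]⟩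
        filter_upwards [hwin, (tendsto_nextGrid ht'.1).eventually h1] with m hm hm'
        rw [min_eq_left ht'.2, hm k _ (hgrid m t ht'), hm', intervalDist_self]
    rw [Finset.sum_const_zero] at hdist
    refine Metric.tendsto_nhds.2 fun ε hε => ?_
    obtain ⟨r, hr, hFr⟩ := hF.2 (fun k t => rescale n (cluster (η ω (a * t)) (i k)))
      (fun k => (hmem' k).mem_cadlagPaths) ε hε
    filter_upwards [hdist.eventually_lt_const hr] with m hm
    exact hFr _ (fun k => (hmem m k).mem_cadlagPaths) hm

end IsForestFire

end Measurability

/-! ### Occupied cells -/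

section Cells

open Classical in
/-- The cells `j ∈ I` whose void event `V j` does not occur. -/
noncomputable def nonvoid {Ω : Type*} (I : Finset ℤ) (V : ℤ → Set Ω) (ω : Ω) : Finset ℤ :=
  I.filter fun j => ω ∉ V j

lemma mem_nonvoid {Ω : Type*} {I : Finset ℤ} {V : ℤ → Set Ω} {ω : Ω} {j : ℤ} :
    j ∈ nonvoid I V ω ↔ j ∈ I ∧ ω ∉ V j := by
  simp [nonvoid]

variable {Ω : Type*} [MeasurableSpace Ω] {P : Measure Ω} {V : ℤ → Set Ω}

omit [MeasurableSpace Ω] in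
lemma nonvoid_eq_iff {I v : Finset ℤ} (hv : v ⊆ I) {ω : Ω} :
    nonvoid I V ω = v ↔ ω ∈ ⋂ j ∈ I, (if j ∈ v then (V j)ᶜ else V j) := by
  simp only [mem_iInter, Finset.ext_iff, mem_nonvoid]
  constructor
  · intro h j hj
    have := h j
    split_ifs with hjv
    · exact (this.2 hjv).2
    · by_contra hV
      exact hjv (this.1 ⟨hj, hV⟩)
  · intro h j
    constructor
    · rintro ⟨hj, hV⟩
      by_contra hjv
      have := h j hj
      rw [if_neg hjv] at this
      exact hV this
    · intro hjv
      have := h j (hv hjv)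
      rw [if_pos hjv] at this
      exact ⟨hv hjv, this⟩

lemma measurableSet_nonvoid_eq (hV : ∀ j, MeasurableSet (V j)) {I v : Finset ℤ} (hv : v ⊆ I) :
    MeasurableSet {ω | nonvoid I V ω = v} := by
  have : {ω | nonvoid I V ω = v} = ⋂ j ∈ I, (if j ∈ v then (V j)ᶜ else V j) := by
    ext ω
    exact nonvoid_eq_iff hv
  rw [this]
  refine Finset.measurableSet_biInter I fun j _ => ?_
  split_ifs
  · exact (hV j).compl
  · exact hV j

lemma measureReal_nonvoid_eq [IsProbabilityMeasure P] (hV : ∀ j, MeasurableSet (V j))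
    (hind : iIndepSet V P) {I v : Finset ℤ} (hv : v ⊆ I) :
    P.real {ω | nonvoid I V ω = v} =
      ∏ j ∈ I, (if j ∈ v then 1 - P.real (V j) else P.real (V j)) := by
  have h1 : {ω | nonvoid I V ω = v} = ⋂ j ∈ I, (if j ∈ v then (V j)ᶜ else V j) := by
    ext ω
    exact nonvoid_eq_iff hv
  have h2 := hind.iIndep_comap_mem.meas_biInter (S := I)
    (s := fun j => if j ∈ v then (V j)ᶜ else V j) fun j _ => by
      split_ifs
      · exact ⟨{False}, trivial, by ext ω; simp⟩
      · exact ⟨{True}, trivial, by ext ω; simp⟩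
  rw [h1, measureReal_def, h2, ENNReal.toReal_prod]
  refine Finset.prod_congr rfl fun j _ => ?_
  split_ifs
  · rw [← measureReal_def, probReal_compl_eq_one_sub (hV j)]
  · rfl

omit [MeasurableSpace Ω] in
lemma comp_nonvoid_eq_sum (I : Finset ℤ) (V : ℤ → Set Ω) (f : Finset ℤ → ℝ) (ω : Ω) :
    f (nonvoid I V ω) = ∑ v ∈ I.powerset, {ω | nonvoid I V ω = v}.indicator (fun _ => f v) ω := by
  classical
  have hmem : nonvoid I V ω ∈ I.powerset := Finset.mem_powerset.2 (Finset.filter_subset _ _)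
  rw [Finset.sum_eq_single_of_mem _ hmem]
  · simp
  · intro v _ hne
    simp [indicator, hne.symm]

lemma measurable_comp_nonvoid (hV : ∀ j, MeasurableSet (V j)) (I : Finset ℤ) (f : Finset ℤ → ℝ) :
    Measurable fun ω => f (nonvoid I V ω) := by
  simp_rw [comp_nonvoid_eq_sum I V f]
  exact Finset.measurable_sum _ fun v hv =>
    measurable_const.indicator (measurableSet_nonvoid_eq hV (Finset.mem_powerset.1 hv))

lemma integral_comp_nonvoid [IsProbabilityMeasure P] (hV : ∀ j, MeasurableSet (V j))
    (hind : iIndepSet V P) (I : Finset ℤ) (f : Finset ℤ → ℝ) :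
    ∫ ω, f (nonvoid I V ω) ∂P =
      ∑ v ∈ I.powerset, (∏ j ∈ I, (if j ∈ v then 1 - P.real (V j) else P.real (V j))) * f v := by
  simp_rw [comp_nonvoid_eq_sum I V f]
  rw [integral_finsetSum _ fun v hv => (integrable_const _).indicator
    (measurableSet_nonvoid_eq hV (Finset.mem_powerset.1 hv))]
  refine Finset.sum_congr rfl fun v hv => ?_
  rw [integral_indicator_const _ (measurableSet_nonvoid_eq hV (Finset.mem_powerset.1 hv)),
    measureReal_nonvoid_eq hV hind (Finset.mem_powerset.1 hv), smul_eq_mul]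

/-- By independence, the law of the set of nonvoid cells is a polynomial in finitely many void
probabilities, so the convergence of each of these suffices. -/
lemma tendsto_integral_comp_nonvoid {Ω : ℝ → Type*} [∀ l, MeasurableSpace (Ω l)]
    {P : ∀ l, Measure (Ω l)} [∀ l, IsProbabilityMeasure (P l)] {V : ∀ l, ℤ → Set (Ω l)}
    {Ω' : Type*} [MeasurableSpace Ω'] {P' : Measure Ω'} [IsProbabilityMeasure P']
    {V' : ℤ → Set Ω'} {g : Filter ℝ} (hV : ∀ᶠ l in g, ∀ j, MeasurableSet (V l j))
    (hind : ∀ᶠ l in g, iIndepSet (V l) (P l)) (hV' : ∀ j, MeasurableSet (V' j))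
    (hind' : iIndepSet V' P')
    (h : ∀ j, Tendsto (fun l => (P l).real (V l j)) g (𝓝 (P'.real (V' j)))) (I : Finset ℤ)
    (f : Finset ℤ → ℝ) :
    Tendsto (fun l => ∫ ω, f (nonvoid I (V l) ω) ∂(P l)) g (𝓝 (∫ ω, f (nonvoid I V' ω) ∂P')) := by
  rw [integral_comp_nonvoid hV' hind']
  have h1 : Tendsto (fun l => ∑ v ∈ I.powerset,
      (∏ j ∈ I, (if j ∈ v then 1 - (P l).real (V l j) else (P l).real (V l j))) * f v) g
      (𝓝 (∑ v ∈ I.powerset,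
        (∏ j ∈ I, (if j ∈ v then 1 - P'.real (V' j) else P'.real (V' j))) * f v)) := by
    refine tendsto_finsetSum _ fun v _ => Tendsto.mul_const _ (tendsto_finsetProd _ fun j _ => ?_)
    split_ifs
    · exact (h j).const_sub 1
    · exact h j
  refine h1.congr' ?_
  filter_upwards [hV, hind] with l h1 h2
  rw [integral_comp_nonvoid h1 h2]

/-- The macroscopic cell `(j h, (j + 1) h]`. -/
def cell (h : ℝ) (j : ℤ) : Set ℝ := Ioc (j * h) ((j + 1) * h)

lemma measurableSet_cell (h : ℝ) (j : ℤ) : MeasurableSet (cell h j) := measurableSet_Ioc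

lemma pairwise_disjoint_cell {h : ℝ} (hh : 0 < h) : Pairwise fun i j => Disjoint (cell h i) (cell h j) := by
  intro i j hij
  wlog hlt : i < j generalizing i j
  · exact (this hij.symm (lt_of_le_of_ne (not_lt.1 hlt) hij.symm)).symm
  refine Ioc_disjoint_Ioc_of_le ?_
  have : (i : ℝ) + 1 ≤ j := by exact_mod_cast hlt
  gcongr

/-- The sites that belong to the cell `(j h, (j + 1) h]` after rescaling by `n`. -/
noncomputable def siteCell (n : ℕ) (h : ℝ) (j : ℤ) : Finset ℤ :=
  Finset.Ioc ⌊n * (j * h)⌋ ⌊n * ((j + 1) * h)⌋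

lemma mem_siteCell {n : ℕ} (hn : 0 < n) {h : ℝ} {i j : ℤ} :
    i ∈ siteCell n h j ↔ (i : ℝ) / n ∈ cell h j := by
  have hn' : (0 : ℝ) < n := Nat.cast_pos.2 hn
  rw [siteCell, Finset.mem_Ioc, Int.floor_lt, Int.le_floor, cell, mem_Ioc, lt_div_iff₀ hn',
    div_le_iff₀ hn', mul_comm (n : ℝ), mul_comm (n : ℝ)]

lemma disjoint_siteCell {n : ℕ} (hn : 0 < n) {h : ℝ} (hh : 0 < h) {j k : ℤ} (hjk : j ≠ k) :
    Disjoint (siteCell n h j) (siteCell n h k) := by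
  rw [Finset.disjoint_left]
  intro i hi hi'
  rw [mem_siteCell hn] at hi hi'
  exact Set.disjoint_left.1 (pairwise_disjoint_cell hh hjk) hi hi'

lemma tendsto_card_siteCell {h : ℝ} (hh : 0 < h) (j : ℤ) :
    Tendsto (fun n : ℕ => ((siteCell n h j).card : ℝ) / n) atTop (𝓝 h) := by
  have h1 : ∀ y : ℝ, Tendsto (fun n : ℕ => (⌊n * y⌋ : ℝ) / n) atTop (𝓝 y) := by
    intro y
    have hlow : Tendsto (fun n : ℕ => y - 1 / (n : ℝ)) atTop (𝓝 y) := by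
      simpa using (tendsto_one_div_atTop_nhds_zero_nat (𝕜 := ℝ)).const_sub y
    refine tendsto_of_tendsto_of_tendsto_of_le_of_le' hlow tendsto_const_nhds ?_ ?_
    all_goals
      filter_upwards [eventually_gt_atTop 0] with n hn
      have hn' : (0 : ℝ) < n := Nat.cast_pos.2 hn
    · rw [le_div_iff₀ hn', sub_mul, one_div, inv_mul_cancel₀ hn'.ne', mul_comm]
      exact (Int.sub_one_lt_floor _).le
    · rw [div_le_iff₀ hn', mul_comm]
      exact Int.floor_le _
  have h2 := (h1 ((j + 1) * h)).sub (h1 (j * h))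
  rw [show ((j : ℝ) + 1) * h - j * h = h by ring] at h2
  refine h2.congr fun n => ?_
  have hle : ⌊(n : ℝ) * (j * h)⌋ ≤ ⌊(n : ℝ) * ((j + 1) * h)⌋ := by
    refine Int.floor_mono ?_
    gcongr
    linarith
  rw [siteCell, Int.card_Ioc, ← sub_div]
  congr 1
  have : ((⌊(n : ℝ) * ((j + 1) * h)⌋ - ⌊(n : ℝ) * (j * h)⌋).toNat : ℤ) =
      ⌊(n : ℝ) * ((j + 1) * h)⌋ - ⌊(n : ℝ) * (j * h)⌋ := Int.toNat_of_nonneg (by lia)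
  exact_mod_cast this.symm

end Cells

/-! ### Sites that remain vacant -/

section Vacant

/-- All sites of the cell `j` receive a seed before time `H`. -/
def seededCell {Ω : Type*} (S : ℤ → ℕ → Ω → ℝ) (n : ℕ) (h H : ℝ) (j : ℤ) : Set Ω :=
  ⋂ i ∈ siteCell n h j, {ω | S i 0 ω ≤ H}

namespace IsForestFire

variable {Ω : Type*} [MeasurableSpace Ω] {P : Measure Ω} [IsProbabilityMeasure P]
  {μS μM : Measure ℝ} {S M : ℤ → ℕ → Ω → ℝ} {η : Ω → ℝ → ℤ → Bool}

omit [IsProbabilityMeasure P] in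
lemma measurableSet_seededCell (hη : IsForestFire P μS μM S M η) (n : ℕ) (h H : ℝ) (j : ℤ) :
    MeasurableSet (seededCell S n h H j) :=
  Finset.measurableSet_biInter _ fun i _ => (hη.seeds i).measurable 0 measurableSet_Iic

lemma iIndepSet_seededCell (hη : IsForestFire P μS μM S M η) {n : ℕ} (hn : 0 < n) {h : ℝ}
    (hh : 0 < h) (H : ℝ) : iIndepSet (seededCell S n h H) P := by
  refine (iIndepSet_iff_meas_biInter (hη.measurableSet_seededCell n h H)).2 fun J => ?_
  have h1 : ⋂ j ∈ J, seededCell S n h H j =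
      ⋂ i ∈ J.biUnion (siteCell n h), {ω | S i 0 ω ≤ H} := by
    ext ω
    simp only [seededCell, mem_iInter, Finset.mem_biUnion]
    exact ⟨fun h i ⟨j, hj, hi⟩ => h j hj i hi, fun h j hj i hi => h i ⟨j, hj, hi⟩⟩
  rw [h1, hη.measure_biInter_first, Finset.card_biUnion fun j _ k _ hjk =>
    disjoint_siteCell hn hh hjk, ← Finset.prod_pow_eq_pow_sum]
  exact Finset.prod_congr rfl fun j _ => (hη.measure_biInter_first H _).symm

lemma measureReal_seededCell (hη : IsForestFire P μS μM S M η) (n : ℕ) (h H : ℝ) (j : ℤ) :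
    P.real (seededCell S n h H j) = (1 - (delayLaw μS).real (Ioi H)) ^ (siteCell n h j).card := by
  have := hη.isProbabilityMeasure_delayLaw
  rw [measureReal_def, seededCell, hη.measure_biInter_first, ENNReal.toReal_pow,
    ← probReal_compl_eq_one_sub measurableSet_Ioi, compl_Ioi, measureReal_def]

end IsForestFire

/-- The cell has about `h n_l` sites, each unseeded with probability about `1 / n_l`. The limit does
not depend on `T`. -/
lemma HypSZero.tendsto_void {μ : Measure ℝ} [IsProbabilityMeasure (delayLaw μ)] (hS : HypSZero μ)
    {h T : ℝ} (hh : 0 < h) (hT : 0 < T) (j : ℤ) :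
    Tendsto (fun l => (1 - (delayLaw μ).real (Ioi (timeScale μ l * T))) ^
      (siteCell (spaceScale μ l) h j).card) (𝓝[>] 0) (𝓝 (Real.exp (-h))) := by
  have h1 := hS.tendsto_spaceScale_mul_delayLaw hT
  have h2 := (tendsto_card_siteCell hh j).comp hS.tendsto_spaceScale
  refine tendsto_one_sub_pow ?_ (.of_forall fun _ => measureReal_nonneg) ?_
  · exact (tendsto_delayLaw_Ioi μ).comp (hS.tendsto_timeScale.atTop_mul_const hT)
  · have h3 := h2.mul h1
    rw [mul_one] at h3
    refine h3.congr' ?_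
    filter_upwards [hS.tendsto_spaceScale.eventually_gt_atTop 0] with l hl
    have : (spaceScale μ l : ℝ) ≠ 0 := by positivity
    simp only [Function.comp_apply]
    field_simp

end Vacant

/-! ### The Poisson measure -/

section Poisson

namespace IsPoissonMeasure

variable {Ω : Type*} [MeasurableSpace Ω] {P : Measure Ω} {π : Ω → Measure ℝ}

lemma measure_eq_zero (hπ : IsPoissonMeasure P π) {a b : ℝ} (hab : a ≤ b) :
    P {ω | π ω (Ioc a b) = 0} = ENNReal.ofReal (Real.exp (-(b - a))) := by
  have h1 := hπ.law (Ioc a b) measurableSet_Ioc (by simp)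
  have h2 : P {ω | π ω (Ioc a b) = 0} = P.map (fun ω => π ω (Ioc a b)) {0} := by
    rw [Measure.map_apply (hπ.measurable _ measurableSet_Ioc) (measurableSet_singleton _)]
    rfl
  have h3 : (fun k : ℕ => (k : ℝ≥0∞)) ⁻¹' {0} = {0} := by ext; simp
  have h4 : (((volume (Ioc a b)).toNNReal : ℝ≥0) : ℝ) = b - a := by
    rw [Real.volume_Ioc, ENNReal.coe_toNNReal_eq_toReal, ENNReal.toReal_ofReal (sub_nonneg.2 hab)]
  rw [h2, h1, Measure.map_apply .of_discrete (measurableSet_singleton _), h3,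
    poissonMeasure_singleton, h4]
  simp

lemma ae_mem_range (hπ : IsPoissonMeasure P π) (a b : ℝ) :
    ∀ᵐ ω ∂P, π ω (Ioc a b) ∈ range (fun k : ℕ => (k : ℝ≥0∞)) := by
  have h1 := hπ.law (Ioc a b) measurableSet_Ioc (by simp)
  refine ae_of_ae_map (hπ.measurable _ measurableSet_Ioc).aemeasurable
    (p := fun x => x ∈ range (fun k : ℕ => (k : ℝ≥0∞))) ?_
  rw [h1]
  have hm : MeasurableSet (range (fun k : ℕ => (k : ℝ≥0∞))) := (countable_range _).measurableSet
  exact (ae_map_iff (Measurable.of_discrete).aemeasurable hm).2 (.of_forall fun k => ⟨k, rfl⟩)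

lemma iIndepSet_cell (hπ : IsPoissonMeasure P π) {h : ℝ} (hh : 0 < h) :
    iIndepSet (fun j => {ω | π ω (cell h j) = 0}) P := by
  have hm : ∀ j, MeasurableSet {ω | π ω (cell h j) = 0} := fun j =>
    hπ.measurable _ (measurableSet_cell h j) (measurableSet_singleton _)
  refine (iIndepSet_iff_meas_biInter hm).2 fun J => ?_
  -- Independence is given for families indexed by `Fin m`, so the finite set `J` is enumerated.
  have h1 := (hπ.indep J.card (fun k => cell h (J.equivFin.symm k))
    (fun k => measurableSet_cell h _) fun k k' hk => pairwise_disjoint_cell hh fun he =>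
      hk (J.equivFin.symm.injective (Subtype.ext he))).meas_biInter (S := Finset.univ)
      (s := fun k => {ω | π ω (cell h (J.equivFin.symm k)) = 0})
      fun k _ => ⟨{0}, measurableSet_singleton _, rfl⟩
  have h2 : ⋂ j ∈ J, {ω | π ω (cell h j) = 0} =
      ⋂ k ∈ Finset.univ, {ω | π ω (cell h (J.equivFin.symm k)) = 0} := by
    ext ω
    simp only [mem_iInter, Finset.mem_univ, true_imp_iff]
    refine ⟨fun h k => h _ (J.equivFin.symm k).2, fun h j hj => ?_⟩
    have := h (J.equivFin ⟨j, hj⟩)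
    simpa using this
  rw [h2, h1, Equiv.prod_comp J.equivFin.symm fun j : J => P {ω | π ω (cell h j) = 0},
    Finset.prod_coe_sort J fun j => P {ω | π ω (cell h j) = 0}]

/-- The Poisson measure is carried by its atoms. -/
lemma ae_exists_atom (hπ : IsPoissonMeasure P π) (a b : ℝ) :
    ∀ᵐ ω ∂P, π ω (Ioc a b) ≠ 0 → ∃ y ∈ Ioc a b, π ω {y} ≠ 0 := by
  have h1 : ∀ᵐ ω ∂P, ∀ q : ℚ, π ω (Ioc a q) ∈ range (fun k : ℕ => (k : ℝ≥0∞)) :=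
    ae_all_iff.2 fun q => hπ.ae_mem_range a q
  filter_upwards [h1] with ω hω hne
  -- Integrality holds almost surely at all rational endpoints together; a rational between `t` and
  -- `u` turns positive mass into mass at least 1.
  have hge : ∀ t u : ℝ, t < u → π ω (Ioc a t) ≠ 0 → 1 ≤ π ω (Ioc a u) := by
    intro t u htu ht
    obtain ⟨q, hq, hqu⟩ := exists_rat_btwn htu
    obtain ⟨k, hk⟩ := hω q
    have h2 : π ω (Ioc a q) ≠ 0 := fun h0 =>
      ht (measure_mono_null (Ioc_subset_Ioc_right hq.le) h0)
    refine le_trans ?_ (measure_mono (Ioc_subset_Ioc_right hqu.le))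
    simp only at hk
    rw [← hk] at h2 ⊢
    exact Nat.one_le_cast.2 (Nat.one_le_iff_ne_zero.2 fun h0 => h2 (by simp [h0]))
  -- The atom is the leftmost point `y = inf Q`: `(a, y]` has mass at least 1 by continuity from
  -- above, while `(a, y)` has mass 0, since no `t < y` is in `Q`.
  set Q : Set ℝ := {t | π ω (Ioc a t) ≠ 0} with hQ
  have hQa : ∀ t ∈ Q, a < t := fun t ht => by
    by_contra hle
    exact ht (by rw [Ioc_eq_empty hle, measure_empty])
  have hbQ : b ∈ Q := hne
  have hbdd : BddBelow Q := ⟨a, fun t ht => (hQa t ht).le⟩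
  set y := sInf Q with hy
  have hay : a ≤ y := le_csInf ⟨b, hbQ⟩ fun t ht => (hQa t ht).le
  have hyb : y ≤ b := csInf_le hbdd hbQ
  have hright : 1 ≤ π ω (Ioc a y) := by
    have hlim := tendsto_measure_biInter_gt (μ := π ω) (s := fun t => Ioc a t) (a := y)
      (fun t _ => nullMeasurableSet_Ioc) (fun s t _ hst => Ioc_subset_Ioc_right hst) (by
        obtain ⟨q, hq⟩ := exists_rat_gt y
        obtain ⟨k, hk⟩ := hω q
        exact ⟨q, hq, by rw [← hk]; exact ENNReal.natCast_ne_top k⟩)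
    have hset : ⋂ t > y, Ioc a t = Ioc a y := by
      ext u
      simp only [mem_iInter, mem_Ioc]
      refine ⟨fun h => ⟨(h (y + 1) (by linarith)).1, le_of_forall_gt_imp_ge_of_dense
        fun t ht => (h t ht).2⟩, fun h t ht => ⟨h.1, h.2.trans (le_of_lt ht)⟩⟩
    rw [hset] at hlim
    refine ge_of_tendsto hlim ?_
    filter_upwards [self_mem_nhdsWithin] with t ht
    obtain ⟨u, hu, hut⟩ := exists_lt_of_csInf_lt ⟨b, hbQ⟩ (mem_Ioi.1 ht)
    exact hge u t hut hu
  have hleft : π ω (Ioo a y) = 0 := by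
    refine measure_null_of_locally_null _ fun t ht => ⟨Ioo a y ∩ Iio ((t + y) / 2), ?_, ?_⟩
    · exact inter_mem_nhdsWithin _ (Iio_mem_nhds (by linarith [ht.2]))
    · refine measure_mono_null (t := Ioc a ((t + y) / 2)) (fun u hu => ⟨hu.1.1, le_of_lt hu.2⟩) ?_
      by_contra h0
      have : y ≤ (t + y) / 2 := csInf_le hbdd h0
      linarith [ht.2]
  have hay' : a < y := by
    refine hay.lt_of_ne fun h => ?_
    rw [← h, Ioc_self, measure_empty] at hright
    exact absurd hright (by simp)
  refine ⟨y, ⟨hay', hyb⟩, fun h0 => ?_⟩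
  rw [← Ioo_union_right hay', measure_union_null hleft h0] at hright
  exact absurd hright (by simp)

end IsPoissonMeasure

end Poisson

/-! ### Discretized clusters -/

section Brackets

/-- `j.1` and `j.2` are consecutive elements of `v`, and the cells `j.1` and `j.2` of mesh `h` are
on the left and on the right of `x`. -/
structure IsBracket (v : Finset ℤ) (h x : ℝ) (j : ℤ × ℤ) : Prop where
  left_mem : j.1 ∈ v
  right_mem : j.2 ∈ v
  notMem : ∀ i, j.1 < i → i < j.2 → i ∉ v
  left_le : (j.1 + 2) * h ≤ x
  le_right : x ≤ j.2 * h

lemma IsBracket.left_le_right {v : Finset ℤ} {h x : ℝ} {j : ℤ × ℤ} (hj : IsBracket v h x j)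
    (hh : 0 < h) : (j.1 : ℝ) * h ≤ j.2 * h := by
  nlinarith [hj.left_le, hj.le_right]

/-- The bracket consists of the nearest elements of `v` on either side. Excluding `c - 1` as well as
`c` leaves a full cell between the left element and `x`, which later absorbs the rounding of `n x`.
-/
lemma exists_isBracket {v : Finset ℤ} {h x : ℝ} (hh : 0 < h) {c : ℤ} (hc : c * h ≤ x)
    (hc' : x ≤ (c + 1) * h) (hl : ∃ j ∈ v, j ≤ c - 2) (hr : ∃ j ∈ v, c + 1 ≤ j) (h0 : c - 1 ∉ v)
    (h1 : c ∉ v) : ∃ j, IsBracket v h x j := by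
  obtain ⟨a, ha, ha'⟩ := (v.filter (· ≤ c - 2)).exists_max_image id
    (by obtain ⟨j, hj, hj'⟩ := hl; exact ⟨j, Finset.mem_filter.2 ⟨hj, hj'⟩⟩)
  obtain ⟨b, hb, hb'⟩ := (v.filter (c + 1 ≤ ·)).exists_min_image id
    (by obtain ⟨j, hj, hj'⟩ := hr; exact ⟨j, Finset.mem_filter.2 ⟨hj, hj'⟩⟩)
  rw [Finset.mem_filter] at ha hb
  refine ⟨(a, b), ha.1, hb.1, fun i hai hib hi => ?_, ?_, ?_⟩
  · dsimp only at hai hib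
    by_cases h2 : i ≤ c - 2
    · exact (ha' i (Finset.mem_filter.2 ⟨hi, h2⟩)).not_gt hai
    · by_cases h3 : c + 1 ≤ i
      · exact (hb' i (Finset.mem_filter.2 ⟨hi, h3⟩)).not_gt hib
      · obtain rfl | rfl : i = c - 1 ∨ i = c := by lia
        exacts [h0 hi, h1 hi]
  · have : (a : ℝ) + 2 ≤ c := by exact_mod_cast (by lia : a + 2 ≤ c)
    exact le_trans (by gcongr) hc
  · have : (c : ℝ) + 1 ≤ b := by exact_mod_cast hb.2
    exact hc'.trans (by dsimp only; gcongr)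

open Classical in
/-- The endpoints of the approximate cluster of `x` when `v` is the set of the nonvoid cells. -/
noncomputable def approxCluster (v : Finset ℤ) (h x : ℝ) : ℝ × ℝ :=
  if hj : ∃ j, IsBracket v h x j then (hj.choose.1 * h, hj.choose.2 * h) else (0, 0)

lemma approxCluster_spec {v : Finset ℤ} {h x : ℝ} (hj : ∃ j, IsBracket v h x j) :
    ∃ j, IsBracket v h x j ∧ approxCluster v h x = (j.1 * h, j.2 * h) :=
  ⟨hj.choose, hj.choose_spec, dif_pos hj⟩

/-- The pairs `(a, b)` with `-A ≤ a ≤ b ≤ A`. -/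
def boundedPairs (p : ℕ) (A : ℝ) : Set (Fin p → ℝ × ℝ) :=
  {y | ∀ k, -A ≤ (y k).1 ∧ (y k).1 ≤ (y k).2 ∧ (y k).2 ≤ A}

lemma isCompact_boundedPairs (p : ℕ) (A : ℝ) : IsCompact (boundedPairs p A) := by
  have h1 : IsCompact (univ.pi fun _ : Fin p => Icc (-A) A ×ˢ Icc (-A) A) :=
    isCompact_univ_pi fun _ => isCompact_Icc.prod isCompact_Icc
  refine h1.of_isClosed_subset ?_ ?_
  · simp only [boundedPairs, ofPred_forall]
    refine isClosed_iInter fun k => ?_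
    have h1 : Continuous fun y : Fin p → ℝ × ℝ => (y k).1 := by fun_prop
    have h2 : Continuous fun y : Fin p → ℝ × ℝ => (y k).2 := by fun_prop
    exact (isClosed_le continuous_const h1).inter
      ((isClosed_le h1 h2).inter (isClosed_le h2 continuous_const))
  · intro y hy k _
    obtain ⟨h1, h2, h3⟩ := hy k
    exact ⟨⟨h1, h2.trans h3⟩, ⟨h1.trans h2, h3⟩⟩

/-- The default value `(0, 0)` keeps the approximation in the compact set even when there is no
bracket. -/
lemma approxCluster_mem {p N : ℕ} {v : Finset ℤ} (hv : v ⊆ Finset.Ico (-N : ℤ) N) {h : ℝ}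
    (hh : 0 < h) (x : Fin p → ℝ) {A : ℝ} (hA : N * h ≤ A) :
    (fun k => approxCluster v h (x k)) ∈ boundedPairs p A := by
  intro k
  have hA0 : 0 ≤ A := le_trans (by positivity) hA
  by_cases hj : ∃ j, IsBracket v h (x k) j
  · obtain ⟨j, hj, he⟩ := approxCluster_spec hj
    simp only [he]
    have h1 := Finset.mem_Ico.1 (hv hj.left_mem)
    have h2 := Finset.mem_Ico.1 (hv hj.right_mem)
    have h3 : -(N : ℝ) ≤ j.1 := by exact_mod_cast h1.1
    have h4 : (j.2 : ℝ) ≤ N := by exact_mod_cast h2.2.le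
    refine ⟨?_, hj.left_le_right hh, ?_⟩
    · nlinarith
    · nlinarith
  · simp [approxCluster, dif_neg hj, hA0]

lemma exists_mem_cell {h : ℝ} (hh : 0 < h) (y : ℝ) : ∃ j, y ∈ cell h j :=
  ⟨⌈y / h⌉ - 1, by
    have h1 := Int.ceil_lt_add_one (y / h)
    have h2 := Int.le_ceil (y / h)
    rw [div_le_iff₀ hh] at h2
    have h3 : ((⌈y / h⌉ : ℝ) - 1) * h < y := by
      rw [← lt_div_iff₀ hh]
      linarith
    constructor <;> push_cast
    · exact h3
    · simpa using h2⟩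

lemma cell_lt_of_lt {h y : ℝ} (hh : 0 < h) {i j : ℤ} (hy : y ∈ cell h j) (hi : y ≤ i * h) :
    j < i := by
  have h1 := hy.1.trans_le hi
  rw [mul_lt_mul_iff_left₀ hh] at h1
  exact_mod_cast h1

lemma le_cell_of_lt {h y : ℝ} (hh : 0 < h) {i j : ℤ} (hy : y ∈ cell h j) (hi : i * h < y) :
    i ≤ j := by
  have h1 := hi.trans_le hy.2
  rw [mul_lt_mul_iff_left₀ hh] at h1
  exact Int.lt_add_one_iff.1 (by exact_mod_cast h1)

end Brackets

/-! ### Discretization of the limit process -/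

section LimitProcess

/-- The cells of `{-N, …, N - 1}` that are charged by `π`. -/
noncomputable def chargedCells (h : ℝ) (N : ℕ) {Ω : Type*} (π : Ω → Measure ℝ) (ω : Ω) : Finset ℤ :=
  nonvoid (Finset.Ico (-N : ℤ) N) (fun j => {ω | π ω (cell h j) = 0}) ω

lemma mem_chargedCells {h : ℝ} {N : ℕ} {Ω : Type*} {π : Ω → Measure ℝ} {ω : Ω} {j : ℤ} :
    j ∈ chargedCells h N π ω ↔ j ∈ Finset.Ico (-N : ℤ) N ∧ π ω (cell h j) ≠ 0 := mem_nonvoid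

variable {Ω : Type*} {π : Ω → Measure ℝ} {ω : Ω}

/-- With `c = ⌊x / h⌋`, the cells `c - 1` and `c` lie in `(x - 2 h, x + h]`, hence are not charged,
and the two remaining hypotheses provide a charged cell on each side. -/
lemma exists_isBracket_chargedCells {h x : ℝ} {N : ℕ} (hh : 0 < h) (hN : |x| + 2 * h ≤ N * h)
    (hx : π ω (Ioc (x - 2 * h) (x + h)) = 0) (hl : π ω (Ioc (-(N * h)) (x - 2 * h)) ≠ 0)
    (hr : π ω (Ioc (x + h) (N * h)) ≠ 0) : ∃ j, IsBracket (chargedCells h N π ω) h x j := by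
  have hx1 := neg_abs_le x
  have hx2 := le_abs_self x
  have hc : (⌊x / h⌋ : ℝ) * h ≤ x := by
    rw [← le_div_iff₀ hh]
    exact Int.floor_le _
  have hc' : x < (⌊x / h⌋ + 1) * h := by
    rw [← div_lt_iff₀ hh]
    exact Int.lt_floor_add_one _
  set c := ⌊x / h⌋ with hcdef
  have hcell : ∀ a b : ℝ, π ω (Ioc a b) ≠ 0 → ∃ j, π ω (cell h j) ≠ 0 ∧ ∃ y ∈ Ioc a b, y ∈ cell h j := by
    intro a b hab
    by_contra hcon
    push Not at hcon
    refine hab (measure_mono_null (t := ⋃ j ∈ {j | ∃ y ∈ Ioc a b, y ∈ cell h j}, cell h j) ?_ ?_)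
    · intro y hy
      obtain ⟨j, hj⟩ := exists_mem_cell hh y
      exact mem_biUnion (x := j) ⟨y, hy, hj⟩ hj
    · refine (measure_biUnion_null_iff (to_countable _)).2 fun j ⟨y, hy, hj⟩ => ?_
      by_contra h0
      exact hcon j h0 y hy hj
  have hnot : ∀ j : ℤ, cell h j ⊆ Ioc (x - 2 * h) (x + h) → j ∉ chargedCells h N π ω :=
    fun j hj hmem => (mem_chargedCells.1 hmem).2 (measure_mono_null hj hx)
  have hNc : c < N := by
    have : (c : ℝ) * h < (N : ℤ) * h := by push_cast; linarith
    rw [mul_lt_mul_iff_left₀ hh] at this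
    exact_mod_cast this
  have hNc' : -N ≤ c := by
    have : (-(N : ℤ) : ℝ) * h < (c + 1) * h := by push_cast; linarith
    rw [mul_lt_mul_iff_left₀ hh] at this
    have : -(N : ℤ) < c + 1 := by exact_mod_cast this
    lia
  refine exists_isBracket hh hc hc'.le ?_ ?_ (hnot _ (Ioc_subset_Ioc ?_ ?_))
    (hnot _ (Ioc_subset_Ioc ?_ ?_))
  · obtain ⟨j, hj, y, hy, hyj⟩ := hcell _ _ hl
    have h1 : j < c - 1 := cell_lt_of_lt hh hyj (by push_cast; linarith [hy.2])
    have h2 : -N ≤ j := le_cell_of_lt hh hyj (by push_cast; linarith [hy.1])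
    exact ⟨j, mem_chargedCells.2 ⟨Finset.mem_Ico.2 ⟨h2, by lia⟩, hj⟩, by lia⟩
  · obtain ⟨j, hj, y, hy, hyj⟩ := hcell _ _ hr
    have h1 : c + 1 ≤ j := le_cell_of_lt hh hyj (by push_cast; linarith [hy.1])
    have h2 : j < N := cell_lt_of_lt hh hyj (by push_cast; linarith [hy.2])
    exact ⟨j, mem_chargedCells.2 ⟨Finset.mem_Ico.2 ⟨by lia, h2⟩, hj⟩, h1⟩
  · push_cast; linarith
  · push_cast; linarith
  · linarith
  · linarith

/-- The cluster of `x` in the limit process is close to its discretization. -/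
lemma limitCluster_eq_Icc {h x : ℝ} {N : ℕ} (hh : 0 < h) {j : ℤ × ℤ}
    (hatom : ∀ i, π ω (cell h i) ≠ 0 → ∃ y ∈ cell h i, π ω {y} ≠ 0)
    (hj : IsBracket (chargedCells h N π ω) h x j) (t : ℝ) :
    ∃ a b, limitCluster (π ω) t x = Icc a b ∧ a ≤ b ∧ |j.1 * h - a| ≤ h ∧ |j.2 * h - b| ≤ h := by
  have hI1 := Finset.mem_Ico.1 (mem_chargedCells.1 hj.left_mem).1
  have hI2 := Finset.mem_Ico.1 (mem_chargedCells.1 hj.right_mem).1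
  -- There is no atom strictly between the two bracketing cells, while each of these contains one.
  -- So the endpoints of the limit cluster lie in the closures of these cells.
  have hvoid : ∀ y, (j.1 + 1) * h < y → y ≤ j.2 * h → π ω {y} = 0 := by
    intro y h1 h2
    obtain ⟨i, hi⟩ := exists_mem_cell hh y
    have h3 : j.1 + 1 ≤ i := le_cell_of_lt hh hi (by push_cast; exact h1)
    have h4 : i < j.2 := cell_lt_of_lt hh hi h2
    have h5 := hj.notMem i (by lia) h4
    rw [mem_chargedCells, not_and, not_not] at h5
    exact measure_mono_null (singleton_subset_iff.2 hi) (h5 (Finset.mem_Ico.2 ⟨by lia, by lia⟩))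
  obtain ⟨y1, hy1, hy1'⟩ := hatom j.1 (mem_chargedCells.1 hj.left_mem).2
  obtain ⟨y2, hy2, hy2'⟩ := hatom j.2 (mem_chargedCells.1 hj.right_mem).2
  have hl := hj.left_le
  have hr := hj.le_right
  have hY : ∀ y, limitProcess (π ω) t y = false ↔ π ω {y} ≠ 0 := fun y => by simp [limitProcess]
  set SL := {y | y ≤ x ∧ limitProcess (π ω) t y = false} with hSL
  set SR := {y | x ≤ y ∧ limitProcess (π ω) t y = false} with hSR
  have hm1 : y1 ∈ SL := ⟨by linarith [hy1.2], (hY _).2 hy1'⟩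
  have hm2 : y2 ∈ SR := ⟨by linarith [hy2.1], (hY _).2 hy2'⟩
  have hb1 : ∀ y ∈ SL, y ≤ (j.1 + 1) * h := fun y hy => by
    by_contra hlt
    exact (hY y).1 hy.2 (hvoid y (not_le.1 hlt) (hy.1.trans hr))
  have hb2 : ∀ y ∈ SR, j.2 * h ≤ y := fun y hy => by
    by_contra hlt
    exact (hY y).1 hy.2 (hvoid y (by linarith [hy.1]) (not_le.1 hlt).le)
  have e1 : sSup SL ≤ (j.1 + 1) * h := csSup_le ⟨_, hm1⟩ hb1
  have e2 : y1 ≤ sSup SL := le_csSup ⟨_, hb1⟩ hm1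
  have e3 : j.2 * h ≤ sInf SR := le_csInf ⟨_, hm2⟩ hb2
  have e4 : sInf SR ≤ y2 := csInf_le ⟨_, hb2⟩ hm2
  refine ⟨sSup SL, sInf SR, rfl, by linarith, abs_le.2 ⟨?_, ?_⟩, abs_le.2 ⟨?_, ?_⟩⟩
  · linarith
  · linarith [hy1.1]
  · linarith [hy2.2]
  · linarith

variable [MeasurableSpace Ω] {P : Measure Ω}

/-- A bracket can be missing only if there is a point within the interval of length `3 h` around
`x`, of probability at most `3 h`, or no point on one of the two sides, each of probability at most
`exp (-(A - |x| - 2))`. -/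
lemma IsPoissonMeasure.eventually_measure_not_isBracket_le [IsProbabilityMeasure P]
    (hπ : IsPoissonMeasure P π) (x : ℝ) {ε : ℝ} (hε : 0 < ε) :
    ∀ᶠ A in atTop, ∀ᶠ h : ℝ in 𝓝[>] 0, ∀ N : ℕ, A ≤ N * h →
      P {ω | ¬ ∃ j, IsBracket (chargedCells h N π ω) h x j} ≤ ENNReal.ofReal ε := by
  have h1 : Tendsto (fun A => Real.exp (-(A - |x| - 2))) atTop (𝓝 0) := by
    refine Real.tendsto_exp_neg_atTop_nhds_zero.comp ?_
    exact tendsto_atTop_add_const_right _ _ (tendsto_atTop_add_const_right _ _ tendsto_id)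
  filter_upwards [h1.eventually_lt_const (show 0 < ε / 3 by positivity),
    eventually_ge_atTop (|x| + 2)] with A hA hA2
  filter_upwards [Ioo_mem_nhdsGT (show (0 : ℝ) < min 1 (ε / 9) by positivity)] with h hh N hN
  have hh0 := hh.1
  have hh1 : h < 1 := hh.2.trans_le (min_le_left _ _)
  have hh2 : h < ε / 9 := hh.2.trans_le (min_le_right _ _)
  have hx1 := neg_abs_le x
  have hx2 := le_abs_self x
  have hsub : {ω | ¬ ∃ j, IsBracket (chargedCells h N π ω) h x j} ⊆
      {ω | π ω (Ioc (x - 2 * h) (x + h)) = 0}ᶜ ∪ ({ω | π ω (Ioc (-(N * h)) (x - 2 * h)) = 0} ∪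
        {ω | π ω (Ioc (x + h) (N * h)) = 0}) := by
    intro ω hω
    by_contra hcon
    simp only [mem_union, mem_compl_iff, not_or, not_not] at hcon
    exact hω (exists_isBracket_chargedCells hh0 (by linarith) hcon.1 hcon.2.1 hcon.2.2)
  have hm : MeasurableSet {ω | π ω (Ioc (x - 2 * h) (x + h)) = 0} :=
    hπ.measurable _ measurableSet_Ioc (measurableSet_singleton _)
  calc P {ω | ¬ ∃ j, IsBracket (chargedCells h N π ω) h x j}
      ≤ ENNReal.ofReal (ε / 3) + (ENNReal.ofReal (ε / 3) + ENNReal.ofReal (ε / 3)) := by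
        refine (measure_mono hsub).trans ((measure_union_le _ _).trans (add_le_add ?_
          ((measure_union_le _ _).trans (add_le_add ?_ ?_))))
        · rw [prob_compl_eq_one_sub hm, hπ.measure_eq_zero (by linarith), ← ENNReal.ofReal_one,
            ← ENNReal.ofReal_sub _ (Real.exp_nonneg _)]
          refine ENNReal.ofReal_le_ofReal ?_
          have := Real.add_one_le_exp (-(x + h - (x - 2 * h)))
          linarith
        · rw [hπ.measure_eq_zero (by linarith)]
          refine ENNReal.ofReal_le_ofReal (le_trans (Real.exp_le_exp.2 ?_) hA.le)
          linarith
        · rw [hπ.measure_eq_zero (by linarith)]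
          refine ENNReal.ofReal_le_ofReal (le_trans (Real.exp_le_exp.2 ?_) hA.le)
          linarith
    _ = ENNReal.ofReal ε := by
        rw [← ENNReal.ofReal_add (by positivity) (by positivity),
          ← ENNReal.ofReal_add (by positivity) (by positivity)]
        congr 1
        ring

lemma IsPoissonMeasure.ae_atoms (hπ : IsPoissonMeasure P π) (h : ℝ) :
    ∀ᵐ ω ∂P, ∀ i, π ω (cell h i) ≠ 0 → ∃ y ∈ cell h i, π ω {y} ≠ 0 :=
  ae_all_iff.2 fun _ => hπ.ae_exists_atom _ _

lemma limitCluster_mem_intervals (π : Measure ℝ) (t x : ℝ) : limitCluster π t x ∈ intervals :=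
  Icc_mem_intervals _ _

end LimitProcess

/-! ### Discretization of the clusters of the forest fire process -/

section Discretization

/-- The sites of `(-A, A]` after rescaling by `n`. -/
noncomputable def siteWindow (n : ℕ) (A : ℝ) : Finset ℤ := Finset.Ioc ⌊n * -A⌋ ⌊n * A⌋

lemma mem_siteWindow {n : ℕ} (hn : 0 < n) {A : ℝ} {i : ℤ} :
    i ∈ siteWindow n A ↔ -A < (i : ℝ) / n ∧ (i : ℝ) / n ≤ A := by
  have hn' : (0 : ℝ) < n := Nat.cast_pos.2 hn
  rw [siteWindow, Finset.mem_Ioc, Int.floor_lt, Int.le_floor, lt_div_iff₀ hn',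
    div_le_iff₀ hn', mul_comm (n : ℝ), mul_comm (n : ℝ)]

lemma card_siteWindow_le {n : ℕ} (hn : 0 < n) {A : ℝ} (hA : 0 ≤ A) :
    ((siteWindow n A).card : ℝ) ≤ (2 * A + 1) * n := by
  have hn' : (1 : ℝ) ≤ n := Nat.one_le_cast.2 hn
  have hle : ⌊(n : ℝ) * -A⌋ ≤ ⌊(n : ℝ) * A⌋ := Int.floor_mono (by nlinarith)
  have h1 : ((siteWindow n A).card : ℤ) = ⌊(n : ℝ) * A⌋ - ⌊(n : ℝ) * -A⌋ := by
    rw [siteWindow, Int.card_Ioc]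
    exact Int.toNat_of_nonneg (by lia)
  have h2 : ((siteWindow n A).card : ℝ) = ⌊(n : ℝ) * A⌋ - ⌊(n : ℝ) * -A⌋ := by exact_mod_cast h1
  rw [h2]
  linarith [Int.floor_le ((n : ℝ) * A), Int.sub_one_lt_floor ((n : ℝ) * -A)]

/-- The sites of `W` that receive a seed before time `H` receive one during every time interval
of length `d` before `H`. -/
def SeedsFrequently (s : ℤ → ℕ → ℝ) (W : Finset ℤ) (d H : ℝ) : Prop :=
  ∀ i ∈ W, s i 0 ≤ H → ∀ u ∈ Icc d H, ∃ k, s i k ∈ Ioc (u - d) u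

/-- `L` is the last unseeded site of the left cell and `R` the first unseeded site of the right one.
Between them, sites in these two cells are seeded by extremality, the others because their cell is
not in `v`. -/
lemma IsBracket.exists_vacant {s : ℤ → ℕ → ℝ} {v : Finset ℤ} {n N : ℕ} {h H x : ℝ} {j : ℤ × ℤ}
    (hv : ∀ i, i ∈ v ↔ i ∈ Finset.Ico (-N : ℤ) N ∧ ∃ q ∈ siteCell n h i, H < s q 0)
    (hj : IsBracket v h x j) (hh : 0 < h) (hn : 1 ≤ n * h) :
    ∃ L R : ℤ, ⌊n * x⌋ ∈ Ioo L R ∧ H < s L 0 ∧ H < s R 0 ∧ (L : ℝ) / n ∈ cell h j.1 ∧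
      (R : ℝ) / n ∈ cell h j.2 ∧ ∀ i ∈ Ioo L R, s i 0 ≤ H := by
  have hn' : (0 : ℝ) < n := by
    by_contra h0
    have : (n : ℝ) * h ≤ 0 := mul_nonpos_of_nonpos_of_nonneg (not_lt.1 h0) hh.le
    linarith
  have hn0 : 0 < n := Nat.cast_pos.1 hn'
  have hI1 := Finset.mem_Ico.1 ((hv _).1 hj.left_mem).1
  have hI2 := Finset.mem_Ico.1 ((hv _).1 hj.right_mem).1
  obtain ⟨L, hL, hL'⟩ := ((siteCell n h j.1).filter (H < s · 0)).exists_max_image id (by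
    obtain ⟨q, hq, hq'⟩ := ((hv _).1 hj.left_mem).2
    exact ⟨q, Finset.mem_filter.2 ⟨hq, hq'⟩⟩)
  obtain ⟨R, hR, hR'⟩ := ((siteCell n h j.2).filter (H < s · 0)).exists_min_image id (by
    obtain ⟨q, hq, hq'⟩ := ((hv _).1 hj.right_mem).2
    exact ⟨q, Finset.mem_filter.2 ⟨hq, hq'⟩⟩)
  rw [Finset.mem_filter, mem_siteCell hn0] at hL hR
  refine ⟨L, R, ⟨?_, ?_⟩, hL.2, hR.2, hL.1, hR.1, fun i hi => ?_⟩
  -- The spare cell in `left_le` gives `L ≤ n x - n h ≤ n x - 1 < ⌊n x⌋`. On the right, `n x < R` is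
  -- enough, as the integer part rounds downwards.
  · have h1 := hL.1.2
    rw [div_le_iff₀ hn'] at h1
    have h2 := mul_le_mul_of_nonneg_left hj.left_le hn'.le
    have h3 := Int.sub_one_lt_floor ((n : ℝ) * x)
    have : (L : ℝ) < ⌊(n : ℝ) * x⌋ := by nlinarith
    exact_mod_cast this
  · have h1 := hR.1.1
    rw [lt_div_iff₀ hn'] at h1
    have h2 := mul_le_mul_of_nonneg_left hj.le_right hn'.le
    have h3 := Int.floor_le ((n : ℝ) * x)
    have : (⌊(n : ℝ) * x⌋ : ℝ) < R := by nlinarith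
    exact_mod_cast this
  · by_contra hlt
    rw [not_le] at hlt
    obtain ⟨c, hc⟩ := exists_mem_cell hh ((i : ℝ) / n)
    have hcs : i ∈ siteCell n h c := (mem_siteCell hn0).2 hc
    have hLi : (L : ℝ) / n < i / n := by
      gcongr
      exact_mod_cast hi.1
    have hiR : (i : ℝ) / n < R / n := by
      gcongr
      exact_mod_cast hi.2
    have h1 : j.1 ≤ c := le_cell_of_lt hh hc (hL.1.1.trans hLi)
    have h2 : c < j.2 + 1 := cell_lt_of_lt hh hc (by push_cast; exact hiR.le.trans hR.1.2)
    obtain h3 | h3 := h1.eq_or_lt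
    · rw [← h3] at hcs
      exact (hL' i (Finset.mem_filter.2 ⟨hcs, hlt⟩)).not_gt hi.1
    · obtain h4 | h4 := (Int.lt_add_one_iff.1 h2).eq_or_lt
      · rw [h4] at hcs
        exact (hR' i (Finset.mem_filter.2 ⟨hcs, hlt⟩)).not_gt hi.2
      · exact hj.notMem c h3 h4 ((hv c).2 ⟨Finset.mem_Ico.2 ⟨by lia, by lia⟩, i, hcs, hlt⟩)

/-- The clusters of a regular path are close to their discretizations. -/
lemma IsRegularPath.intervalDist_approxCluster_le {s m : ℤ → ℕ → ℝ} {η : ℝ → ℤ → Bool}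
    (hp : IsRegularPath s m η) {v : Finset ℤ} {n N : ℕ} {h H d x : ℝ}
    (hv : ∀ i, i ∈ v ↔ i ∈ Finset.Ico (-N : ℤ) N ∧ ∃ q ∈ siteCell n h i, H < s q 0)
    (hbr : ∃ j, IsBracket v h x j) (hh : 0 < h) (hn : 1 ≤ n * h)
    (hseed : SeedsFrequently s (siteWindow n (N * h)) d H) (hd : 0 ≤ d) :
    (∀ t ∈ Icc 0 H, rescale n (cluster (η t) ⌊n * x⌋) ⊆ Icc (-(N * h)) (N * h)) ∧
      ∀ t ∈ Icc d H, (∀ i ∈ siteWindow n (N * h), ∀ k, m i k ∉ Ioc (t - d) t) →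
        intervalDist (Icc (approxCluster v h x).1 (approxCluster v h x).2)
          (rescale n (cluster (η t) ⌊n * x⌋)) ≤ 4 * h := by
  obtain ⟨j, hj, he⟩ := approxCluster_spec hbr
  obtain ⟨L, R, hi, hL, hR, hLc, hRc, hbtw⟩ := hj.exists_vacant hv hh hn
  have hn' : (0 : ℝ) < n := by
    by_contra h0
    have : (n : ℝ) * h ≤ 0 := mul_nonpos_of_nonpos_of_nonneg (not_lt.1 h0) hh.le
    linarith
  have hn0 : 0 < n := Nat.cast_pos.1 hn'
  have hI1 := Finset.mem_Ico.1 ((hv _).1 hj.left_mem).1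
  have hI2 := Finset.mem_Ico.1 ((hv _).1 hj.right_mem).1
  have hLA : -(N * h) < (L : ℝ) / n := by
    refine lt_of_le_of_lt ?_ hLc.1
    have : (-(N : ℤ) : ℝ) ≤ j.1 := by exact_mod_cast hI1.1
    push_cast at this
    nlinarith
  have hRA : (R : ℝ) / n ≤ N * h := by
    refine hRc.2.trans ?_
    have : (j.2 : ℝ) + 1 ≤ N := by exact_mod_cast hI2.2
    gcongr
  have hinv : 0 < 1 / (n : ℝ) := by positivity
  have hinv' : 1 / (n : ℝ) ≤ h := by rwa [div_le_iff₀ hn', mul_comm]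
  have hwin : ∀ i ∈ Ioo L R, i ∈ siteWindow n (N * h) := fun i hi => by
    rw [mem_siteWindow hn0]
    constructor
    · refine hLA.trans ?_
      gcongr
      exact_mod_cast hi.1
    · refine le_trans ?_ hRA
      gcongr
      exact_mod_cast hi.2.le
  constructor
  · intro t ht
    refine (hp.rescale_cluster_subset n hi ht.1 (ht.2.trans_lt hL) (ht.2.trans_lt hR)).trans
      (Icc_subset_Icc ?_ ?_)
    · rw [add_div]; linarith
    · rw [sub_div]; linarith
  · intro t ht hm
    rw [hp.cluster_eq hi hL hR (fun q hq => hseed q (hwin q hq) (hbtw q hq)) hd ht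
      fun q hq => hm q (hwin q hq), he, rescale_Ioo n hi, intervalDist_Icc_Icc
      (hj.left_le_right hh) (by
        gcongr
        have : L + 1 ≤ R - 1 := by have h1 := hi.1; have h2 := hi.2; lia
        exact_mod_cast this), add_div, sub_div]
    -- One `h` is for the position of the site in its cell, another for the shift by `1 / n ≤ h`
    -- from the vacant site to the end of the cluster.
    have h1 : |j.1 * h - ((L : ℝ) / n + 1 / n)| ≤ 2 * h := by
      have := hLc.1
      have := hLc.2
      exact abs_le.2 ⟨by linarith, by linarith⟩
    have h2 : |j.2 * h - ((R : ℝ) / n - 1 / n)| ≤ 2 * h := by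
      have := hRc.1
      have := hRc.2
      exact abs_le.2 ⟨by linarith, by linarith⟩
    linarith

/-- A function that is small except shortly after finitely many times has a small integral. -/
lemma integral_le_of_marks {ι : Type*} [Countable ι] {f : ℝ → ℝ} {T A b e q : ℝ} {τ : ι → ℝ}
    (hT : 0 < T) (hA : 0 ≤ A) (hb : 0 ≤ b) (he : 0 ≤ e) (hq : 0 ≤ q)
    (hf : IntervalIntegrable f volume 0 T)
    (hfA : ∀ t ∈ Icc 0 T, f t ≤ A) (hfb : ∀ t ∈ Icc e T, (∀ i, τ i ∉ Ioc (t - e) t) → f t ≤ b)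
    (hτ : ∑' i, (Ioc 0 T).indicator (1 : ℝ → ℝ≥0∞) (τ i) ≤ ENNReal.ofReal q) :
    ∫ t in (0 : ℝ)..T, f t ≤ b * T + A * (e * (1 + q)) := by
  classical
  -- The bad times are those before `e` and those within `e` after a mark; they have total length at
  -- most `e` times one plus the number of marks in `(0, T]`.
  set B : ι → Set ℝ := fun i => if τ i ∈ Ioc 0 T then Ico (τ i) (τ i + e) else ∅ with hB
  have hBm : ∀ i, MeasurableSet (B i) := fun i => by
    simp only [hB]
    split_ifs
    exacts [measurableSet_Ico, MeasurableSet.empty]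
  set U : Set ℝ := Ico 0 e ∪ ⋃ i, B i with hU
  have hUm : MeasurableSet U := measurableSet_Ico.union (.iUnion hBm)
  have hvol : volume U ≤ ENNReal.ofReal (e * (1 + q)) := by
    calc volume U ≤ ENNReal.ofReal e + ∑' i, ENNReal.ofReal e * (Ioc 0 T).indicator 1 (τ i) := by
          refine (measure_union_le _ _).trans (add_le_add ?_ ((measure_iUnion_le _).trans
            (ENNReal.tsum_le_tsum fun i => ?_)))
          · simp
          · simp only [hB]
            split_ifs with h <;> simp [h]
      _ ≤ ENNReal.ofReal e + ENNReal.ofReal e * ENNReal.ofReal q := by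
          rw [ENNReal.tsum_mul_left]
          gcongr
      _ = ENNReal.ofReal (e * (1 + q)) := by
          rw [← ENNReal.ofReal_mul he, ← ENNReal.ofReal_add he (by positivity)]
          congr 1
          ring
  have hvol' : (volume.restrict (Ioc 0 T)).real U ≤ e * (1 + q) := by
    refine ENNReal.toReal_le_of_le_ofReal (by positivity) (le_trans ?_ hvol)
    exact Measure.restrict_le_self U
  rw [intervalIntegral.integral_of_le hT.le]
  rw [intervalIntegrable_iff_integrableOn_Ioc_of_le hT.le] at hf
  have hint : Integrable (fun t => b + U.indicator (fun _ => A) t) (volume.restrict (Ioc 0 T)) :=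
    (integrable_const b).add ((integrable_const A).indicator hUm)
  calc ∫ t in Ioc 0 T, f t ≤ ∫ t in Ioc 0 T, (b + U.indicator (fun _ => A) t) := by
        refine setIntegral_mono_on hf hint measurableSet_Ioc fun t ht => ?_
        by_cases htU : t ∈ U
        · rw [indicator_of_mem htU]
          linarith [hfA t (Ioc_subset_Icc_self ht)]
        · rw [indicator_of_notMem htU, add_zero]
          have h1 : e ≤ t := by
            by_contra hlt
            exact htU (Or.inl ⟨ht.1.le, not_le.1 hlt⟩)
          refine hfb t ⟨h1, ht.2⟩ fun i hi => htU (Or.inr (mem_iUnion.2 ⟨i, ?_⟩))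
          have h2 : τ i ∈ Ioc 0 T := ⟨lt_of_le_of_lt (by linarith) hi.1, hi.2.trans ht.2⟩
          simp only [hB, if_pos h2]
          exact ⟨hi.2, by linarith [hi.1]⟩
    _ = b * T + A * (volume.restrict (Ioc 0 T)).real U := by
        rw [integral_add (integrable_const b) ((integrable_const A).indicator hUm),
          integral_indicator_const _ hUm]
        simp [hT.le, mul_comm]
    _ ≤ b * T + A * (e * (1 + q)) := by gcongr

end Discretization

/-! ### Seeds and matches in a window -/

section WindowEstimates

namespace IsForestFire

variable {Ω : Type*} [MeasurableSpace Ω] {P : Measure Ω} [IsProbabilityMeasure P]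
  {μS μM : Measure ℝ} {S M : ℤ → ℕ → Ω → ℝ} {η : Ω → ℝ → ℤ → Bool}

/-- An interval of length `2 δ` contains an interval of the grid of mesh `δ`, so a union bound over
`K` grid intervals handles all `u` at once. -/
lemma measure_not_seedsFrequently_le (hη : IsForestFire P μS μM S M η) (hS : IsPositiveLaw μS)
    (W : Finset ℤ) {δ : ℝ} (hδ : 0 < δ) (K : ℕ) :
    P {ω | ¬ SeedsFrequently (fun i k => S i k ω) W (2 * δ) (K * δ)} ≤
      W.card * (K * delayLaw μS (Ioc δ (K * δ))) := by
  have hsub : {ω | ¬ SeedsFrequently (fun i k => S i k ω) W (2 * δ) (K * δ)} ⊆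
      ⋃ i ∈ W, ⋃ c ∈ Finset.range K, {ω | S i 0 ω ≤ K * δ ∧ ∀ k, S i k ω ∉ Ioc (c * δ) (c * δ + δ)} := by
    intro ω hω
    simp only [SeedsFrequently, mem_ofPred_eq, not_forall] at hω
    obtain ⟨i, hi, h0, u, hu, hk⟩ := hω
    push Not at hk
    have hf1 : (⌊u / δ⌋₊ : ℝ) * δ ≤ u := by
      rw [← le_div_iff₀ hδ]
      exact Nat.floor_le (div_nonneg ((by positivity : (0 : ℝ) ≤ 2 * δ).trans hu.1) hδ.le)
    have hf2 : u < (⌊u / δ⌋₊ + 1) * δ := by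
      rw [← div_lt_iff₀ hδ]
      exact Nat.lt_floor_add_one _
    have hpos : 1 ≤ ⌊u / δ⌋₊ := Nat.le_floor (by
      rw [le_div_iff₀ hδ]; push_cast; linarith [hu.1])
    have hle : ⌊u / δ⌋₊ ≤ K := by
      have : (⌊u / δ⌋₊ : ℝ) * δ ≤ K * δ := hf1.trans hu.2
      exact_mod_cast le_of_mul_le_mul_right this hδ
    obtain ⟨c, hc⟩ : ∃ c, ⌊u / δ⌋₊ = c + 1 := ⟨_, (Nat.sub_add_cancel hpos).symm⟩
    rw [hc] at hf1 hf2 hle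
    push_cast at hf1 hf2
    refine mem_biUnion hi (mem_biUnion (x := c) (Finset.mem_coe.2 (Finset.mem_range.2 hle))
      ⟨h0, fun k hmem => hk k ⟨?_, ?_⟩⟩)
    · linarith [hmem.1]
    · linarith [hmem.2]
  refine (measure_mono hsub).trans ((measure_biUnion_finset_le _ _).trans ?_)
  refine le_trans (Finset.sum_le_card_nsmul W _ (K * delayLaw μS (Ioc δ (K * δ))) fun i _ => ?_)
    (nsmul_eq_mul _ _).le
  refine (measure_biUnion_finset_le _ _).trans ?_
  refine le_trans (Finset.sum_le_card_nsmul (Finset.range K) _ (delayLaw μS (Ioc δ (K * δ)))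
    fun c hc => ?_) (by rw [nsmul_eq_mul, Finset.card_range])
  refine (hη.seeds i).measure_no_mark_le hS (by positivity) hδ ?_
  have : (c : ℝ) + 1 ≤ K := by exact_mod_cast Finset.mem_range.1 hc
  nlinarith

/-- The expected number of matches that fall on `W` during a time interval. -/
lemma sum_measure_fires_le (hη : IsForestFire P μS μM S M η) (hM : IsPositiveLaw μM)
    (W : Finset ℤ) (s t : ℝ) :
    ∑ i ∈ W, ∑' k, P {ω | M i k ω ∈ Ioc s t} ≤
      W.card * (ENNReal.ofReal (mean μM)⁻¹ * ENNReal.ofReal (t - s)) := by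
  rw [← nsmul_eq_mul]
  refine Finset.sum_le_card_nsmul _ _ _ fun i _ =>
    ((hη.fires i).tsum_measure_le hM measurableSet_Ioc).trans ?_
  rw [renewalBound, Measure.smul_apply, smul_eq_mul, ← Real.volume_Ioc]
  gcongr
  exact Measure.restrict_le_self

end IsForestFire

end WindowEstimates

/-! ### The discretization is accurate -/

section Closeness

/-- The cells of `{-N, …, N - 1}` that contain a site without seeds up to the macroscopic
time `T`. -/
noncomputable def unseededCells (μS : Measure ℝ) (l T h : ℝ) (N : ℕ) {Ω : Type*}
    (S : ℤ → ℕ → Ω → ℝ) (ω : Ω) : Finset ℤ :=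
  nonvoid (Finset.Ico (-N : ℤ) N) (seededCell S (spaceScale μS l) h (timeScale μS l * T)) ω

lemma mem_unseededCells {μS : Measure ℝ} {l T h : ℝ} {N : ℕ} {Ω : Type*} {S : ℤ → ℕ → Ω → ℝ}
    {ω : Ω} {i : ℤ} : i ∈ unseededCells μS l T h N S ω ↔ i ∈ Finset.Ico (-N : ℤ) N ∧
      ∃ q ∈ siteCell (spaceScale μS l) h i, timeScale μS l * T < S q 0 ω := by
  rw [unseededCells, mem_nonvoid]
  simp [seededCell]

variable {μS μM : Measure ℝ} {Ω : ℝ → Type*} [∀ l, MeasurableSpace (Ω l)] {P : ∀ l, Measure (Ω l)}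
  [∀ l, IsProbabilityMeasure (P l)] {S M : ∀ l, ℤ → ℕ → Ω l → ℝ} {η : ∀ l, Ω l → ℝ → ℤ → Bool}

lemma eventually_mem_Ioc : ∀ᶠ l : ℝ in 𝓝[>] 0, l ∈ Ioc (0 : ℝ) 1 :=
  Ioc_mem_nhdsGT one_pos

/-- The union bound is at most `(2 A + 1) K n_l ν_S((a_l T / K, a_l T])`, which tends to 0 for fixed
`K` by slow variation. -/
lemma eventually_measure_not_seedsFrequently_le (hS : HypSZero μS)
    (hη : ∀ l ∈ Ioc (0 : ℝ) 1, IsForestFire (P l) μS (slowedLaw μM l) (S l) (M l) (η l))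
    {T A ε : ℝ} (hT : 0 < T) (hA : 0 ≤ A) (hε : 0 < ε) {K : ℕ} (hK : 0 < K) :
    ∀ᶠ l in 𝓝[>] 0, P l {ω | ¬ SeedsFrequently (fun i k => S l i k ω)
      (siteWindow (spaceScale μS l) A) (2 * (timeScale μS l * (T / K))) (timeScale μS l * T)} ≤
        ENNReal.ofReal ε := by
  have := (hη 1 ⟨one_pos, le_rfl⟩).isProbabilityMeasure_delayLaw
  have hK' : (1 : ℝ) ≤ K := Nat.one_le_cast.2 hK
  have h1 := (hS.tendsto_spaceScale_mul_delayLaw_Ioc (s := T / K) (t := T) (by positivity)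
    (div_le_self hT.le hK')).const_mul ((2 * A + 1) * K)
  rw [mul_zero] at h1
  filter_upwards [h1.eventually_lt_const hε, eventually_mem_Ioc,
    hS.tendsto_spaceScale.eventually_gt_atTop 0] with l hl hl1 hn
  have ha := (hS.timeScale_spec hl1.1).1
  have h2 := (hη l hl1).measure_not_seedsFrequently_le hS.isPositiveLaw
    (siteWindow (spaceScale μS l) A) (δ := timeScale μS l * (T / K)) (by positivity) K
  have h3 : (K : ℝ) * (timeScale μS l * (T / K)) = timeScale μS l * T := by field_simp
  rw [h3] at h2
  refine h2.trans ?_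
  rw [← ofReal_measureReal, ← ENNReal.ofReal_natCast, ← ENNReal.ofReal_natCast,
    ← ENNReal.ofReal_mul (by positivity), ← ENNReal.ofReal_mul (by positivity)]
  refine ENNReal.ofReal_le_ofReal (le_trans ?_ hl.le)
  have h4 := card_siteWindow_le hn hA
  calc _ ≤ ((2 * A + 1) * spaceScale μS l) * (K * (delayLaw μS).real
        (Ioc (timeScale μS l * (T / K)) (timeScale μS l * T))) := by gcongr
    _ = _ := by ring

/-- Each of at most `(2 A + 1) n_l` sites receives matches at rate `l`, during a time `a_l (t - s)`,
and `n_l l a_l ≤ 1`. -/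
lemma sum_measure_fires_window_le (hM : HypM μM) (hS : HypSZero μS) {l : ℝ} (hl : l ∈ Ioc (0 : ℝ) 1)
    (hη : IsForestFire (P l) μS (slowedLaw μM l) (S l) (M l) (η l)) (hn : 0 < spaceScale μS l)
    {A s t : ℝ} (hA : 0 ≤ A) (hst : s ≤ t) :
    ∑ i ∈ siteWindow (spaceScale μS l) A,
      ∑' k, P l {ω | M l i k ω ∈ Ioc (timeScale μS l * s) (timeScale μS l * t)} ≤
      ENNReal.ofReal ((2 * A + 1) * (t - s)) := by
  have := hη.isProbabilityMeasure_delayLaw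
  have ha := (hS.timeScale_spec hl.1).1
  refine (hη.sum_measure_fires_le (hM.isPositiveLaw.slowedLaw hl.1) _ _ _).trans ?_
  rw [mean_slowedLaw, hM.mean_eq, one_div, inv_inv, ← ENNReal.ofReal_natCast,
    ← ENNReal.ofReal_mul hl.1.le, ← ENNReal.ofReal_mul (by positivity)]
  refine ENNReal.ofReal_le_ofReal ?_
  have h1 := card_siteWindow_le hn hA
  have h2 := hS.spaceScale_mul_le hl.1
  have h3 : 0 ≤ t - s := sub_nonneg.2 hst
  calc _ ≤ ((2 * A + 1) * spaceScale μS l) * (l * (timeScale μS l * t - timeScale μS l * s)) := by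
        gcongr
        rw [← mul_sub]
        exact mul_nonneg hl.1.le (mul_nonneg ha.le h3)
    _ = ((2 * A + 1) * (t - s)) * (spaceScale μS l * (l * timeScale μS l)) := by ring
    _ ≤ ((2 * A + 1) * (t - s)) * 1 := by gcongr
    _ = _ := mul_one _

/-- At given times, the clusters are close to their discretizations with large probability. -/
lemma eventually_measure_clusters_le (hM : HypM μM) (hS : HypSZero μS)
    (hη : ∀ l ∈ Ioc (0 : ℝ) 1, IsForestFire (P l) μS (slowedLaw μM l) (S l) (M l) (η l))
    {p : ℕ} {T h ε : ℝ} (hT : 0 < T) {t : Fin p → ℝ} (ht : ∀ k, t k ∈ Ioc 0 T) (x : Fin p → ℝ)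
    (N : ℕ) (hh : 0 < h) (hε : 0 < ε) :
    ∀ᶠ l in 𝓝[>] 0, P l {ω | (∀ k, ∃ j, IsBracket (unseededCells μS l T h N (S l) ω) h (x k) j) ∧
      ¬ ∀ k, intervalDist (Icc (approxCluster (unseededCells μS l T h N (S l) ω) h (x k)).1
        (approxCluster (unseededCells μS l T h N (S l) ω) h (x k)).2)
        (rescaledCluster μS l (η l ω) (t k) (x k)) ≤ 4 * h} ≤ ENNReal.ofReal ε := by
  have := (hη 1 ⟨one_pos, le_rfl⟩).isProbabilityMeasure_delayLaw
  have hA : 0 ≤ N * h := by positivity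
  -- The refilling time `2 T / K` has to fit before each `t k` and be so short that the expected
  -- number of matches on the window during the `p` intervals of this length before the `t k` is at
  -- most `ε / 2`.
  obtain ⟨K, hK0, hKt, hKε⟩ : ∃ K : ℕ, 0 < K ∧ (∀ k, 2 * (T / K) ≤ t k) ∧
      p * ((2 * (N * h) + 1) * (2 * (T / K))) ≤ ε / 2 := by
    have h1 : Tendsto (fun K : ℕ => 2 * (T / K)) atTop (𝓝 0) := by
      simpa using (tendsto_const_div_atTop_nhds_zero_nat T).const_mul 2
    have h2 := (h1.const_mul (2 * (N * h) + 1)).const_mul (p : ℝ)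
    simp only [mul_zero] at h2
    exact ((eventually_gt_atTop 0).and ((eventually_all.2 fun k =>
      h1.eventually_le_const (ht k).1).and (h2.eventually_le_const (by positivity)))).exists
  filter_upwards [eventually_measure_not_seedsFrequently_le hS hη hT hA
    (show 0 < ε / 2 by positivity) hK0, eventually_mem_Ioc,
    hS.tendsto_spaceScale.eventually_gt_atTop 0,
    (tendsto_natCast_atTop_atTop.comp hS.tendsto_spaceScale).eventually_ge_atTop (1 / h)]
    with l hseed hl hn hn1
  have ha := (hS.timeScale_spec hl.1).1
  have hn1' : 1 ≤ spaceScale μS l * h := by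
    simp only [Function.comp_apply] at hn1
    rwa [div_le_iff₀ hh] at hn1
  set e := T / (K : ℝ) with he
  have he0 : 0 < e := by positivity
  set W := siteWindow (spaceScale μS l) (N * h) with hW
  have hmatch : P l (⋃ k, ⋃ i ∈ W, ⋃ q, {ω | M l i q ω ∈
      Ioc (timeScale μS l * (t k - 2 * e)) (timeScale μS l * t k)}) ≤ ENNReal.ofReal (ε / 2) := by
    have hk : ∀ k, P l (⋃ i ∈ W, ⋃ q, {ω | M l i q ω ∈
        Ioc (timeScale μS l * (t k - 2 * e)) (timeScale μS l * t k)}) ≤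
        ENNReal.ofReal ((2 * (N * h) + 1) * (2 * e)) := by
      intro k
      have h1 := sum_measure_fires_window_le hM hS hl (hη l hl) hn hA
        (show t k - 2 * e ≤ t k by linarith)
      rw [sub_sub_cancel] at h1
      exact (measure_biUnion_finset_le _ _).trans
        ((Finset.sum_le_sum fun i _ => measure_iUnion_le _).trans h1)
    refine (measure_iUnion_fintype_le _ _).trans ((Finset.sum_le_sum fun k _ => hk k).trans ?_)
    rw [Finset.sum_const, Finset.card_univ, Fintype.card_fin, nsmul_eq_mul,
      ← ENNReal.ofReal_natCast, ← ENNReal.ofReal_mul (by positivity)]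
    exact ENNReal.ofReal_le_ofReal hKε
  have hsub : {ω | (∀ k, ∃ j, IsBracket (unseededCells μS l T h N (S l) ω) h (x k) j) ∧
      ¬ ∀ k, intervalDist (Icc (approxCluster (unseededCells μS l T h N (S l) ω) h (x k)).1
        (approxCluster (unseededCells μS l T h N (S l) ω) h (x k)).2)
        (rescaledCluster μS l (η l ω) (t k) (x k)) ≤ 4 * h} ≤ᵐ[P l]
      ({ω | ¬ SeedsFrequently (fun i k => S l i k ω) W (2 * (timeScale μS l * e))
        (timeScale μS l * T)} ∪ ⋃ k, ⋃ i ∈ W, ⋃ q, {ω | M l i q ω ∈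
      Ioc (timeScale μS l * (t k - 2 * e)) (timeScale μS l * t k)} : Set (Ω l)) := by
    filter_upwards [(hη l hl).ae_isRegularPath hS] with ω hω hmem
    by_contra hcon
    obtain ⟨hc1, hc2⟩ := not_or.1 hcon
    rw [mem_ofPred_eq, not_not] at hc1
    refine hmem.2 fun k => ?_
    refine (hω.intervalDist_approxCluster_le (fun i => mem_unseededCells) (hmem.1 k) hh hn1' hc1
      (by positivity)).2 _ ⟨?_, ?_⟩ fun i hi q hq => hc2 ?_
    · have := mul_le_mul_of_nonneg_left (hKt k) ha.le
      linarith
    · exact mul_le_mul_of_nonneg_left (ht k).2 ha.le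
    · refine mem_iUnion.2 ⟨k, mem_biUnion hi (mem_iUnion.2 ⟨q, ?_, hq.2⟩)⟩
      have := hq.1
      linarith
  calc _ ≤ ENNReal.ofReal (ε / 2) + ENNReal.ofReal (ε / 2) :=
        (measure_mono_ae hsub).trans ((measure_union_le _ _).trans (add_le_add hseed hmatch))
    _ = ENNReal.ofReal ε := by
        rw [← ENNReal.ofReal_add (by positivity) (by positivity), add_halves]

/-- The paths of the clusters are close to their discretizations with large probability. -/
lemma eventually_measure_paths_le (hM : HypM μM) (hS : HypSZero μS)
    (hη : ∀ l ∈ Ioc (0 : ℝ) 1, IsForestFire (P l) μS (slowedLaw μM l) (S l) (M l) (η l))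
    {p : ℕ} {T h ε ρ : ℝ} (hT : 0 < T) (x : Fin p → ℝ)
    (N : ℕ) (hh : 0 < h) (hε : 0 < ε) (hρ : 0 < ρ) :
    ∀ᶠ l in 𝓝[>] 0, P l {ω | (∀ k, ∃ j, IsBracket (unseededCells μS l T h N (S l) ω) h (x k) j) ∧
      ¬ ∀ k, pathDist T
        (fun _ => Icc (approxCluster (unseededCells μS l T h N (S l) ω) h (x k)).1
          (approxCluster (unseededCells μS l T h N (S l) ω) h (x k)).2)
        (fun t => rescaledCluster μS l (η l ω) t (x k)) ≤ 4 * h * T + ρ} ≤ ENNReal.ofReal ε := by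
  have := (hη 1 ⟨one_pos, le_rfl⟩).isProbabilityMeasure_delayLaw
  have hA : 0 ≤ N * h := by positivity
  -- The window receives on average at most `(2 N h + 1) T` matches, so by Markov's inequality `q`
  -- or more of them fall with probability at most `ε / 2`. Then `K` makes the bad times, of total
  -- length at most `2 (T / K) (1 + q)`, cost at most `ρ`.
  obtain ⟨q, hq0, hq⟩ : ∃ q : ℝ, 0 < q ∧ (2 * (N * h) + 1) * T ≤ q * (ε / 2) :=
    ⟨(2 * (N * h) + 1) * T / (ε / 2), by positivity, by field_simp; rfl⟩
  obtain ⟨K, hK0, hKρ⟩ : ∃ K : ℕ, 0 < K ∧ 4 * (N * h) * (2 * (T / K) * (1 + q)) ≤ ρ := by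
    have h1 : Tendsto (fun K : ℕ => 4 * (N * h) * (2 * (T / K) * (1 + q))) atTop (𝓝 0) := by
      simpa using (((tendsto_const_div_atTop_nhds_zero_nat T).const_mul 2).mul_const
        (1 + q)).const_mul (4 * (N * h))
    exact ((eventually_gt_atTop 0).and (h1.eventually_le_const hρ)).exists
  filter_upwards [eventually_measure_not_seedsFrequently_le hS hη hT hA
    (show 0 < ε / 2 by positivity) hK0, eventually_mem_Ioc,
    hS.tendsto_spaceScale.eventually_gt_atTop 0,
    (tendsto_natCast_atTop_atTop.comp hS.tendsto_spaceScale).eventually_ge_atTop (1 / h)]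
    with l hseed hl hn hn1
  have ha := (hS.timeScale_spec hl.1).1
  have hn1' : 1 ≤ spaceScale μS l * h := by
    simp only [Function.comp_apply] at hn1
    rwa [div_le_iff₀ hh] at hn1
  set a := timeScale μS l with hadef
  set e := T / (K : ℝ) with he
  have he0 : 0 < e := by positivity
  set W := siteWindow (spaceScale μS l) (N * h) with hW
  have hdiv : ∀ (i : ℤ) (k : ℕ) (ω : Ω l) (s t : ℝ),
      M l i k ω / a ∈ Ioc s t ↔ M l i k ω ∈ Ioc (a * s) (a * t) := fun i k ω s t => by
    rw [mem_Ioc, mem_Ioc, lt_div_iff₀ ha, div_le_iff₀ ha, mul_comm a, mul_comm a]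
  set G : Ω l → ℝ≥0∞ := fun ω => ∑' z : W × ℕ, (Ioc 0 T).indicator 1 (M l z.1 z.2 ω / a) with hG
  have hGm : ∀ z : W × ℕ, Measurable fun ω =>
      (Ioc 0 T).indicator (1 : ℝ → ℝ≥0∞) (M l z.1 z.2 ω / a) := fun z =>
    (measurable_one.indicator measurableSet_Ioc).comp
      (((hη l hl).fires z.1).measurable z.2 |>.div_const a)
  have hmatch : P l {ω | ENNReal.ofReal q ≤ G ω} ≤ ENNReal.ofReal (ε / 2) := by
    have h1 : ∫⁻ ω, G ω ∂(P l) ≤ ENNReal.ofReal ((2 * (N * h) + 1) * T) := by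
      have h2 := sum_measure_fires_window_le hM hS hl (hη l hl) hn hA hT.le
      rw [sub_zero] at h2
      refine le_trans (le_of_eq ?_) h2
      rw [hG, lintegral_tsum fun z => (hGm z).aemeasurable, 
        ENNReal.tsum_prod (f := fun (i : W) (k : ℕ) =>
          ∫⁻ ω, (Ioc 0 T).indicator 1 (M l i k ω / a) ∂(P l)), tsum_fintype]
      refine Eq.trans (Finset.sum_congr rfl fun (i : W) _ => tsum_congr fun k => ?_)
        (Finset.sum_coe_sort W fun i => ∑' k, P l {ω | M l i k ω ∈ Ioc (a * 0) (a * T)})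
      have h3 : MeasurableSet {ω | M l i k ω ∈ Ioc (a * 0) (a * T)} :=
        ((hη l hl).fires i).measurable k measurableSet_Ioc
      rw [← lintegral_indicator_one h3]
      refine lintegral_congr fun ω => ?_
      simp only [indicator, hdiv, mem_ofPred_eq, Pi.one_apply]
    have hGmeas : Measurable G := Measurable.tsum hGm
    have h2 := mul_meas_ge_le_lintegral (μ := P l) hGmeas (ENNReal.ofReal q)
    have h3 : ENNReal.ofReal q * P l {ω | ENNReal.ofReal q ≤ G ω} ≤
        ENNReal.ofReal q * ENNReal.ofReal (ε / 2) := by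
      refine h2.trans (h1.trans ?_)
      rw [← ENNReal.ofReal_mul hq0.le]
      exact ENNReal.ofReal_le_ofReal hq
    exact (ENNReal.mul_le_mul_iff_right (by simpa using hq0) ENNReal.ofReal_ne_top).1 h3
  have hsub : {ω | (∀ k, ∃ j, IsBracket (unseededCells μS l T h N (S l) ω) h (x k) j) ∧
      ¬ ∀ k, pathDist T
        (fun _ => Icc (approxCluster (unseededCells μS l T h N (S l) ω) h (x k)).1
          (approxCluster (unseededCells μS l T h N (S l) ω) h (x k)).2)
        (fun t => rescaledCluster μS l (η l ω) t (x k)) ≤ 4 * h * T + ρ} ≤ᵐ[P l]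
      ({ω | ¬ SeedsFrequently (fun i k => S l i k ω) W (2 * (a * e)) (a * T)} ∪
        {ω | ENNReal.ofReal q ≤ G ω} : Set (Ω l)) := by
    filter_upwards [(hη l hl).ae_isRegularPath hS] with ω hω hmem
    by_contra hcon
    obtain ⟨hc1, hc2⟩ := not_or.1 hcon
    rw [mem_ofPred_eq, not_not] at hc1
    rw [mem_ofPred_eq, not_le] at hc2
    refine hmem.2 fun k => ?_
    obtain ⟨hin, hdist⟩ := hω.intervalDist_approxCluster_le (fun i => mem_unseededCells)
      (hmem.1 k) hh hn1' hc1 (by positivity)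
    obtain ⟨hy1, hy2, hy3⟩ := approxCluster_mem (v := unseededCells μS l T h N (S l) ω)
      (fun i hi => (mem_nonvoid.1 hi).1) hh x le_rfl k
    have hstep := hω.isStepPath (spaceScale μS l) ⌊(spaceScale μS l : ℝ) * x k⌋ ha T
    have hIA := Icc_subset_Icc hy1 hy3
    have hJA : ∀ t ∈ Icc 0 T, rescaledCluster μS l (η l ω) t (x k) ⊆ Icc (-(N * h)) (N * h) :=
      fun t ht => hin _ ⟨mul_nonneg ha.le ht.1, mul_le_mul_of_nonneg_left ht.2 ha.le⟩
    refine (integral_le_of_marks (A := 4 * (N * h)) (b := 4 * h) (e := 2 * e) (q := q)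
      (τ := fun z : W × ℕ => M l z.1 z.2 ω / a) hT (by positivity) (by positivity) (by positivity)
      hq0.le ?_ ?_ ?_ hc2.le).trans (by gcongr)
    · exact (isStepPath_const T (Icc_mem_intervals _ _)).intervalIntegrable hT.le hA hstep
        (fun _ _ => hIA) hJA
    · exact fun t ht => intervalDist_le_of_subset hA (Icc_mem_intervals _ _) (hstep.mem t ht) hIA
        (hJA t ht)
    · intro t ht hno
      refine hdist (a * t) ⟨?_, mul_le_mul_of_nonneg_left ht.2 ha.le⟩ fun i hi q hq =>
        hno (⟨i, hi⟩, q) ((hdiv _ _ _ _ _).2 ?_)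
      · have := mul_le_mul_of_nonneg_left ht.1 ha.le
        linarith
      · rwa [show a * (t - 2 * e) = a * t - 2 * (a * e) by ring]
  calc _ ≤ ENNReal.ofReal (ε / 2) + ENNReal.ofReal (ε / 2) :=
        (measure_mono_ae hsub).trans ((measure_union_le _ _).trans (add_le_add hseed hmatch))
    _ = ENNReal.ofReal ε := by
        rw [← ENNReal.ofReal_add (by positivity) (by positivity), add_halves]

end Closeness

/-! ### Convergence in law through discretizations -/

section Convergence

/-- A test function is uniformly continuous near a compact family of points. -/
lemma IsTestFunction.exists_uniform {V W : Type*} [PseudoMetricSpace W] {E E₀ : Set V}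
    {d : V → V → ℝ} {F : V → ℝ} (hF : IsTestFunction E d F) (hE : E₀ ⊆ E) {K : Set W}
    (hK : IsCompact K) {c : W → V} (hc : ∀ y ∈ K, c y ∈ E₀) (hself : ∀ y ∈ K, d (c y) (c y) = 0)
    {B : ℝ} (hB : 0 ≤ B)
    (htri : ∀ y ∈ K, ∀ y' ∈ K, ∀ w ∈ E₀, d (c y) w ≤ B * dist y y' + d (c y') w) {ε : ℝ}
    (hε : 0 < ε) :
    ∃ r > 0, ∀ y ∈ K, ∀ w ∈ E₀, d (c y) w < r → |F w - F (c y)| < ε := by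
  have := hK.induction_on (p := fun s => ∃ r > 0, ∀ y ∈ s ∩ K, ∀ w ∈ E₀, d (c y) w < r →
    |F w - F (c y)| < ε) ⟨1, one_pos, by simp⟩
    (fun s t hst ⟨r, hr, h⟩ => ⟨r, hr, fun y hy => h y ⟨hst hy.1, hy.2⟩⟩)
    (fun s t ⟨r, hr, h⟩ ⟨r', hr', h'⟩ => ⟨min r r', lt_min hr hr', fun y hy w hw hd => by
      obtain h1 | h1 := hy.1
      · exact h y ⟨h1, hy.2⟩ w hw (hd.trans_le (min_le_left _ _))
      · exact h' y ⟨h1, hy.2⟩ w hw (hd.trans_le (min_le_right _ _))⟩) ?_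
  · simpa using this
  · intro y hy
    -- Continuity at `c y` controls both `F w` and `F (c y')` when `y'` is near `y`, since `htri`
    -- moves the base point from `y'` to `y`. The radius uses `B + 1` so that `B = 0` is allowed.
    obtain ⟨r, hr, h⟩ := hF.2 (c y) (hE (hc y hy)) (ε / 2) (by positivity)
    refine ⟨Metric.ball y (r / (2 * (B + 1))), mem_nhdsWithin_of_mem_nhds
      (Metric.ball_mem_nhds y (by positivity)), r / 2, by positivity, fun y' hy' w hw hd => ?_⟩
    have h1 : B * dist y y' ≤ r / 2 := by
      have h2 : dist y y' ≤ r / (2 * (B + 1)) := by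
        rw [dist_comm]
        exact (Metric.mem_ball.1 hy'.1).le
      calc B * dist y y' ≤ (B + 1) * (r / (2 * (B + 1))) := by gcongr; linarith
        _ = r / 2 := by field_simp
    have h3 := h w (hE hw) (by linarith [htri y hy y' hy'.2 w hw])
    have h4 := h (c y') (hE (hc y' hy'.2)) (by
      have := htri y hy y' hy'.2 (c y') (hc y' hy'.2)
      rw [hself y' hy'.2] at this
      linarith)
    rw [abs_lt] at h3 h4 ⊢
    constructor <;> linarith [h3.1, h3.2, h4.1, h4.2]

/-- By Borel–Cantelli, the approximations with `ε = 2⁻ⁿ` converge almost everywhere. The function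
`f` need not be known to be measurable for its bad sets to have small outer measure. -/
lemma aestronglyMeasurable_of_approx {Ω : Type*} [MeasurableSpace Ω] {P : Measure Ω} {f : Ω → ℝ}
    (h : ∀ ε > 0, ∃ g : Ω → ℝ, Measurable g ∧ P {ω | ε ≤ |f ω - g ω|} ≤ ENNReal.ofReal ε) :
    AEStronglyMeasurable f P := by
  choose g hg hgP using fun n : ℕ => h ((1 / 2 : ℝ) ^ n) (by positivity)
  have hsum : ∑' n, P {ω | (1 / 2 : ℝ) ^ n ≤ |f ω - g n ω|} ≠ ∞ := by
    refine ne_top_of_le_ne_top ?_ (ENNReal.tsum_le_tsum hgP)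
    rw [← ENNReal.ofReal_tsum_of_nonneg (fun n => by positivity)
      (summable_geometric_of_lt_one (by norm_num) (by norm_num))]
    exact ENNReal.ofReal_ne_top
  refine aestronglyMeasurable_of_tendsto_ae atTop (fun n => (hg n).aestronglyMeasurable) ?_
  filter_upwards [ae_eventually_notMem hsum] with ω hω
  refine tendsto_iff_dist_tendsto_zero.2 (squeeze_zero' (.of_forall fun n => dist_nonneg) ?_
    (tendsto_pow_atTop_nhds_zero_of_lt_one (r := (1 / 2 : ℝ)) (by norm_num) (by norm_num)))
  filter_upwards [hω] with n hn
  rw [not_le] at hn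
  rw [dist_comm, Real.dist_eq]
  exact hn.le

lemma abs_integral_sub_integral_le {Ω : Type*} [MeasurableSpace Ω] {P : Measure Ω}
    [IsProbabilityMeasure P] {f g : Ω → ℝ} (hf : Integrable f P) (hg : Integrable g P) {C ε b : ℝ}
    (hC : 0 ≤ C) (hε : 0 ≤ ε) (hb : 0 ≤ b) (hfC : ∀ᵐ ω ∂P, |f ω| ≤ C) (hgC : ∀ ω, |g ω| ≤ C)
    {B : Set Ω} (hB : P B ≤ ENNReal.ofReal b) (h : ∀ᵐ ω ∂P, ω ∉ B → |f ω - g ω| ≤ ε) :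
    |∫ ω, f ω ∂P - ∫ ω, g ω ∂P| ≤ ε + 2 * C * b := by
  rw [← integral_sub hf hg]
  have hm := measurableSet_toMeasurable P B
  have hint : Integrable (fun ω => ε + (toMeasurable P B).indicator (fun _ => 2 * C) ω) P :=
    (integrable_const ε).add ((integrable_const _).indicator hm)
  rw [← Real.norm_eq_abs]
  refine (norm_integral_le_of_norm_le hint ?_).trans ?_
  · filter_upwards [h, hfC] with ω h1 h2
    by_cases hω : ω ∈ toMeasurable P B
    · rw [indicator_of_mem hω, Real.norm_eq_abs]
      have := abs_sub (f ω) (g ω)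
      linarith [hgC ω]
    · rw [indicator_of_notMem hω, add_zero]
      exact h1 fun hB => hω (subset_toMeasurable P B hB)
  · rw [integral_add (integrable_const _) ((integrable_const _).indicator hm),
      integral_indicator_const _ hm, measureReal_def, measure_toMeasurable]
    simp only [integral_const, probReal_univ, smul_eq_mul, one_mul]
    have := ENNReal.toReal_le_of_le_ofReal hb hB
    rw [mul_comm]
    gcongr

variable {μS μM : Measure ℝ} {Ω : ℝ → Type*} [∀ l, MeasurableSpace (Ω l)] {P : ∀ l, Measure (Ω l)}
  [∀ l, IsProbabilityMeasure (P l)] {S M : ∀ l, ℤ → ℕ → Ω l → ℝ} {η : ∀ l, Ω l → ℝ → ℤ → Bool}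
  {Ω' : Type*} [MeasurableSpace Ω'] {P' : Measure Ω'} [IsProbabilityMeasure P']
  {π : Ω' → Measure ℝ}

/-- The set of the cells with a site that receives no seed converges in law to the set of the
cells charged by the Poisson measure. -/
lemma tendsto_integral_unseededCells (hS : HypSZero μS)
    (hη : ∀ l ∈ Ioc (0 : ℝ) 1, IsForestFire (P l) μS (slowedLaw μM l) (S l) (M l) (η l))
    (hπ : IsPoissonMeasure P' π) {T h : ℝ} (hT : 0 < T) (hh : 0 < h) (N : ℕ) (f : Finset ℤ → ℝ) :
    Tendsto (fun l => ∫ ω, f (unseededCells μS l T h N (S l) ω) ∂(P l)) (𝓝[>] 0)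
      (𝓝 (∫ ω, f (chargedCells h N π ω) ∂P')) := by
  have := (hη 1 ⟨one_pos, le_rfl⟩).isProbabilityMeasure_delayLaw
  have hm : ∀ j, MeasurableSet {ω | π ω (cell h j) = 0} := fun j =>
    hπ.measurable _ (measurableSet_cell h j) (measurableSet_singleton _)
  refine tendsto_integral_comp_nonvoid ?_ ?_ hm (hπ.iIndepSet_cell hh) (fun j => ?_) _ f
  · filter_upwards [eventually_mem_Ioc] with l hl j
    exact (hη l hl).measurableSet_seededCell _ _ _ _
  · filter_upwards [eventually_mem_Ioc, hS.tendsto_spaceScale.eventually_gt_atTop 0] with l hl hn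
    exact (hη l hl).iIndepSet_seededCell hn hh _
  · have h1 : P'.real {ω | π ω (cell h j) = 0} = Real.exp (-h) := by
      rw [measureReal_def, cell, hπ.measure_eq_zero (by nlinarith), ENNReal.toReal_ofReal
        (Real.exp_nonneg _)]
      congr 1
      ring
    rw [h1]
    refine (hS.tendsto_void hh hT j).congr' ?_
    filter_upwards [eventually_mem_Ioc] with l hl
    rw [(hη l hl).measureReal_seededCell]

/-- Random elements that are close to functions of the set of the cells with a site that receives
no seed converge in law to a random element that is close to the same functions of the set of the
charged cells. -/
theorem tendstoInLaw_of_discretization (hS : HypSZero μS)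
    (hη : ∀ l ∈ Ioc (0 : ℝ) 1, IsForestFire (P l) μS (slowedLaw μM l) (S l) (M l) (η l))
    (hπ : IsPoissonMeasure P' π) {V : Type*} {E E₀ : Set V} {d : V → V → ℝ} {p : ℕ}
    (x : Fin p → ℝ) {c : (Fin p → ℝ × ℝ) → V} {T B C : ℝ} (hT : 0 < T) (hB : 0 ≤ B) (hC : 0 < C)
    (hE : E₀ ⊆ E) (hc : ∀ A, ∀ y ∈ boundedPairs p A, c y ∈ E₀)
    (hself : ∀ A, ∀ y ∈ boundedPairs p A, d (c y) (c y) = 0)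
    (htri : ∀ A, ∀ y ∈ boundedPairs p A, ∀ y' ∈ boundedPairs p A, ∀ w ∈ E₀,
      d (c y) w ≤ B * dist y y' + d (c y') w)
    {X : ∀ l, Ω l → V} {Y : Ω' → V} (hX : ∀ l ∈ Ioc (0 : ℝ) 1, ∀ᵐ ω ∂(P l), X l ω ∈ E₀)
    (hY : ∀ᵐ ω ∂P', Y ω ∈ E₀)
    (hXm : ∀ F, IsTestFunction E d F → ∀ l ∈ Ioc (0 : ℝ) 1,
      AEStronglyMeasurable (fun ω => F (X l ω)) (P l))
    (hXd : ∀ (N : ℕ) (h r ε : ℝ), 0 < h → C * h < r → 0 < ε → ∀ᶠ l in 𝓝[>] 0,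
      P l {ω | (∀ k, ∃ j, IsBracket (unseededCells μS l T h N (S l) ω) h (x k) j) ∧
        r ≤ d (c fun k => approxCluster (unseededCells μS l T h N (S l) ω) h (x k)) (X l ω)} ≤
          ENNReal.ofReal ε)
    (hYd : ∀ (N : ℕ) (h : ℝ), 0 < h → ∀ᵐ ω ∂P',
      (∀ k, ∃ j, IsBracket (chargedCells h N π ω) h (x k) j) →
        d (c fun k => approxCluster (chargedCells h N π ω) h (x k)) (Y ω) ≤ C * h) :
    TendstoInLaw E d P X P' Y := by
  have hbd : ∀ F, IsTestFunction E d F → ∃ D, 0 ≤ D ∧ ∀ v ∈ E, |F v| ≤ D := fun F hF => by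
    obtain ⟨D, hD⟩ := hF.1
    exact ⟨|D|, abs_nonneg D, fun v hv => (hD v hv).trans (le_abs_self D)⟩
  have hV' : ∀ h j, MeasurableSet {ω | π ω (cell h j) = 0} := fun h j =>
    hπ.measurable _ (measurableSet_cell h j) (measurableSet_singleton _)
  -- the parameters of the discretization
  have hpar : ∀ F, IsTestFunction E d F → ∀ ε > 0, ∃ (A r h : ℝ) (N : ℕ), 0 < h ∧ C * h < r ∧
      N * h ≤ A ∧ (∀ y ∈ boundedPairs p A, ∀ w ∈ E₀, d (c y) w < r → |F w - F (c y)| < ε) ∧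
      P' {ω | ¬ ∀ k, ∃ j, IsBracket (chargedCells h N π ω) h (x k) j} ≤ ENNReal.ofReal ε := by
    intro F hF ε hε
    have hp : 0 < ε / (p + 1) := by positivity
    obtain ⟨A, hA⟩ := (eventually_all.2 fun k =>
      hπ.eventually_measure_not_isBracket_le (x k) hp).exists
    -- The order of choices matters: `A` bounds the missing brackets uniformly in small `h`, the
    -- compact set then fixes `r`, and `h` comes last. The `+ 1` leaves room for rounding `N = ⌈|A|
    -- / h⌉₊`, as `h < 1`.
    obtain ⟨r, hr, hFr⟩ := hF.exists_uniform hE (isCompact_boundedPairs p (|A| + 1))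
      (hc _) (hself _) hB (htri _) hε
    obtain ⟨h, hbad, hh0, hh⟩ := ((eventually_all.2 hA).and
      (Ioo_mem_nhdsGT (show (0 : ℝ) < min 1 (r / C) by positivity))).exists
    have hh1 : h < 1 := hh.trans_le (min_le_left _ _)
    have hh2 : h < r / C := hh.trans_le (min_le_right _ _)
    refine ⟨|A| + 1, r, h, ⌈|A| / h⌉₊, hh0, ?_, ?_, hFr, ?_⟩
    · rwa [lt_div_iff₀ hC, mul_comm] at hh2
    · have h1 := Nat.ceil_lt_add_one (show 0 ≤ |A| / h by positivity)
      have h2 : (⌈|A| / h⌉₊ : ℝ) * h ≤ (|A| / h + 1) * h := by gcongr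
      have h3 : (|A| / h + 1) * h = |A| + h := by field_simp
      linarith
    · have h1 : A ≤ ⌈|A| / h⌉₊ * h := by
        have h2 := Nat.le_ceil (|A| / h)
        rw [div_le_iff₀ hh0] at h2
        exact (le_abs_self A).trans h2
      have h3 : {ω | ¬ ∀ k, ∃ j, IsBracket (chargedCells h ⌈|A| / h⌉₊ π ω) h (x k) j} =
          ⋃ k, {ω | ¬ ∃ j, IsBracket (chargedCells h ⌈|A| / h⌉₊ π ω) h (x k) j} := by
        ext ω
        simp
      rw [h3]
      refine (measure_iUnion_fintype_le _ _).trans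
        ((Finset.sum_le_sum fun k _ => hbad k _ h1).trans ?_)
      rw [Finset.sum_const, Finset.card_univ, Fintype.card_fin, nsmul_eq_mul,
        ← ENNReal.ofReal_natCast, ← ENNReal.ofReal_mul (by positivity)]
      refine ENNReal.ofReal_le_ofReal ?_
      rw [mul_div_assoc', div_le_iff₀ (by positivity)]
      nlinarith
  have hmem : ∀ {A h : ℝ} {N : ℕ} (v : Finset ℤ), v ⊆ Finset.Ico (-N : ℤ) N → 0 < h → N * h ≤ A →
      (fun k => approxCluster v h (x k)) ∈ boundedPairs p A := fun v hv hh hA =>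
    approxCluster_mem hv hh x hA
  have hYclose : ∀ F, IsTestFunction E d F → ∀ {ε A r h : ℝ} {N : ℕ}, 0 < h → C * h < r →
      N * h ≤ A → (∀ y ∈ boundedPairs p A, ∀ w ∈ E₀, d (c y) w < r → |F w - F (c y)| < ε) →
      ∀ᵐ ω ∂P', ω ∉ {ω | ¬ ∀ k, ∃ j, IsBracket (chargedCells h N π ω) h (x k) j} →
        |F (Y ω) - F (c fun k => approxCluster (chargedCells h N π ω) h (x k))| < ε := by
    intro F _ ε A r h N hh hr hA hFr
    filter_upwards [hY, hYd N h hh] with ω h1 h2 h3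
    rw [not_not] at h3
    exact hFr _ (hmem _ (fun i hi => (mem_nonvoid.1 hi).1) hh hA) _ h1 ((h2 h3).trans_lt hr)
  have hYm : ∀ F, IsTestFunction E d F → AEStronglyMeasurable (fun ω => F (Y ω)) P' := by
    intro F hF
    refine aestronglyMeasurable_of_approx fun ε hε => ?_
    obtain ⟨A, r, h, N, hh, hr, hA, hFr, hbad⟩ := hpar F hF ε hε
    refine ⟨fun ω => F (c fun k => approxCluster (chargedCells h N π ω) h (x k)),
      measurable_comp_nonvoid (hV' h) _ fun v => F (c fun k => approxCluster v h (x k)),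
      le_trans (measure_mono_ae ?_) hbad⟩
    filter_upwards [hYclose F hF hh hr hA hFr] with ω h1 h2
    by_contra h3
    exact (h1 h3).not_ge h2
  have hXi : ∀ F, IsTestFunction E d F → ∀ l ∈ Ioc (0 : ℝ) 1,
      Integrable (fun ω => F (X l ω)) (P l) := fun F hF l hl => by
    obtain ⟨D, hD0, hD⟩ := hbd F hF
    exact .of_bound (hXm F hF l hl) D ((hX l hl).mono fun ω hω => hD _ (hE hω))
  have hYi : ∀ F, IsTestFunction E d F → Integrable (fun ω => F (Y ω)) P' := fun F hF => by
    obtain ⟨D, hD0, hD⟩ := hbd F hF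
    exact .of_bound (hYm F hF) D (hY.mono fun ω hω => hD _ (hE hω))
  refine ⟨fun l hl => (hX l hl).mono fun ω hω => hE hω, hY.mono fun ω hω => hE hω, hXi, hYi, ?_⟩
  intro F hF
  obtain ⟨D, hD0, hD⟩ := hbd F hF
  refine Metric.tendsto_nhds.2 fun ε₀ hε₀ => ?_
  -- The three errors below, `ε + 2 D ε` in the limit, `ε` between discretizations and `ε + 6 D ε`
  -- before the limit, add up to `3 ε + 8 D ε < ε₀`.
  set ε := ε₀ / (4 + 8 * D) with hεdef
  have hε : 0 < ε := by positivity
  have hε₀' : ε₀ = 4 * ε + 8 * D * ε := by rw [hεdef]; field_simp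
  obtain ⟨A, r, h, N, hh, hr, hA, hFr, hbad⟩ := hpar F hF ε hε
  classical
  set f : Finset ℤ → ℝ := fun v => F (c fun k => approxCluster v h (x k)) with hf
  -- The absence of a bracket depends only on the set of charged cells, so its probability before
  -- the limit is controlled by the same convergence as `f`.
  set g : Finset ℤ → ℝ := fun v => if ∀ k, ∃ j, IsBracket v h (x k) j then 0 else 1 with hg
  have hfD : ∀ v ⊆ Finset.Ico (-N : ℤ) N, |f v| ≤ D := fun v hv =>
    hD _ (hE (hc A _ (hmem v hv hh hA)))
  have hlim : |∫ ω, F (Y ω) ∂P' - ∫ ω, f (chargedCells h N π ω) ∂P'| ≤ ε + 2 * D * ε := by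
    refine abs_integral_sub_integral_le (hYi F hF) ?_ hD0 hε.le hε.le
      (hY.mono fun ω hω => hD _ (hE hω)) (fun ω => hfD _ fun i hi => (mem_nonvoid.1 hi).1) hbad
      ((hYclose F hF hh hr hA hFr).mono fun ω h1 h2 => (h1 h2).le)
    exact .of_bound (measurable_comp_nonvoid (hV' h) _ f).aestronglyMeasurable D
      (.of_forall fun ω => hfD _ fun i hi => (mem_nonvoid.1 hi).1)
  have hglim : ∫ ω, g (chargedCells h N π ω) ∂P' < 2 * ε := by
    have h1 : MeasurableSet {ω | ¬ ∀ k, ∃ j, IsBracket (chargedCells h N π ω) h (x k) j} := by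
      have := measurable_comp_nonvoid (hV' h) (Finset.Ico (-N : ℤ) N) g
        (measurableSet_singleton 1)
      convert this using 1
      ext ω
      simp [hg, chargedCells]
    have h2 : ∀ ω, g (chargedCells h N π ω) =
        {ω | ¬ ∀ k, ∃ j, IsBracket (chargedCells h N π ω) h (x k) j}.indicator 1 ω := fun ω => by
      by_cases h3 : ∀ k, ∃ j, IsBracket (chargedCells h N π ω) h (x k) j
      · simp only [hg, if_pos h3]
        rw [indicator_of_notMem (by simpa using h3)]
      · simp only [hg, if_neg h3]
        rw [indicator_of_mem (by simpa using h3), Pi.one_apply]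
    simp_rw [h2]
    rw [integral_indicator_one h1, measureReal_def]
    have := ENNReal.toReal_le_of_le_ofReal hε.le hbad
    linarith
  have hfl := tendsto_integral_unseededCells hS hη hπ hT hh N f
  have hgl := tendsto_integral_unseededCells hS hη hπ hT hh N g
  filter_upwards [hXd N h r ε hh hr hε, hgl.eventually_lt_const hglim, eventually_mem_Ioc,
    Metric.tendsto_nhds.1 hfl ε hε] with l h1 h2 hl h3
  have hV := (hη l hl).measurableSet_seededCell (spaceScale μS l) h (timeScale μS l * T)
  have hbadl : P l {ω | ¬ ∀ k, ∃ j, IsBracket (unseededCells μS l T h N (S l) ω) h (x k) j} ≤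
      ENNReal.ofReal (2 * ε) := by
    have h4 : MeasurableSet
        {ω | ¬ ∀ k, ∃ j, IsBracket (unseededCells μS l T h N (S l) ω) h (x k) j} := by
      have := measurable_comp_nonvoid hV (Finset.Ico (-N : ℤ) N) g (measurableSet_singleton 1)
      convert this using 1
      ext ω
      simp [hg, unseededCells]
    have h5 : ∀ ω, g (unseededCells μS l T h N (S l) ω) = {ω | ¬ ∀ k, ∃ j, IsBracket
        (unseededCells μS l T h N (S l) ω) h (x k) j}.indicator 1 ω := fun ω => by
      by_cases h6 : ∀ k, ∃ j, IsBracket (unseededCells μS l T h N (S l) ω) h (x k) j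
      · simp only [hg, if_pos h6]
        rw [indicator_of_notMem (by simpa using h6)]
      · simp only [hg, if_neg h6]
        rw [indicator_of_mem (by simpa using h6), Pi.one_apply]
    simp_rw [h5] at h2
    rw [integral_indicator_one h4] at h2
    rw [← ofReal_measureReal]
    exact ENNReal.ofReal_le_ofReal h2.le
  have hXclose : |∫ ω, F (X l ω) ∂(P l) - ∫ ω, f (unseededCells μS l T h N (S l) ω) ∂(P l)| ≤
      ε + 2 * D * (2 * ε + ε) := by
    refine abs_integral_sub_integral_le (hXi F hF l hl) ?_ hD0 hε.le (by positivity)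
      ((hX l hl).mono fun ω hω => hD _ (hE hω)) (fun ω => hfD _ fun i hi => (mem_nonvoid.1 hi).1)
      (B := {ω | ¬ ∀ k, ∃ j, IsBracket (unseededCells μS l T h N (S l) ω) h (x k) j} ∪
        {ω | (∀ k, ∃ j, IsBracket (unseededCells μS l T h N (S l) ω) h (x k) j) ∧
        r ≤ d (c fun k => approxCluster (unseededCells μS l T h N (S l) ω) h (x k)) (X l ω)}) ?_ ?_
    · exact .of_bound (measurable_comp_nonvoid hV _ f).aestronglyMeasurable D
        (.of_forall fun ω => hfD _ fun i hi => (mem_nonvoid.1 hi).1)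
    · rw [ENNReal.ofReal_add (by positivity) hε.le]
      exact (measure_union_le _ _).trans (add_le_add hbadl h1)
    · filter_upwards [hX l hl] with ω h4 h5
      obtain ⟨h6, h7⟩ := not_or.1 h5
      rw [mem_ofPred_eq, not_not] at h6
      refine (hFr _ (hmem _ (fun i hi => (mem_nonvoid.1 hi).1) hh hA) _ h4 ?_).le
      by_contra h8
      exact h7 ⟨h6, not_lt.1 h8⟩
  rw [Real.dist_eq] at h3 ⊢
  rw [abs_le] at hXclose hlim
  rw [abs_lt] at h3 ⊢
  rw [hε₀']
  constructor <;> linarith [hXclose.1, hXclose.2, hlim.1, hlim.2, h3.1, h3.2]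

end Convergence

/-! ### The two convergences -/

section Main

variable {μS μM : Measure ℝ} {Ω : ℝ → Type*} [∀ l, MeasurableSpace (Ω l)] {P : ∀ l, Measure (Ω l)}
  [∀ l, IsProbabilityMeasure (P l)] {S M : ∀ l, ℤ → ℕ → Ω l → ℝ} {η : ∀ l, Ω l → ℝ → ℤ → Bool}
  {Ω' : Type*} [MeasurableSpace Ω'] {P' : Measure Ω'} [IsProbabilityMeasure P']
  {π : Ω' → Measure ℝ}

lemma abs_add_abs_le_dist {p : ℕ} (y y' : Fin p → ℝ × ℝ) (k : Fin p) :
    |(y k).1 - (y' k).1| + |(y k).2 - (y' k).2| ≤ 2 * dist y y' := by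
  have h1 := dist_le_pi_dist y y' k
  rw [Prod.dist_eq, Real.dist_eq, Real.dist_eq] at h1
  linarith [(le_max_left _ _).trans h1, (le_max_right _ _).trans h1]

omit [IsProbabilityMeasure P'] in
/-- The distance between the limit clusters and their discretizations. -/
lemma IsPoissonMeasure.ae_intervalDist_limitCluster_le (hπ : IsPoissonMeasure P' π) {p : ℕ}
    (x : Fin p → ℝ) (N : ℕ) {h : ℝ} (hh : 0 < h) :
    ∀ᵐ ω ∂P', (∀ k, ∃ j, IsBracket (chargedCells h N π ω) h (x k) j) → ∀ k t,
      intervalDist (Icc (approxCluster (chargedCells h N π ω) h (x k)).1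
        (approxCluster (chargedCells h N π ω) h (x k)).2) (limitCluster (π ω) t (x k)) ≤ 2 * h := by
  filter_upwards [hπ.ae_atoms h] with ω hω hbr k t
  obtain ⟨j, hj, he⟩ := approxCluster_spec (hbr k)
  obtain ⟨a, b, hab, hle, h1, h2⟩ := limitCluster_eq_Icc hh hω hj t
  rw [he, hab, intervalDist_Icc_Icc (hj.left_le_right hh) hle]
  linarith

theorem tendstoInLaw_clusters (hM : HypM μM) (hS : HypSZero μS)
    (hη : ∀ l ∈ Ioc (0 : ℝ) 1, IsForestFire (P l) μS (slowedLaw μM l) (S l) (M l) (η l))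
    (hπ : IsPoissonMeasure P' π) {p : ℕ} (t x : Fin p → ℝ) (ht : ∀ k, 0 < t k) :
    TendstoInLaw {I : Fin p → Set ℝ | ∀ k, I k ∈ intervals}
      (fun I J => ∑ k, intervalDist (I k) (J k))
      P (fun l ω k => rescaledCluster μS l (η l ω) (t k) (x k))
      P' (fun ω k => limitCluster (π ω) (t k) (x k)) := by
  have := (hη 1 ⟨one_pos, le_rfl⟩).isProbabilityMeasure_delayLaw
  set T : ℝ := 1 + ∑ k, t k with hTdef
  have hT : 0 < T := by
    have : 0 ≤ ∑ k, t k := Finset.sum_nonneg fun k _ => (ht k).le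
    linarith
  have htT : ∀ k, t k ∈ Ioc 0 T := fun k => by
    refine ⟨ht k, ?_⟩
    have : t k ≤ ∑ k, t k := Finset.single_le_sum (fun k _ => (ht k).le) (Finset.mem_univ k)
    linarith
  refine tendstoInLaw_of_discretization hS hη hπ x (c := fun y k => Icc (y k).1 (y k).2)
    (E₀ := {I : Fin p → Set ℝ | ∀ k, I k ∈ intervals}) (T := T) (B := 2 * p) (C := 4 * p + 1)
    hT (by positivity) (by positivity) Subset.rfl (fun A y _ k => Icc_mem_intervals _ _)
    (fun A y _ => by simp [intervalDist_self]) ?_ ?_ ?_ ?_ ?_ ?_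
  · intro A y hy y' hy' w hw
    calc ∑ k, intervalDist (Icc (y k).1 (y k).2) (w k)
        ≤ ∑ k, (2 * dist y y' + intervalDist (Icc (y' k).1 (y' k).2) (w k)) :=
          Finset.sum_le_sum fun k _ => (intervalDist_triangle (hy k).2.1 (hy' k).2.1 (hw k)).trans
            (by gcongr; exact abs_add_abs_le_dist y y' k)
      _ = 2 * p * dist y y' + ∑ k, intervalDist (Icc (y' k).1 (y' k).2) (w k) := by
          rw [Finset.sum_add_distrib, Finset.sum_const, Finset.card_univ, Fintype.card_fin,
            nsmul_eq_mul]
          ring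
  · intro l hl
    filter_upwards [(hη l hl).ae_isRegularPath hS] with ω hω k
    exact hω.rescale_cluster_mem _ _ (mul_nonneg (hS.timeScale_spec hl.1).1.le (ht k).le)
  · exact .of_forall fun ω k => limitCluster_mem_intervals _ _ _
  · exact fun F _ l hl => (hη l hl).aestronglyMeasurable_clusters hS _ _
      (fun k => mul_nonneg (hS.timeScale_spec hl.1).1.le (ht k).le) F
  · intro N h r ε hh hr hε
    filter_upwards [eventually_measure_clusters_le hM hS hη hT htT x N hh hε] with l hl
    refine (measure_mono ?_).trans hl
    rintro ω ⟨hbr, hle⟩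
    refine ⟨hbr, fun hall => hle.not_gt ?_⟩
    calc _ ≤ ∑ k : Fin p, 4 * h := Finset.sum_le_sum fun k _ => hall k
      _ < r := by
        rw [Finset.sum_const, Finset.card_univ, Fintype.card_fin, nsmul_eq_mul]
        linarith
  · intro N h hh
    filter_upwards [hπ.ae_intervalDist_limitCluster_le x N hh] with ω hω hbr
    calc _ ≤ ∑ k : Fin p, 2 * h := Finset.sum_le_sum fun k _ => hω hbr k _
      _ ≤ (4 * p + 1) * h := by
        rw [Finset.sum_const, Finset.card_univ, Fintype.card_fin, nsmul_eq_mul]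
        nlinarith [(p.cast_nonneg : (0 : ℝ) ≤ p)]

/-- Boundedness of `J` makes the integrals genuine; a non-integrable distance would have integral 0
by convention. -/
lemma pathDist_const_triangle {T : ℝ} (hT : 0 ≤ T) {a b a' b' : ℝ} (h : a ≤ b) (h' : a' ≤ b')
    {J : ℝ → Set ℝ} (hJ : IsStepPath T J) {A : ℝ} (hA : ∀ t ∈ Icc 0 T, J t ⊆ Icc (-A) A) :
    pathDist T (fun _ => Icc a b) J ≤ T * (|a - a'| + |b - b'|) + pathDist T (fun _ => Icc a' b') J := by
  have hint : ∀ c d : ℝ, IntervalIntegrable (fun t => intervalDist (Icc c d) (J t)) volume 0 T := by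
    intro c d
    have hD : ∀ z ∈ ({|A|, |c|, |d|} : Finset ℝ), z ≤ |A| + |c| + |d| := by
      have h1 := abs_nonneg A
      have h2 := abs_nonneg c
      have h3 := abs_nonneg d
      intro z hz
      simp only [Finset.mem_insert, Finset.mem_singleton] at hz
      rcases hz with rfl | rfl | rfl <;> linarith
    refine (isStepPath_const T (Icc_mem_intervals c d)).intervalIntegrable hT
      (A := |A| + |c| + |d|) (by positivity) hJ (fun _ _ => ?_) fun t ht => (hA t ht).trans ?_
    · exact Icc_subset_Icc (neg_le.1 ((neg_le_abs c).trans (hD _ (by simp))))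
        ((le_abs_self d).trans (hD _ (by simp)))
    · have h1 := (le_abs_self A).trans (hD _ (by simp))
      exact Icc_subset_Icc (by linarith) h1
  calc pathDist T (fun _ => Icc a b) J
      ≤ ∫ t in (0 : ℝ)..T, (|a - a'| + |b - b'| + intervalDist (Icc a' b') (J t)) :=
        intervalIntegral.integral_mono_on hT (hint a b)
          (intervalIntegrable_const.add (hint a' b'))
          fun t ht => intervalDist_triangle h h' (hJ.mem t ht)
    _ = _ := by
        rw [intervalIntegral.integral_add intervalIntegrable_const (hint a' b')]
        simp [pathDist, mul_add]

theorem tendstoInLaw_paths (hM : HypM μM) (hS : HypSZero μS)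
    (hη : ∀ l ∈ Ioc (0 : ℝ) 1, IsForestFire (P l) μS (slowedLaw μM l) (S l) (M l) (η l))
    (hπ : IsPoissonMeasure P' π) {T : ℝ} (hT : 0 < T) {p : ℕ} (x : Fin p → ℝ) :
    TendstoInLaw {J : Fin p → ℝ → Set ℝ | ∀ k, J k ∈ cadlagPaths T}
      (fun I J => ∑ k, pathDist T (I k) (J k))
      P (fun l ω k t => rescaledCluster μS l (η l ω) t (x k))
      P' (fun ω k t => limitCluster (π ω) t (x k)) := by
  have := (hη 1 ⟨one_pos, le_rfl⟩).isProbabilityMeasure_delayLaw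
  refine tendstoInLaw_of_discretization hS hη hπ x (c := fun y k _ => Icc (y k).1 (y k).2)
    -- On bounded step paths `δ_T` is a true integral and satisfies the triangle inequality needed;
    -- both the rescaled and the limit clusters are almost surely such paths. The constant `C`
    -- allows an error `4 h T` for each path, with a spare `h` to be shared.
    (E₀ := {J : Fin p → ℝ → Set ℝ | ∀ k, IsStepPath T (J k) ∧
      ∃ A, ∀ t ∈ Icc 0 T, J k t ⊆ Icc (-A) A}) (T := T) (B := 2 * p * T) (C := 4 * p * T + 1)
    hT (by positivity) (by positivity) (fun J hJ k => (hJ k).1.mem_cadlagPaths)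
    (fun A y hy k => ⟨isStepPath_const T (Icc_mem_intervals _ _), A, fun _ _ =>
      Icc_subset_Icc (hy k).1 (hy k).2.2⟩)
    (fun A y _ => by simp [pathDist, intervalDist_self]) ?_ ?_ ?_ ?_ ?_ ?_
  · intro A y hy y' hy' w hw
    calc ∑ k, pathDist T (fun _ => Icc (y k).1 (y k).2) (w k)
        ≤ ∑ k, (T * (2 * dist y y') + pathDist T (fun _ => Icc (y' k).1 (y' k).2) (w k)) :=
          Finset.sum_le_sum fun k _ => (pathDist_const_triangle hT.le (hy k).2.1 (hy' k).2.1
            (hw k).1 (hw k).2.choose_spec).trans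
            (by gcongr; exact abs_add_abs_le_dist y y' k)
      _ = 2 * p * T * dist y y' + ∑ k, pathDist T (fun _ => Icc (y' k).1 (y' k).2) (w k) := by
          rw [Finset.sum_add_distrib, Finset.sum_const, Finset.card_univ, Fintype.card_fin,
            nsmul_eq_mul]
          ring
  · intro l hl
    have ha := (hS.timeScale_spec hl.1).1
    filter_upwards [(hη l hl).ae_isRegularPath hS] with ω hω k
    refine ⟨hω.isStepPath _ _ ha T, ?_⟩
    obtain ⟨L, R, hi, hL, hR⟩ := hω.exists_Ioo (timeScale μS l * T)
      ⌊(spaceScale μS l : ℝ) * x k⌋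
    refine ⟨max |((L : ℝ) + 1) / spaceScale μS l| |((R : ℝ) - 1) / spaceScale μS l|,
      fun t ht => ?_⟩
    have h1 : timeScale μS l * t ≤ timeScale μS l * T := mul_le_mul_of_nonneg_left ht.2 ha.le
    exact (hω.rescale_cluster_subset _ hi (mul_nonneg ha.le ht.1) (h1.trans_lt hL)
      (h1.trans_lt hR)).trans (Icc_subset_Icc
        (neg_le.1 ((neg_le_abs _).trans (le_max_left _ _)))
        ((le_abs_self _).trans (le_max_right _ _)))
  · refine .of_forall fun ω k => ⟨isStepPath_const T (limitCluster_mem_intervals (π ω) 0 (x k)), ?_⟩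
    refine ⟨max |sSup {y | y ≤ x k ∧ limitProcess (π ω) 0 y = false}|
      |sInf {y | x k ≤ y ∧ limitProcess (π ω) 0 y = false}|, fun t _ => ?_⟩
    exact Icc_subset_Icc (neg_le.1 ((neg_le_abs _).trans (le_max_left _ _)))
      ((le_abs_self _).trans (le_max_right _ _))
  · exact fun F hF l hl => (hη l hl).aestronglyMeasurable_paths hS _ _
      (hS.timeScale_spec hl.1).1 hT hF
  · intro N h r ε hh hr hε
    -- The error due to matches is taken as `h / (p + 1)` for each path, so that the `p` of them use
    -- at most the spare `h` in `C h`.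
    filter_upwards [eventually_measure_paths_le hM hS hη hT x N hh hε
      (show 0 < h / (p + 1) by positivity)] with l hl
    refine (measure_mono ?_).trans hl
    rintro ω ⟨hbr, hle⟩
    refine ⟨hbr, fun hall => hle.not_gt ?_⟩
    calc _ ≤ ∑ k : Fin p, (4 * h * T + h / (p + 1)) := Finset.sum_le_sum fun k _ => hall k
      _ < r := by
        rw [Finset.sum_const, Finset.card_univ, Fintype.card_fin, nsmul_eq_mul]
        have : (p : ℝ) * (h / (p + 1)) ≤ h := by
          rw [mul_div_assoc', div_le_iff₀ (by positivity)]
          nlinarith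
        linarith
  · intro N h hh
    filter_upwards [hπ.ae_intervalDist_limitCluster_le x N hh] with ω hω hbr
    calc _ ≤ ∑ k : Fin p, T * (2 * h) := Finset.sum_le_sum fun k _ => by
          have h1 : ∀ t, limitCluster (π ω) t (x k) = limitCluster (π ω) 0 (x k) := fun _ => rfl
          simp only [pathDist, h1]
          rw [intervalIntegral.integral_const, sub_zero, smul_eq_mul]
          exact mul_le_mul_of_nonneg_left (hω hbr k 0) hT.le
      _ ≤ (4 * p * T + 1) * h := by
        rw [Finset.sum_const, Finset.card_univ, Fintype.card_fin, nsmul_eq_mul]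
        have : 0 ≤ (p : ℝ) * T * h := by positivity
        nlinarith

end Main

end ForestFire

theorem mainTheorem4
    (μS μM : Measure ℝ) (hM : ForestFire.HypM μM) (hS : ForestFire.HypSZero μS)
    {Ω : ℝ → Type*} [∀ l, MeasurableSpace (Ω l)]
    (P : ∀ l, Measure (Ω l)) [∀ l, IsProbabilityMeasure (P l)]
    (S M : ∀ l, ℤ → ℕ → Ω l → ℝ) (η : ∀ l, Ω l → ℝ → ℤ → Bool)
    (hη : ∀ l ∈ Set.Ioc (0 : ℝ) 1,
      ForestFire.IsForestFire (P l) μS (ForestFire.slowedLaw μM l) (S l) (M l) (η l))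
    {Ω' : Type*} [MeasurableSpace Ω'] (P' : Measure Ω') [IsProbabilityMeasure P']
    (π : Ω' → Measure ℝ) (hπ : ForestFire.IsPoissonMeasure P' π) :
    (∀ T : ℝ, 0 < T → ∀ (p : ℕ) (x : Fin p → ℝ),
      ForestFire.TendstoInLaw
        {J : Fin p → ℝ → Set ℝ | ∀ k, J k ∈ ForestFire.cadlagPaths T}
        (fun I J => ∑ k, ForestFire.pathDist T (I k) (J k))
        P (fun l ω k t => ForestFire.rescaledCluster μS l (η l ω) t (x k))
        P' (fun ω k t => ForestFire.limitCluster (π ω) t (x k))) ∧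
    (∀ (p : ℕ) (t x : Fin p → ℝ), (∀ k, 0 < t k) →
      ForestFire.TendstoInLaw
        {I : Fin p → Set ℝ | ∀ k, I k ∈ ForestFire.intervals}
        (fun I J => ∑ k, ForestFire.intervalDist (I k) (J k))
        P (fun l ω k => ForestFire.rescaledCluster μS l (η l ω) (t k) (x k))
        P' (fun ω k => ForestFire.limitCluster (π ω) (t k) (x k))) :=
  ⟨fun _ hT _ x => ForestFire.tendstoInLaw_paths hM hS hη hπ hT x,
    fun _ t x ht => ForestFire.tendstoInLaw_clusters hM hS hη hπ t x ht⟩
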